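/- Let $\zeta(s_1,s_2)$ denote the double zeta function, i.e. the analytic continuation of $\sum_{0<m_1<m_2} m_1^{-s_1}m_2^{-s_2}$ (absolutely convergent for $\Re s_2>1$, $\Re(s_1+s_2)>2$); the continuation exists and is holomorphic on $\mathbb{C}^2$ outside the hyperplanes $s_2=1$, $s_1+s_2=1$ and $s_1+s_2=2-2n$ $(n=0,1,2,\dots)$. Put $f(s)=2^s\pi^{s-1}\Gamma(1-s)$, let $(s)_j=s(s+1)\cdots(s+j-1)$, and let $\cot^{(j)}$ be the $j$-th derivative of the cotangent. For complex $s_1,s_2$ with $s_1+s_2\neq 0$ put $r_1=\frac{s_1}{s_1+s_2}$, $r_2=\frac{s_2}{s_1+s_2}$, and for $j\ge 0$ let $c_j$ be the coefficient of $x^j$ in the Taylor expansion of $(1+xr_2)^{-s_1}(1-xr_1)^{-s_2}$ at $x=0$ (principal branches). Then $$c_j=\sum_{\substack{l_2,\dots,l_j\ge 0\\ 2l_2+3l_3+\cdots+jl_j=j}}(s_1+s_2)^{l_2+\cdots+l_j}\prod_{k=2}^{j}\frac{1}{l_k!}\left(\frac{r_1(-r_2)^k+r_2r_1^k}{k}\right)^{l_k}\qquad(j\ge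 0).$$ Moreover, fix a real number $\epsilon>0$ and an integer $N\ge 0$. For complex $s_1,s_2$ satisfying $|\Im s_1|<\frac1\epsilon$, $|\Im s_2|<\frac1\epsilon$, $\epsilon<\frac{\Re s_1}{\Re(s_1+s_2)}<1-\epsilon$ and $|s_1+s_2-2k|>|s_1+s_2|^{-1/\epsilon}$ for all $k\in\mathbb{Z}$, we have, as $\Re s_1,\Re s_2\to-\infty$, $$\frac{\zeta(s_1,s_2)}{f(s_1+s_2)}=-\frac12\sin\left(\frac{\pi}{2}(s_1+s_2)\right)+\frac12\cos\left(\frac{\pi}{2}(s_1+s_2)\right)\sum_{j=0}^{2N}\frac{\pi^j\cot^{(j)}(\pi r_2)}{(s_1+s_2)_j}\,c_j+O\left(|s_1+s_2|^{-N-1}\right).$$ That is, there are constants $C,R>0$ depending only on $\epsilon$ and $N$ such that, for all such $s_1,s_2$ with $\Re s_1<-R$ and $\Re s_2<-R$, the difference of $\zeta(s_1,s_2)/f(s_1+s_2)$ and the explicit terms on the right is at most $C|s_1+s_2|^{-N-1}$ in absolute value. -/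

import Mathlib

open Complex

noncomputable section

/-- The domain of holomorphy of the double zeta function: the complement in `ℂ²` of the
hyperplanes `s₂ = 1`, `s₁ + s₂ = 1` and `s₁ + s₂ = 2, 0, -2, -4, …`. -/
def doubleZetaDomain : Set (ℂ × ℂ) :=
  {s | s.2 ≠ 1 ∧ s.1 + s.2 ≠ 1 ∧ ∀ n : ℕ, s.1 + s.2 ≠ 2 - 2 * (n : ℂ)}

/-- `Z` is the analytic continuation of the double series `∑_{0 < m₁ < m₂} 1 / (m₁^s₁ m₂^s₂)`:
it is the (absolutely convergent) sum of the series for `Re s₂ > 1`, `Re (s₁ + s₂) > 2`, and it is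
holomorphic on the connected open set `doubleZetaDomain`. The identity theorem makes `Z` unique
on that set. -/
def IsDoubleZetaContinuation (Z : ℂ × ℂ → ℂ) : Prop :=
  DifferentiableOn ℂ Z doubleZetaDomain ∧
    ∀ s : ℂ × ℂ, 1 < s.2.re → 2 < (s.1 + s.2).re →
      HasSum (fun m : {m : ℕ × ℕ // 0 < m.1 ∧ m.1 < m.2} =>
        1 / ((m.1.1 : ℂ) ^ s.1 * (m.1.2 : ℂ) ^ s.2)) (Z s)

open Classical in
/-- The double zeta function `ζ(s₁, s₂)` of Euler–Zagier type, as the analytic continuation of its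
defining series. That the continuation exists is not built in: the main theorem asserts it. -/
def doubleZeta : ℂ × ℂ → ℂ :=
  if h : ∃ Z : ℂ × ℂ → ℂ, IsDoubleZetaContinuation Z then h.choose else 0

/-- `f(s) = 2^s π^(s-1) Γ(1-s)`. -/
def zetaFactor (s : ℂ) : ℂ :=
  (2 : ℂ) ^ s * (Real.pi : ℂ) ^ (s - 1) * Complex.Gamma (1 - s)

/-- The coefficient of `x^j` in the Taylor expansion of `p(x)` at `x = 0`. -/
def taylorCoeff (p : ℂ → ℂ) (j : ℕ) : ℂ :=
  iteratedDeriv j p 0 / (Nat.factorial j : ℂ)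

/-- `r₁ = s₁ / (s₁ + s₂)`. -/
def ratio₁ (s₁ s₂ : ℂ) : ℂ := s₁ / (s₁ + s₂)

/-- `r₂ = s₂ / (s₁ + s₂)`. -/
def ratio₂ (s₁ s₂ : ℂ) : ℂ := s₂ / (s₁ + s₂)

/-- `c_j`, the coefficient of `x^j` in `(1 + x r₂)^(-s₁) (1 - x r₁)^(-s₂)`. -/
def cCoeff (s₁ s₂ : ℂ) (j : ℕ) : ℂ :=
  taylorCoeff (fun x : ℂ =>
    (1 + x * ratio₂ s₁ s₂) ^ (-s₁) * (1 - x * ratio₁ s₁ s₂) ^ (-s₂)) j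

/-- The tuples `(l_2, …, l_j)` of natural numbers with `2 l_2 + 3 l_3 + ⋯ + j l_j = j`. (Each
entry is automatically at most `j`, so the range imposes no restriction.) -/
def weightTuples (j : ℕ) : Finset (Finset.Icc 2 j → ℕ) :=
  (Fintype.piFinset fun _ : Finset.Icc 2 j => Finset.range (j + 1)).filter
    fun l => ∑ k : Finset.Icc 2 j, (k : ℕ) * l k = j

/-- The right-hand side of the explicit formula for `c_j`. -/
def cExplicit (s₁ s₂ : ℂ) (j : ℕ) : ℂ :=
  ∑ l ∈ weightTuples j,
    (s₁ + s₂) ^ (∑ k, l k) *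
      ∏ k : Finset.Icc 2 j,
        1 / (Nat.factorial (l k) : ℂ) *
          ((ratio₁ s₁ s₂ * (-ratio₂ s₁ s₂) ^ (k : ℕ) +
            ratio₂ s₁ s₂ * ratio₁ s₁ s₂ ^ (k : ℕ)) / ((k : ℕ) : ℂ)) ^ l k

end

/-! Write s = s₁ + s₂ and A = -Re s. Euler–Maclaurin summation over the larger index gives ζ(s₁, s₂)
= Σ_j (B_j/j!) (s₂)_{j-1} ζ(s + j - 1) plus a remainder (`emZeta`). Letting the order grow yields
the analytic continuation; taking the order close to A is the starting point of the asymptotics.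

For n = 2k + 1 with Re(s + n) < 0 the functional equation replaces ζ(s + n) by f(s + n) sin(π(s +
n)/2) ζ(1 - s - n). Since f(s + n) = (-2π)^n f(s)/(s)_n, and B_{2k+2} is a multiple of ζ(2k + 2),
the corresponding term divided by f(s) is -(cos(πs/2)/π) ζ(2k + 2) μ_n ζ(1 - s - n) with μ_n = (s
r₂)_n/(s)_n (`emTerm_even`). The last zeta value is 1 up to an exponentially small error in the
range used.

Formally μ_n is the n-th moment of a beta law with parameters s r₂, s r₁ and mean r₂. Expanding
about the mean, μ_n = Σ_j C(n, j) r₂^(n-j) ν_j with ν_j = j! c_j/(s)_j = O(|s|^(-⌈j/2⌉)), so keeping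
j ≤ 2N costs O(|s|^(-N-1)) (`factorial_mul_cCoeff`, `centralMoment_bound`, `moment_error`). For
fixed j the sum over k is, up to j!, the j-th derivative of Σ ζ(2k+2) x^(2k+1) = (1/x - π cot πx)/2
at r₂ (`hasSum_zeta_mul_truncMoment`). The derivatives of 1/x assemble the same expansion of μ_{-1}
= (s - 1)/(s₂ - 1), which is the Euler–Maclaurin term j = 0, and the two cancel. The term j = 1
gives the sine.

Terms with n ≥ ⌈-Re s₂⌉ and the remainder are, relative to f(s), at most a power of A times the
inverse of a binomial coefficient "A choose -Re s₂", hence exponentially small because Re s₁/Re s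
stays away from 0 and 1 (`exists_tail_term_le`, `exists_remainder_le`). Separation from the even
integers limits the effect of the pole of ζ to a power of A.

The formula for c_j holds because the logarithm of the generating function is s Σ_{k≥2} (r₁(-r₂)^k +
r₂ r₁^k) x^k/k. In the proof both sides are shown to satisfy the same second-order recurrence
(`cCoeff_rec`, `coeff_truncExp_rec`). -/

/-! ### Taylor coefficients at the origin. -/

theorem taylorCoeff_congr {f g : ℂ → ℂ} (h : f =ᶠ[nhds 0] g) (j : ℕ) :
    taylorCoeff f j = taylorCoeff g j := by
  rw [taylorCoeff, taylorCoeff, h.iteratedDeriv_eq]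

theorem taylorCoeff_zero (f : ℂ → ℂ) : taylorCoeff f 0 = f 0 := by
  simp [taylorCoeff]

theorem taylorCoeff_add {f g : ℂ → ℂ} (hf : AnalyticAt ℂ f 0) (hg : AnalyticAt ℂ g 0) (j : ℕ) :
    taylorCoeff (fun x => f x + g x) j = taylorCoeff f j + taylorCoeff g j := by
  simp only [taylorCoeff]
  rw [iteratedDeriv_fun_add hf.contDiffAt hg.contDiffAt, add_div]

theorem taylorCoeff_const_mul (f : ℂ → ℂ) (c : ℂ) (j : ℕ) :
    taylorCoeff (fun x => c * f x) j = c * taylorCoeff f j := by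
  simp only [taylorCoeff]
  rw [iteratedDeriv_const_mul_field, mul_div_assoc]

theorem taylorCoeff_id_mul_succ {f : ℂ → ℂ} (hf : AnalyticAt ℂ f 0) (j : ℕ) :
    taylorCoeff (fun x => x * f x) (j + 1) = taylorCoeff f j := by
  have h : iteratedDeriv (j + 1) (fun x => x * f x) 0 = (j + 1) * iteratedDeriv j f 0 := by
    rw [iteratedDeriv_fun_mul (f := fun x => x) contDiffAt_id hf.contDiffAt,
      Finset.sum_eq_single_of_mem 1 (by simp)]
    · rw [iteratedDeriv_fun_id_zero]; simp
    · intro i _ hi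
      rw [iteratedDeriv_fun_id_zero]; simp [hi]
  rw [taylorCoeff, taylorCoeff, h, Nat.factorial_succ]
  have h2 : (j : ℂ) + 1 ≠ 0 := by exact_mod_cast Nat.succ_ne_zero j
  push_cast
  rw [mul_div_mul_left _ _ h2]

theorem taylorCoeff_deriv (f : ℂ → ℂ) (j : ℕ) :
    taylorCoeff (deriv f) j = (j + 1) * taylorCoeff f (j + 1) := by
  rw [taylorCoeff, taylorCoeff, iteratedDeriv_succ', Nat.factorial_succ]
  have h2 : (j : ℂ) + 1 ≠ 0 := by exact_mod_cast Nat.succ_ne_zero j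
  have h3 : (Nat.factorial j : ℂ) ≠ 0 := by exact_mod_cast Nat.factorial_ne_zero j
  push_cast
  field_simp

theorem ratio_add {s₁ s₂ : ℂ} (h : s₁ + s₂ ≠ 0) : ratio₁ s₁ s₂ + ratio₂ s₁ s₂ = 1 := by
  rw [ratio₁, ratio₂, ← add_div, div_self h]

theorem mul_ratio₁ {s₁ s₂ : ℂ} (h : s₁ + s₂ ≠ 0) : (s₁ + s₂) * ratio₁ s₁ s₂ = s₁ := by
  rw [ratio₁, mul_div_cancel₀ _ h]

theorem mul_ratio₂ {s₁ s₂ : ℂ} (h : s₁ + s₂ ≠ 0) : (s₁ + s₂) * ratio₂ s₁ s₂ = s₂ := by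
  rw [ratio₂, mul_div_cancel₀ _ h]

/-! ### The recurrence for c_j from the differential equation of its generating function. -/

section CCoeff
variable (s₁ s₂ : ℂ)

/-- The generating function of the coefficients `cCoeff s₁ s₂`. -/
noncomputable def cGen (x : ℂ) : ℂ :=
  (1 + x * ratio₂ s₁ s₂) ^ (-s₁) * (1 - x * ratio₁ s₁ s₂) ^ (-s₂)

theorem eventually_mem_slitPlane :
    ∀ᶠ x : ℂ in nhds 0, 1 + x * ratio₂ s₁ s₂ ∈ slitPlane ∧ 1 - x * ratio₁ s₁ s₂ ∈ slitPlane := by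
  refine Filter.Eventually.and ?_ ?_
  · exact ContinuousAt.eventually_mem (f := fun x : ℂ => 1 + x * ratio₂ s₁ s₂) (by fun_prop)
      (isOpen_slitPlane.mem_nhds (by simp))
  · exact ContinuousAt.eventually_mem (f := fun x : ℂ => 1 - x * ratio₁ s₁ s₂) (by fun_prop)
      (isOpen_slitPlane.mem_nhds (by simp))

theorem cGen_analyticAt : AnalyticAt ℂ (cGen s₁ s₂) 0 := by
  unfold cGen
  refine AnalyticAt.mul (AnalyticAt.cpow (by fun_prop) (by fun_prop) (by simp))
    (AnalyticAt.cpow (by fun_prop) (by fun_prop) (by simp))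

variable {s₁ s₂}

/-- With s₁ = s r₁ and s₂ = s r₂, the logarithmic derivative is s r₁ r₂ (-1/(1 + r₂x) + 1/(1 -
r₁x)), whose numerator collapses to s r₁ r₂ x because r₁ + r₂ = 1. The nested factors of x let
coefficients be read off by index shifts. -/
theorem cGen_ode (h : s₁ + s₂ ≠ 0) : ∀ᶠ x : ℂ in nhds 0,
    deriv (cGen s₁ s₂) x + (ratio₂ s₁ s₂ - ratio₁ s₁ s₂) * (x * deriv (cGen s₁ s₂) x) =
      ratio₁ s₁ s₂ * ratio₂ s₁ s₂ * (x * (x * deriv (cGen s₁ s₂) x)) +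
      (s₁ + s₂) * ratio₁ s₁ s₂ * ratio₂ s₁ s₂ * (x * cGen s₁ s₂ x) := by
  filter_upwards [eventually_mem_slitPlane s₁ s₂] with x ⟨h1, h2⟩
  have hr := ratio_add h
  have e1 := mul_ratio₁ h
  have e2 := mul_ratio₂ h
  set r₁ := ratio₁ s₁ s₂ with hr₁
  set r₂ := ratio₂ s₁ s₂ with hr₂
  have d1 : HasDerivAt (fun x : ℂ => 1 + x * r₂) r₂ x := by
    simpa using ((hasDerivAt_id x).mul_const r₂).const_add 1
  have d2 : HasDerivAt (fun x : ℂ => 1 - x * r₁) (-r₁) x := by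
    simpa using ((hasDerivAt_id x).mul_const r₁).const_sub 1
  have n1 := slitPlane_ne_zero h1
  have n2 := slitPlane_ne_zero h2
  have d := (d1.cpow_const (c := -s₁) h1).mul (d2.cpow_const (c := -s₂) h2)
  rw [cpow_sub _ _ n1, cpow_sub _ _ n2, cpow_one, cpow_one] at d
  have hd : deriv (cGen s₁ s₂) x = _ := d.deriv
  rw [hd]
  simp only [cGen, ← hr₁, ← hr₂]
  generalize (1 + x * r₂) ^ (-s₁) = A
  generalize (1 - x * r₁) ^ (-s₂) = B
  clear_value r₁ r₂
  generalize hs : s₁ + s₂ = s at *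
  have huv : 1 + (r₂ - r₁) * x - r₁ * r₂ * x ^ 2 = (1 + x * r₂) * (1 - x * r₁) := by ring
  have hD : -s₁ * (A / (1 + x * r₂)) * r₂ * B + A * (-s₂ * (B / (1 - x * r₁)) * -r₁) =
      s * r₁ * r₂ * x * (A * B) / ((1 + x * r₂) * (1 - x * r₁)) := by
    rw [eq_div_iff (mul_ne_zero n1 n2), ← e1, ← e2]
    have i1 := div_mul_cancel₀ A n1
    have i2 := div_mul_cancel₀ B n2
    linear_combination (-s * r₁ * r₂ * B * (1 - x * r₁)) * i1 +
      (s * r₁ * r₂ * A * (1 + x * r₂)) * i2 + (s * r₁ * r₂ * A * B * x) * hr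
  rw [hD]
  have := div_mul_cancel₀ (s * r₁ * r₂ * x * (A * B)) (mul_ne_zero n1 n2)
  linear_combination this

theorem cCoeff_eq (j : ℕ) : cCoeff s₁ s₂ j = taylorCoeff (cGen s₁ s₂) j := rfl

theorem cCoeff_zero : cCoeff s₁ s₂ 0 = 1 := by
  rw [cCoeff_eq, taylorCoeff_zero]; simp [cGen]

theorem cGen_ode_coeff (h : s₁ + s₂ ≠ 0) (j : ℕ) :
    taylorCoeff (deriv (cGen s₁ s₂)) j + (ratio₂ s₁ s₂ - ratio₁ s₁ s₂) *
      taylorCoeff (fun x => x * deriv (cGen s₁ s₂) x) j =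
    ratio₁ s₁ s₂ * ratio₂ s₁ s₂ *
      taylorCoeff (fun x => x * (x * deriv (cGen s₁ s₂) x)) j +
    (s₁ + s₂) * ratio₁ s₁ s₂ * ratio₂ s₁ s₂ * taylorCoeff (fun x => x * cGen s₁ s₂ x) j := by
  have hg := cGen_analyticAt s₁ s₂
  have hd : AnalyticAt ℂ (fun x => deriv (cGen s₁ s₂) x) 0 := hg.deriv
  have h1 : AnalyticAt ℂ (fun x => x * deriv (cGen s₁ s₂) x) 0 := analyticAt_id.fun_mul hd
  have h2 : AnalyticAt ℂ (fun x => x * (x * deriv (cGen s₁ s₂) x)) 0 := analyticAt_id.fun_mul h1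
  have h3 : AnalyticAt ℂ (fun x => x * cGen s₁ s₂ x) 0 := analyticAt_id.fun_mul hg
  have := taylorCoeff_congr (cGen_ode h) j
  rw [taylorCoeff_add hd (analyticAt_const.fun_mul h1), taylorCoeff_const_mul,
    taylorCoeff_add (analyticAt_const.fun_mul h2) (analyticAt_const.fun_mul h3),
    taylorCoeff_const_mul, taylorCoeff_const_mul] at this
  exact this

theorem cCoeff_one (h : s₁ + s₂ ≠ 0) : cCoeff s₁ s₂ 1 = 0 := by
  have := cGen_ode_coeff h 0
  rw [taylorCoeff_deriv] at this
  simpa [taylorCoeff_zero, ← cCoeff_eq] using this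

theorem cCoeff_rec (h : s₁ + s₂ ≠ 0) (j : ℕ) :
    ((j : ℂ) + 2) * cCoeff s₁ s₂ (j + 2) =
      (j + 1) * (ratio₁ s₁ s₂ - ratio₂ s₁ s₂) * cCoeff s₁ s₂ (j + 1) +
      ratio₁ s₁ s₂ * ratio₂ s₁ s₂ * (s₁ + s₂ + j) * cCoeff s₁ s₂ j := by
  have hg := cGen_analyticAt s₁ s₂
  have hd : AnalyticAt ℂ (fun x => deriv (cGen s₁ s₂) x) 0 := hg.deriv
  have h1 : AnalyticAt ℂ (fun x => x * deriv (cGen s₁ s₂) x) 0 := analyticAt_id.fun_mul hd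
  have key := cGen_ode_coeff h (j + 1)
  rw [taylorCoeff_id_mul_succ hg, taylorCoeff_id_mul_succ hd, taylorCoeff_id_mul_succ h1,
    taylorCoeff_deriv, taylorCoeff_deriv] at key
  have e : taylorCoeff (fun x => x * deriv (cGen s₁ s₂) x) j = j * cCoeff s₁ s₂ j := by
    cases j with
    | zero => simp [taylorCoeff_zero]
    | succ i => rw [taylorCoeff_id_mul_succ hd, taylorCoeff_deriv, cCoeff_eq]; push_cast; ring
  rw [e] at key
  simp only [← cCoeff_eq] at key
  push_cast at key
  linear_combination key

end CCoeff

/-! ### The explicit formula for c_j through products of truncated exponentials. -/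

section Explicit
open Polynomial

/-- The truncated exponential `∑_{l ≤ J} (a X^k)^l / l!`. -/
noncomputable def truncExp (J k : ℕ) (a : ℂ) : ℂ[X] :=
  ∑ l ∈ Finset.range (J + 1), monomial (k * l) (a ^ l / (Nat.factorial l : ℂ))

theorem coeff_zero_truncExp {J k : ℕ} (hk : k ≠ 0) (a : ℂ) : (truncExp J k a).coeff 0 = 1 := by
  rw [truncExp, finsetSum_coeff, Finset.sum_eq_single_of_mem 0 (by simp)]
  · simp
  · intro l _ hl
    rw [coeff_monomial, if_neg]
    simp [hk, hl]

/-- The full exponential of a X^k solves y' = k a X^(k-1) y exactly; truncation leaves only the top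
term, of degree k - 1 + kJ ≥ J. -/
theorem dvd_derivative_truncExp {J k : ℕ} (hk : 2 ≤ k) (a : ℂ) :
    (X : ℂ[X]) ^ J ∣ derivative (truncExp J k a) - C (k * a) * X ^ (k - 1) * truncExp J k a := by
  have e : derivative (truncExp J k a) - C (k * a) * X ^ (k - 1) * truncExp J k a =
      - (C (k * a) * X ^ (k - 1) * monomial (k * J) (a ^ J / (Nat.factorial J : ℂ))) := by
    obtain ⟨k, rfl⟩ : ∃ i, k = i + 1 := ⟨k - 1, by omega⟩
    have e1 : derivative (truncExp J (k + 1) a) = C (((k + 1 : ℕ) : ℂ) * a) * X ^ k *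
        ∑ l ∈ Finset.range J, monomial ((k + 1) * l) (a ^ l / (Nat.factorial l : ℂ)) := by
      rw [truncExp, derivative_sum, Finset.sum_range_succ', Finset.mul_sum]
      simp only [mul_zero, monomial_zero_left, derivative_C, add_zero]
      refine Finset.sum_congr rfl fun l _ => ?_
      rw [derivative_monomial, C_mul_X_pow_eq_monomial, monomial_mul_monomial]
      have h3 : (Nat.factorial l : ℂ) ≠ 0 := by exact_mod_cast Nat.factorial_ne_zero l
      have h2 : (l : ℂ) + 1 ≠ 0 := by exact_mod_cast Nat.succ_ne_zero l
      have hd : (k + 1) * (l + 1) - 1 = k + (k + 1) * l := by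
        rw [mul_add, mul_one, ← add_assoc, Nat.add_sub_cancel, add_comm]
      rw [hd, Nat.factorial_succ]
      congr 1
      push_cast
      field_simp
      ring
    rw [e1, truncExp, Finset.sum_range_succ]
    simp only [Nat.add_sub_cancel]
    ring
  rw [e, dvd_neg, ← C_mul_X_pow_eq_monomial]
  refine Dvd.dvd.mul_left (Dvd.dvd.mul_left (pow_dvd_pow _ ?_) _) _
  nlinarith

theorem dvd_derivative_prod_truncExp (J : ℕ) (a : ℕ → ℂ) :
    (X : ℂ[X]) ^ J ∣ derivative (∏ k ∈ Finset.Icc 2 J, truncExp J k (a k)) -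
      (∑ k ∈ Finset.Icc 2 J, C (k * a k) * X ^ (k - 1)) *
        ∏ k ∈ Finset.Icc 2 J, truncExp J k (a k) := by
  rw [derivative_prod_finset, Finset.sum_mul, ← Finset.sum_sub_distrib]
  refine Finset.dvd_sum fun k hk => ?_
  rw [← Finset.mul_prod_erase _ _ hk]
  convert Dvd.dvd.mul_left (dvd_derivative_truncExp (Finset.mem_Icc.1 hk).1 (a k) (J := J))
    (∏ k ∈ (Finset.Icc 2 J).erase k, truncExp J k (a k)) using 1
  ring

/-- Two geometric series with denominators 1 + r₂X and 1 - r₁X, summed and cleared of denominators.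
The k = 1 term r₁(-r₂) + r₂r₁ vanishes, which is why the sum starts at 2. -/
theorem quadratic_mul_geom_sum (r₁ r₂ s : ℂ) (hr : r₁ + r₂ = 1) (J : ℕ) :
    (1 + C r₂ * X) * (1 - C r₁ * X) *
      (∑ k ∈ Finset.Icc 2 (J + 1), C (s * (r₁ * (-r₂) ^ k + r₂ * r₁ ^ k)) * X ^ (k - 1)) =
    C (s * r₁ * r₂) * X - X ^ (J + 1) * (C s * (C (r₁ * (-r₂) ^ (J + 2)) * (1 - C r₁ * X) +
      C (r₂ * r₁ ^ (J + 2)) * (1 + C r₂ * X))) := by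
  obtain rfl : r₁ = 1 - r₂ := by linear_combination hr
  induction J with
  | zero =>
    simp only [C_mul, C_sub, C_neg, C_pow, C_1]
    simp
    ring
  | succ J ih =>
    rw [Finset.sum_Icc_succ_top (by omega), mul_add, ih]
    simp only [C_mul, C_sub, C_neg, C_pow, C_1, C_add, Nat.add_sub_cancel]
    ring

/-- A solution of the logarithmic differential equation modulo X^(J+1) obeys the recurrence of
`cCoeff_rec` as far as the coefficient of X^(J+1), which is all that the comparison needs. -/
theorem coeff_truncExp_rec (r₁ r₂ s : ℂ) (hr : r₁ + r₂ = 1) (J : ℕ) (G : ℂ[X])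
    (hG : (X : ℂ[X]) ^ (J + 1) ∣ derivative G -
      (∑ k ∈ Finset.Icc 2 (J + 1), C (s * (r₁ * (-r₂) ^ k + r₂ * r₁ ^ k)) * X ^ (k - 1)) * G) :
    G.coeff 1 = 0 ∧ ∀ i < J, ((i : ℂ) + 2) * G.coeff (i + 2) =
      (i + 1) * (r₁ - r₂) * G.coeff (i + 1) + r₁ * r₂ * (s + i) * G.coeff i := by
  have hdvd : (X : ℂ[X]) ^ (J + 1) ∣
      (1 + C r₂ * X) * (1 - C r₁ * X) * derivative G - C (s * r₁ * r₂) * X * G := by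
    have h1 := (hG.mul_left ((1 + C r₂ * X) * (1 - C r₁ * X)))
    have h2 : (X : ℂ[X]) ^ (J + 1) ∣ X ^ (J + 1) * (C s * (C (r₁ * (-r₂) ^ (J + 2)) *
      (1 - C r₁ * X) + C (r₂ * r₁ ^ (J + 2)) * (1 + C r₂ * X))) * G :=
      (dvd_mul_right _ _).mul_right _
    convert h1.sub h2 using 1
    have := quadratic_mul_geom_sum r₁ r₂ s hr J
    linear_combination G * this
  rw [X_pow_dvd_iff] at hdvd
  have e : (1 + C r₂ * X) * (1 - C r₁ * X) * derivative G - C (s * r₁ * r₂) * X * G =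
      derivative G + C (r₂ - r₁) * (X * derivative G) - C (r₁ * r₂) * (X * (X * derivative G)) -
        C (s * r₁ * r₂) * (X * G) := by
    simp only [C_mul, C_sub]; ring
  rw [e] at hdvd
  constructor
  · have := hdvd 0 (by omega)
    simpa [coeff_derivative] using this
  · intro i hi
    have := hdvd (i + 1) (by omega)
    simp only [coeff_sub, coeff_add, coeff_C_mul, coeff_X_mul, coeff_derivative] at this
    have e : (X * derivative G).coeff i = i * G.coeff i := by
      cases i with
      | zero => simp
      | succ i => rw [coeff_X_mul, coeff_derivative]; push_cast; ring
    rw [e] at this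
    push_cast at this
    linear_combination this

/-- Expanding the product picks one exponent l_k ≤ j from each factor, and the power of X collected
is Σ k l_k. -/
theorem cExplicit_eq_coeff (s₁ s₂ : ℂ) (j : ℕ) :
    cExplicit s₁ s₂ j = (∏ k ∈ Finset.Icc 2 j, truncExp j k ((s₁ + s₂) *
      ((ratio₁ s₁ s₂ * (-ratio₂ s₁ s₂) ^ k + ratio₂ s₁ s₂ * ratio₁ s₁ s₂ ^ k) / k))).coeff j := by
  rw [← Finset.prod_coe_sort]
  simp only [truncExp]
  rw [Finset.prod_univ_sum, finsetSum_coeff, cExplicit, weightTuples, Finset.sum_filter]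
  refine Finset.sum_congr rfl fun l _ => ?_
  have e : ∀ (t : Finset (Finset.Icc 2 j)) (c : Finset.Icc 2 j → ℂ),
      ∏ k ∈ t, monomial ((k : ℕ) * l k) (c k) = monomial (∑ k ∈ t, (k : ℕ) * l k) (∏ k ∈ t, c k) := by
    intro t c
    induction t using Finset.induction_on with
    | empty => simp
    | insert a t ha ih => rw [Finset.prod_insert ha, ih, monomial_mul_monomial,
        Finset.sum_insert ha, Finset.prod_insert ha]
  rw [e, coeff_monomial]
  refine if_congr Iff.rfl ?_ rfl
  rw [← Finset.prod_pow_eq_pow_sum, ← Finset.prod_mul_distrib]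
  refine Finset.prod_congr rfl fun k _ => ?_
  rw [mul_pow]
  ring

theorem cCoeff_eq_cExplicit {s₁ s₂ : ℂ} (h : s₁ + s₂ ≠ 0) (j : ℕ) :
    cCoeff s₁ s₂ j = cExplicit s₁ s₂ j := by
  rw [cExplicit_eq_coeff]
  set a : ℕ → ℂ := fun k => (s₁ + s₂) *
      ((ratio₁ s₁ s₂ * (-ratio₂ s₁ s₂) ^ k + ratio₂ s₁ s₂ * ratio₁ s₁ s₂ ^ k) / k) with ha
  set G : ℂ[X] := ∏ k ∈ Finset.Icc 2 j, truncExp j k (a k) with hGdef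
  have h0 : G.coeff 0 = 1 := by
    rw [hGdef, coeff_zero_prod]
    refine Finset.prod_eq_one fun k hk => coeff_zero_truncExp ?_ _
    have := (Finset.mem_Icc.1 hk).1
    omega
  rcases j with _ | J
  · rw [h0, cCoeff_zero]
  have hG := dvd_derivative_prod_truncExp (J + 1) a
  have hsum : ∑ k ∈ Finset.Icc 2 (J + 1), C (k * a k) * (X : ℂ[X]) ^ (k - 1) =
      ∑ k ∈ Finset.Icc 2 (J + 1), C ((s₁ + s₂) * (ratio₁ s₁ s₂ * (-ratio₂ s₁ s₂) ^ k +
        ratio₂ s₁ s₂ * ratio₁ s₁ s₂ ^ k)) * X ^ (k - 1) := by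
    refine Finset.sum_congr rfl fun k hk => ?_
    have hk0 : (k : ℂ) ≠ 0 := by
      have := (Finset.mem_Icc.1 hk).1
      exact_mod_cast (by omega : k ≠ 0)
    congr 2
    simp only [ha]
    field_simp
  rw [hsum] at hG
  obtain ⟨h1, hrec⟩ := coeff_truncExp_rec _ _ _ (ratio_add h) J G hG
  have main : ∀ i, i ≤ J → cCoeff s₁ s₂ i = G.coeff i ∧ cCoeff s₁ s₂ (i + 1) = G.coeff (i + 1) := by
    intro i
    induction i with
    | zero => intro _; exact ⟨by rw [cCoeff_zero, h0], by rw [cCoeff_one h, h1]⟩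
    | succ i ih =>
      intro hi
      obtain ⟨e1, e2⟩ := ih (by omega)
      refine ⟨e2, ?_⟩
      have hne : (i : ℂ) + 2 ≠ 0 := by exact_mod_cast Nat.succ_ne_zero (i + 1)
      apply mul_left_cancel₀ hne
      rw [cCoeff_rec h, hrec i (by omega), e1, e2]
  exact (main J le_rfl).2

end Explicit

/-! ### Central moments of the formal beta law and their decay. -/

/-- The central moments `∑_i (j choose i) (-r₂)^(j-i) (s r₂)_i / (s)_i` of a formal beta
distribution with parameters `s r₂, s r₁`, defined through their three-term recurrence. -/
noncomputable def centralMoment (s r₁ r₂ : ℂ) : ℕ → ℂ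
  | 0 => 1
  | 1 => 0
  | j + 2 => (j + 1) / (s + j + 1) *
      ((r₁ - r₂) * centralMoment s r₁ r₂ (j + 1) + r₁ * r₂ * centralMoment s r₁ r₂ j)

theorem centralMoment_rec {s : ℂ} (r₁ r₂ : ℂ) (j : ℕ) (h : s + j + 1 ≠ 0) :
    (s + j + 1) * centralMoment s r₁ r₂ (j + 2) = (j + 1) *
      ((r₁ - r₂) * centralMoment s r₁ r₂ (j + 1) + r₁ * r₂ * centralMoment s r₁ r₂ j) := by
  rw [centralMoment, ← mul_assoc, mul_div_cancel₀ _ h]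

theorem ascPochhammer_eval_ne_zero {s : ℂ} {n : ℕ} (h : ∀ i < n, s + i ≠ 0) :
    (ascPochhammer ℂ n).eval s ≠ 0 := by
  induction n with
  | zero => simp
  | succ n ih =>
    rw [ascPochhammer_succ_eval]
    exact mul_ne_zero (ih fun i hi => h i (by omega)) (h n (by omega))

/-- Rescaling by j!/(s)_j turns `cCoeff_rec` into the recurrence of the central moments; this is how
the c_j enter the asymptotics. -/
theorem factorial_mul_cCoeff {s₁ s₂ : ℂ} (h0 : s₁ + s₂ ≠ 0) (j : ℕ)
    (h : ∀ i < j, s₁ + s₂ + i ≠ 0) :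
    (Nat.factorial j : ℂ) * cCoeff s₁ s₂ j / (ascPochhammer ℂ j).eval (s₁ + s₂) =
      centralMoment (s₁ + s₂) (ratio₁ s₁ s₂) (ratio₂ s₁ s₂) j := by
  induction j using Nat.twoStepInduction with
  | zero => simp [centralMoment, cCoeff_zero]
  | one => simp [centralMoment, cCoeff_one h0]
  | more j ih1 ih2 =>
    have hj1 : s₁ + s₂ + j + 1 ≠ 0 := by
      have := h (j + 1) (by omega); push_cast at this; rwa [← add_assoc] at this
    rw [centralMoment, ← ih1 fun i hi => h i (by omega), ← ih2 fun i hi => h i (by omega)]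
    have hP := ascPochhammer_eval_ne_zero (n := j) (s := s₁ + s₂) fun i hi => h i (by omega)
    have hrec := cCoeff_rec h0 j
    rw [ascPochhammer_succ_eval, ascPochhammer_succ_eval, Nat.factorial_succ, Nat.factorial_succ]
    have hj := h j (by omega)
    generalize (ascPochhammer ℂ j).eval (s₁ + s₂) = P at *
    generalize s₁ + s₂ = s at *
    push_cast
    rw [div_eq_iff (by rw [← add_assoc]; exact mul_ne_zero (mul_ne_zero hP hj) hj1)]
    field_simp
    linear_combination (Nat.factorial j : ℂ) * (s + j + 1) * hrec

/-- One step of the recurrence gains a factor 1/s over the two preceding moments, so the order rises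
by one every second step: the natural-number quotient (j + 1)/2 is ⌈j/2⌉. -/
theorem centralMoment_bound (j : ℕ) : ∃ C R : ℝ, 0 < C ∧ 1 ≤ R ∧ ∀ s r₁ r₂ : ℂ, ‖r₁‖ ≤ 1 →
    ‖r₂‖ ≤ 1 → R ≤ ‖s‖ → ‖centralMoment s r₁ r₂ j‖ ≤ C / ‖s‖ ^ ((j + 1) / 2) := by
  induction j using Nat.twoStepInduction with
  | zero => exact ⟨1, 1, one_pos, le_rfl, fun s r₁ r₂ _ _ _ => by simp [centralMoment]⟩
  | one => exact ⟨1, 1, one_pos, le_rfl, fun s r₁ r₂ _ _ _ => by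
      simp [centralMoment]⟩
  | more j ih1 ih2 =>
    obtain ⟨C₁, R₁, hC₁, hR₁, h₁⟩ := ih1
    obtain ⟨C₂, R₂, hC₂, hR₂, h₂⟩ := ih2
    refine ⟨2 * (j + 1) * (2 * C₂ + C₁), max (max R₁ R₂) (2 * (j + 1)), by positivity,
      le_max_of_le_left (le_max_of_le_left hR₁), fun s r₁ r₂ hr₁ hr₂ hs => ?_⟩
    simp only [max_le_iff] at hs
    obtain ⟨⟨hs1, hs2⟩, hs3⟩ := hs
    have hs0 : 1 ≤ ‖s‖ := hR₁.trans hs1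
    have b1 := h₁ s r₁ r₂ hr₁ hr₂ hs1
    have b2 := h₂ s r₁ r₂ hr₁ hr₂ hs2
    have b2' : ‖centralMoment s r₁ r₂ (j + 1)‖ ≤ C₂ / ‖s‖ ^ ((j + 1) / 2) :=
      b2.trans (div_le_div_of_nonneg_left hC₂.le (by positivity)
        (pow_le_pow_right₀ hs0 (by omega)))
    have hden : ‖s‖ / 2 ≤ ‖s + j + 1‖ := by
      have h1 : ‖s‖ ≤ ‖s + j + 1‖ + ‖((j : ℂ) + 1)‖ := by
        have := norm_sub_le (s + j + 1) ((j : ℂ) + 1)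
        rwa [show s + j + 1 - ((j : ℂ) + 1) = s by ring] at this
      have h2 : ‖((j : ℂ) + 1)‖ = j + 1 := by
        rw [← Nat.cast_succ, Complex.norm_natCast]; push_cast; ring
      linarith
    rw [centralMoment, norm_mul, norm_div, show (j + 2 + 1) / 2 = (j + 1) / 2 + 1 by omega, pow_succ]
    have h2 : ‖((j : ℂ) + 1)‖ = j + 1 := by
      rw [← Nat.cast_succ, Complex.norm_natCast]; push_cast; ring
    have hb : ‖(r₁ - r₂) * centralMoment s r₁ r₂ (j + 1) + r₁ * r₂ * centralMoment s r₁ r₂ j‖ ≤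
        (2 * C₂ + C₁) / ‖s‖ ^ ((j + 1) / 2) := by
      refine (norm_add_le _ _).trans ?_
      rw [norm_mul, norm_mul, norm_mul, add_div, mul_div_assoc]
      have hr : ‖r₁ - r₂‖ ≤ 2 := (norm_sub_le _ _).trans (by linarith)
      have hr' : ‖r₁‖ * ‖r₂‖ ≤ 1 := mul_le_one₀ hr₁ (norm_nonneg _) hr₂
      exact add_le_add (mul_le_mul hr b2' (norm_nonneg _) (by norm_num))
        ((mul_le_mul hr' b1 (norm_nonneg _) (by norm_num)).trans (one_mul _).le)
    calc _ ≤ (j + 1) / (‖s‖ / 2) * ((2 * C₂ + C₁) / ‖s‖ ^ ((j + 1) / 2)) := by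
          rw [h2]
          refine mul_le_mul ?_ hb (norm_nonneg _) (by positivity)
          exact div_le_div_of_nonneg_left (by positivity) (by positivity) hden
      _ = _ := by field_simp

/-- Here α_j stands for C(n, j) r₂^(n-j) and β_j for C(n+1, j) r₂^(n+1-j), with n complex so that n
= -1 is covered too. The exact moments satisfy (s + n) μ_{n+1} = (s r₂ + n) μ_n; for the truncated
sums the recurrence of ν telescopes and leaves only a boundary term in ν_J and ν_{J+1}. -/
theorem truncated_moment_rec {s r₁ r₂ : ℂ} (n : ℂ) {α β ν : ℕ → ℂ} (hr : r₁ + r₂ = 1)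
    (hα : ∀ j : ℕ, (j + 1) * r₂ * α (j + 1) = (n - j) * α j)
    (hβ0 : β 0 = r₂ * α 0) (hβ : ∀ j, β (j + 1) = r₂ * α (j + 1) + α j)
    (hν1 : ν 1 = 0) (J : ℕ) (hν : ∀ j < J, (s + j + 1) * ν (j + 2) = (j + 1) *
      ((r₁ - r₂) * ν (j + 1) + r₁ * r₂ * ν j)) :
    (s + n) * ∑ j ∈ Finset.range (J + 1), β j * ν j -
      (s * r₂ + n) * ∑ j ∈ Finset.range (J + 1), α j * ν j =
    -(r₁ * r₂ * (J + 1) * α (J + 1) * ν J + (s + J) * α J * ν (J + 1)) := by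
  obtain rfl : r₁ = 1 - r₂ := by linear_combination hr
  induction J with
  | zero =>
    have := hα 0
    simp only [zero_add, Finset.range_one, Finset.sum_singleton, hβ0, hν1] at *
    push_cast at *
    linear_combination (1 - r₂) * ν 0 * this
  | succ J ih =>
    rw [Finset.sum_range_succ, Finset.sum_range_succ _ (J + 1), hβ]
    have h1 := hα (J + 1)
    have h0 := hα J
    have h2 := hν J (by omega)
    have ih := ih fun j hj => hν j (by omega)
    push_cast at *
    linear_combination ih + α (J + 1) * h2 + (1 - r₂) * ν (J + 1) * h1 - ν (J + 1) * h0

/-- The truncation at order `J` of `∑_j (n choose j) r₂^(n-j) ν_j`, where `ν` are the central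
moments. -/
noncomputable def truncMoment (J : ℕ) (s r₁ r₂ : ℂ) (n : ℕ) : ℂ :=
  ∑ j ∈ Finset.range (J + 1), (n.choose j : ℂ) * r₂ ^ (n - j) * centralMoment s r₁ r₂ j

/-- The analogue of `truncMoment` for the moment of order `-1`. -/
noncomputable def truncMomentNegOne (J : ℕ) (s r₁ r₂ : ℂ) : ℂ :=
  ∑ j ∈ Finset.range (J + 1), (-1) ^ j * r₂⁻¹ ^ (j + 1) * centralMoment s r₁ r₂ j

theorem truncMoment_rec {s r₁ r₂ : ℂ} (J n : ℕ) (hs : ∀ j < J, s + (j : ℂ) + 1 ≠ 0)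
    (hr : r₁ + r₂ = 1) :
    (s + n) * truncMoment J s r₁ r₂ (n + 1) - (s * r₂ + n) * truncMoment J s r₁ r₂ n =
    -(r₁ * r₂ * (J + 1) * (n.choose (J + 1) * r₂ ^ (n - (J + 1))) * centralMoment s r₁ r₂ J +
      (s + J) * (n.choose J * r₂ ^ (n - J)) * centralMoment s r₁ r₂ (J + 1)) := by
  refine truncated_moment_rec (n : ℂ) (α := fun j => n.choose j * r₂ ^ (n - j))
    (β := fun j => (n + 1).choose j * r₂ ^ (n + 1 - j)) hr ?_ ?_ ?_ rfl J
    (fun j hj => centralMoment_rec _ _ _ (hs j hj))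
  · intro j
    rcases lt_or_ge j n with h | h
    · obtain ⟨m, rfl⟩ : ∃ m, n = j + 1 + m := ⟨n - (j + 1), by omega⟩
      have h1 := Nat.choose_succ_right_eq (j + 1 + m) j
      have h1' : (((j + 1 + m).choose (j + 1) : ℂ)) * (j + 1) = (j + 1 + m).choose j * (m + 1) := by
        rw [show j + 1 + m - j = m + 1 by omega] at h1
        exact_mod_cast h1
      rw [show j + 1 + m - (j + 1) = m by omega, show j + 1 + m - j = m + 1 by omega]
      push_cast
      linear_combination r₂ ^ (m + 1) * h1'
    · simp only [Nat.choose_eq_zero_of_lt (show n < j + 1 by omega)]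
      rcases h.lt_or_eq with h | rfl
      · simp [Nat.choose_eq_zero_of_lt h]
      · simp
  · simp [pow_succ, mul_comm]
  · intro j
    simp only [Nat.choose_succ_succ, Nat.add_sub_add_right]
    rcases lt_or_ge j n with h | h
    · obtain ⟨m, rfl⟩ : ∃ m, n = j + 1 + m := ⟨n - (j + 1), by omega⟩
      rw [show j + 1 + m - (j + 1) = m by omega, show j + 1 + m - j = m + 1 by omega]
      push_cast
      ring
    · simp [Nat.choose_eq_zero_of_lt (show n < j + 1 by omega)]

theorem truncMomentNegOne_rec {s r₁ r₂ : ℂ} (J : ℕ) (hs : ∀ j < J, s + (j : ℂ) + 1 ≠ 0)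
    (hr : r₁ + r₂ = 1) (hr₂ : r₂ ≠ 0) :
    (s - 1) - (s * r₂ - 1) * truncMomentNegOne J s r₁ r₂ =
    -(r₁ * r₂ * (J + 1) * ((-1) ^ (J + 1) * r₂⁻¹ ^ (J + 2)) * centralMoment s r₁ r₂ J +
      (s + J) * ((-1) ^ J * r₂⁻¹ ^ (J + 1)) * centralMoment s r₁ r₂ (J + 1)) := by
  have := truncated_moment_rec (s := s) (r₁ := r₁) (r₂ := r₂) (-1)
    (α := fun j => (-1) ^ j * r₂⁻¹ ^ (j + 1)) (ν := centralMoment s r₁ r₂)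
    -- For n = -1 the next moment has order 0 and equals 1, so only β_0 survives, while C(-1, j) =
    -- (-1)^j.
    (β := fun j => if j = 0 then 1 else 0) hr ?_ ?_ ?_ rfl J
    (fun j hj => centralMoment_rec _ _ _ (hs j hj))
  · simp only [ite_mul, one_mul, zero_mul] at this
    rw [Finset.sum_ite_eq' ] at this
    simp only [centralMoment] at this
    simpa [truncMomentNegOne, sub_eq_add_neg] using this
  · intro j
    have hi := mul_inv_cancel₀ hr₂
    linear_combination (-(j + 1) * (-1) ^ j * r₂⁻¹ ^ (j + 1)) * hi
  · simp [hr₂]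
  · intro j
    have hi := mul_inv_cancel₀ hr₂
    simp only [Nat.add_eq_zero_iff, one_ne_zero, and_false, if_false]
    linear_combination ((-1) ^ j * r₂⁻¹ ^ (j + 1)) * hi

theorem norm_truncMoment_le {C q : ℝ} (hq0 : 0 < q) (hq1 : q ≤ 1) {s r₁ r₂ : ℂ} {J : ℕ}
    (hr₂ : ‖r₂‖ ≤ q) (hν : ∀ j ≤ J, ‖centralMoment s r₁ r₂ j‖ ≤ C) (n : ℕ) :
    ‖truncMoment J s r₁ r₂ n‖ ≤ ((J + 1) * C / q ^ J) * ((n + 1) ^ J * q ^ n) := by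
  have hC : 0 ≤ C := (norm_nonneg _).trans (hν 0 (by omega))
  refine (norm_sum_le _ _).trans ?_
  refine (Finset.sum_le_card_nsmul _ _ (C / q ^ J * ((n + 1) ^ J * q ^ n)) fun j hj => ?_).trans ?_
  · have hj' : j ≤ J := by simpa [Nat.lt_succ_iff] using hj
    rw [norm_mul, norm_mul, norm_pow, Complex.norm_natCast]
    have h1 : (n.choose j : ℝ) ≤ (n + 1) ^ J := by
      calc (n.choose j : ℝ) ≤ (n : ℝ) ^ j := by exact_mod_cast Nat.choose_le_pow n j
        _ ≤ (n + 1 : ℝ) ^ j := by gcongr; linarith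
        _ ≤ _ := pow_le_pow_right₀ (by linarith [n.cast_nonneg (α := ℝ)]) hj'
    have h2 : ‖r₂‖ ^ (n - j) ≤ q ^ n / q ^ J := by
      rw [le_div_iff₀ (by positivity)]
      calc ‖r₂‖ ^ (n - j) * q ^ J ≤ q ^ (n - j) * q ^ J := by gcongr
        _ = q ^ (n - j + J) := by rw [pow_add]
        _ ≤ q ^ n := pow_le_pow_of_le_one hq0.le hq1 (by omega)
    calc _ ≤ ((n : ℝ) + 1) ^ J * (q ^ n / q ^ J) * C := by
          gcongr
          exact hν j hj'
      _ = _ := by ring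
  · rw [Finset.card_range, nsmul_eq_mul]
    push_cast
    exact le_of_eq (by ring)

/-- The moment `(s r₂)_n / (s)_n`. -/
noncomputable def rawMoment (s r₂ : ℂ) (n : ℕ) : ℂ :=
  (ascPochhammer ℂ n).eval (s * r₂) / (ascPochhammer ℂ n).eval s

theorem rawMoment_succ {s : ℂ} (r₂ : ℂ) (n : ℕ) (h : s + n ≠ 0) :
    (s + n) * rawMoment s r₂ (n + 1) = (s * r₂ + n) * rawMoment s r₂ n := by
  rw [rawMoment, rawMoment, ascPochhammer_succ_eval, ascPochhammer_succ_eval]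
  field_simp

theorem truncMoment_zero (J : ℕ) (s r₁ r₂ : ℂ) : truncMoment J s r₁ r₂ 0 = 1 := by
  rw [truncMoment, Finset.sum_eq_single_of_mem 0 (by simp)]
  · simp [centralMoment]
  · intro j _ hj
    rw [Nat.choose_eq_zero_of_lt (Nat.pos_of_ne_zero hj)]; simp

/-- With J = 2N the boundary term is O(|s|^(-N)), since both ν_{2N} and s ν_{2N+1} are; dividing by
s + n, or by s r₂ - 1, gains the last factor. For n ≥ 0 the error contracts by q at each step and
picks up a term of size (n+1)^(J+1) q^(n+1), which accumulates to n^(J+2) q^n and stays summable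
over n. -/
theorem moment_error (N : ℕ) {q δ : ℝ} (hq0 : 0 < q) (hq1 : q < 1) (hδ : 0 < δ) :
    ∃ K R : ℝ, 0 < K ∧ 1 ≤ R ∧ ∀ s r₁ r₂ : ℂ, r₁ + r₂ = 1 → ‖r₁‖ ≤ 1 → ‖r₂‖ ≤ q → δ ≤ ‖r₂‖ →
      R ≤ ‖s‖ →
      (δ * ‖s‖ ≤ ‖s * r₂ - 1‖ →
        ‖(s - 1) / (s * r₂ - 1) - truncMomentNegOne (2 * N) s r₁ r₂‖ ≤ K / ‖s‖ ^ (N + 1)) ∧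
      (∀ n, ‖truncMoment (2 * N) s r₁ r₂ n‖ ≤ K * ((n + 1) ^ (2 * N) * q ^ n)) ∧
      ∀ B : ℕ, (∀ i < B, ‖s * r₂ + i‖ ≤ q * ‖s + i‖ ∧ δ * ‖s‖ ≤ ‖s + i‖) → ∀ n ≤ B,
        ‖rawMoment s r₂ n - truncMoment (2 * N) s r₁ r₂ n‖ ≤
          K / ‖s‖ ^ (N + 1) * (n ^ (2 * N + 2) * q ^ n) := by
  choose C R hC hR hb using centralMoment_bound
  set J := 2 * N with hJ
  set C₀ := ∑ j ∈ Finset.range (J + 2), C j with hC₀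
  set R₀ := ∑ j ∈ Finset.range (J + 2), R j with hR₀
  have hCle : ∀ j ≤ J + 1, C j ≤ C₀ := fun j hj =>
    Finset.single_le_sum (f := C) (fun i _ => (hC i).le) (by simp; omega)
  have hRle : ∀ j ≤ J + 1, R j ≤ R₀ := fun j hj =>
    Finset.single_le_sum (f := R) (fun i _ => zero_le_one.trans (hR i)) (by simp; omega)
  have hC₀0 : 0 < C₀ := (hC 0).trans_le (hCle 0 (by omega))
  have hR₀1 : 1 ≤ R₀ := (hR 0).trans (hRle 0 (by omega))
  set K₁ := (J + 1 + (J + 1)) * C₀ / δ / q ^ (J + 2) with hK₁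
  set K₂ := (J + 1 + (J + 1)) * C₀ / δ / δ ^ (J + 2) with hK₂
  set K₃ := (J + 1) * C₀ / q ^ J with hK₃
  have hK₁0 : 0 < K₁ := by positivity
  have hK₂0 : 0 < K₂ := by positivity
  have hK₃0 : 0 < K₃ := by positivity
  refine ⟨K₁ + K₂ + K₃, R₀ + J, by positivity, le_add_of_le_of_nonneg hR₀1 J.cast_nonneg,
    fun s r₁ r₂ hr hr₁ hr₂ hr₂' hs' => ?_⟩
  have hs : R₀ ≤ ‖s‖ := le_trans (le_add_of_nonneg_right J.cast_nonneg) hs'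
  have hs0 : ∀ j < J, s + (j : ℂ) + 1 ≠ 0 := by
    intro j hj h
    have hj' : ((j + 1 : ℕ) : ℝ) ≤ J := by exact_mod_cast hj
    have e : s = -((j + 1 : ℕ) : ℂ) := by push_cast; linear_combination h
    rw [e, norm_neg, Complex.norm_natCast] at hs'
    linarith
  have hs1 : 1 ≤ ‖s‖ := hR₀1.trans hs
  have hν : ∀ j ≤ J + 1, ‖centralMoment s r₁ r₂ j‖ ≤ C₀ / ‖s‖ ^ ((j + 1) / 2) := fun j hj =>
    (hb j s r₁ r₂ hr₁ (hr₂.trans hq1.le) ((hRle j hj).trans hs)).trans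
      (by have := hCle j hj; gcongr)
  have hν' : ∀ j ≤ J, ‖centralMoment s r₁ r₂ j‖ ≤ C₀ := fun j hj =>
    (hν j (by omega)).trans (div_le_self hC₀0.le (one_le_pow₀ hs1))
  have hνJ : ‖centralMoment s r₁ r₂ J‖ ≤ C₀ / ‖s‖ ^ N := by
    have := hν J (by omega)
    rwa [show (J + 1) / 2 = N by omega] at this
  have hνJ1 : ‖centralMoment s r₁ r₂ (J + 1)‖ ≤ C₀ / ‖s‖ ^ (N + 1) := by
    have := hν (J + 1) (by omega)
    rwa [show (J + 1 + 1) / 2 = N + 1 by omega] at this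
  have hJn : ‖((J : ℂ) + 1)‖ = J + 1 := by
    rw [← Nat.cast_succ, Complex.norm_natCast]; push_cast; ring
  have hsJ : ‖s + J‖ ≤ (J + 1) * ‖s‖ := by
    refine (norm_add_le _ _).trans ?_
    rw [Complex.norm_natCast]
    nlinarith [J.cast_nonneg (α := ℝ)]
  -- the common estimate of the inhomogeneous term
  have hE : ∀ (a b : ℂ) (M : ℝ), ‖a‖ ≤ M → ‖b‖ ≤ M →
      ‖-(r₁ * r₂ * (J + 1) * a * centralMoment s r₁ r₂ J +
        (s + J) * b * centralMoment s r₁ r₂ (J + 1))‖ ≤ (J + 1 + (J + 1)) * C₀ / ‖s‖ ^ N * M := by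
    intro a b M ha hb
    have hM : 0 ≤ M := (norm_nonneg _).trans ha
    rw [norm_neg]
    refine (norm_add_le _ _).trans ?_
    rw [norm_mul, norm_mul, norm_mul, norm_mul, norm_mul, norm_mul, hJn]
    have h1 : ‖r₁‖ * ‖r₂‖ ≤ 1 := mul_le_one₀ hr₁ (norm_nonneg _) (hr₂.trans hq1.le)
    calc _ ≤ 1 * (J + 1) * M * (C₀ / ‖s‖ ^ N) + ((J + 1) * ‖s‖) * M * (C₀ / ‖s‖ ^ (N + 1)) := by
          gcongr
      _ = _ := by
          field_simp
          ring
  refine ⟨fun hδs => ?_, fun n => ?_, fun B hB => ?_⟩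
  · have hr₂0 : r₂ ≠ 0 := norm_pos_iff.1 (hδ.trans_le hr₂')
    have hne : s * r₂ - 1 ≠ 0 := norm_pos_iff.1 (lt_of_lt_of_le (by positivity) hδs)
    have key := truncMomentNegOne_rec J hs0 hr hr₂0
    have hi : ∀ k ≤ J + 2, ‖r₂⁻¹ ^ k‖ ≤ 1 / δ ^ (J + 2) := by
      intro k hk
      have hδ1 : δ ≤ 1 := hr₂'.trans (hr₂.trans hq1.le)
      rw [norm_pow, norm_inv, inv_pow, ← one_div]
      apply one_div_le_one_div_of_le (by positivity)
      calc δ ^ (J + 2) ≤ δ ^ k := pow_le_pow_of_le_one hδ.le hδ1 hk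
        _ ≤ _ := by gcongr
    have h1 : ‖(-1 : ℂ) ^ (J + 1) * r₂⁻¹ ^ (J + 2)‖ ≤ 1 / δ ^ (J + 2) := by
      simpa using hi (J + 2) le_rfl
    have h2 : ‖(-1 : ℂ) ^ J * r₂⁻¹ ^ (J + 1)‖ ≤ 1 / δ ^ (J + 2) := by
      simpa using hi (J + 1) (by omega)
    have e : (s - 1) / (s * r₂ - 1) - truncMomentNegOne J s r₁ r₂ =
        ((s - 1) - (s * r₂ - 1) * truncMomentNegOne J s r₁ r₂) / (s * r₂ - 1) := by
      field_simp
    rw [e, key, norm_div]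
    calc _ ≤ ((J + 1 + (J + 1)) * C₀ / ‖s‖ ^ N * (1 / δ ^ (J + 2))) / (δ * ‖s‖) := by
          gcongr
          exact hE _ _ _ h1 h2
      _ = K₂ / ‖s‖ ^ (N + 1) := by
          rw [hK₂]; field_simp; ring
      _ ≤ _ := by gcongr; linarith
  · refine (norm_truncMoment_le hq0 hq1.le hr₂ hν' n).trans ?_
    gcongr
    linarith
  · intro n
    induction n with
    | zero => intro _; simp [rawMoment, truncMoment_zero]
    | succ n ih =>
      intro hn
      have ih := ih (by omega)
      obtain ⟨hB1, hB2⟩ := hB n (by omega)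
      have hne : s + n ≠ 0 := norm_pos_iff.1 (lt_of_lt_of_le (by positivity) hB2)
      have key := truncMoment_rec J n hs0 hr
      have hch : ∀ k ≤ J + 1, ‖((n.choose k : ℂ)) * r₂ ^ (n - k)‖ ≤
          ((n + 1 : ℕ) : ℝ) ^ (J + 1) * (q ^ (n + 1) / q ^ (J + 2)) := by
        intro k hk
        rw [norm_mul, norm_pow, Complex.norm_natCast]
        have h1 : (n.choose k : ℝ) ≤ ((n + 1 : ℕ) : ℝ) ^ (J + 1) := by
          have : n.choose k ≤ (n + 1) ^ (J + 1) :=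
            (Nat.choose_le_pow n k).trans ((Nat.pow_le_pow_left (Nat.le_succ n) k).trans
              (Nat.pow_le_pow_right (Nat.succ_pos n) hk))
          exact_mod_cast this
        have h2 : ‖r₂‖ ^ (n - k) ≤ q ^ (n + 1) / q ^ (J + 2) := by
          rw [le_div_iff₀ (by positivity)]
          calc ‖r₂‖ ^ (n - k) * q ^ (J + 2) ≤ q ^ (n - k) * q ^ (J + 2) := by gcongr
            _ = q ^ (n - k + (J + 2)) := (pow_add _ _ _).symm
            _ ≤ q ^ (n + 1) := pow_le_pow_of_le_one hq0.le hq1.le (by omega)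
        gcongr
      have e : rawMoment s r₂ (n + 1) - truncMoment J s r₁ r₂ (n + 1) =
          (s * r₂ + n) / (s + n) * (rawMoment s r₂ n - truncMoment J s r₁ r₂ n) -
          ((s + n) * truncMoment J s r₁ r₂ (n + 1) - (s * r₂ + n) * truncMoment J s r₁ r₂ n) /
            (s + n) := by
        have := rawMoment_succ r₂ n hne
        field_simp
        linear_combination this
      rw [e, key]
      refine (norm_sub_le _ _).trans ?_
      rw [norm_mul, norm_div, norm_div]
      have hq' : ‖s * r₂ + n‖ / ‖s + n‖ ≤ q := by
        rw [div_le_iff₀ (norm_pos_iff.2 hne)]; exact hB1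
      calc _ ≤ q * ((K₁ + K₂ + K₃) / ‖s‖ ^ (N + 1) * (n ^ (J + 2) * q ^ n)) +
            ((J + 1 + (J + 1)) * C₀ / ‖s‖ ^ N *
              (((n + 1 : ℕ) : ℝ) ^ (J + 1) * (q ^ (n + 1) / q ^ (J + 2)))) / (δ * ‖s‖) := by
            gcongr
            exact hE _ _ _ (hch (J + 1) le_rfl) (hch J (by omega))
        _ = (K₁ + K₂ + K₃) / ‖s‖ ^ (N + 1) * (n ^ (J + 2) * q ^ (n + 1)) +
            K₁ / ‖s‖ ^ (N + 1) * (((n + 1 : ℕ) : ℝ) ^ (J + 1) * q ^ (n + 1)) := by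
            rw [hK₁]
            field_simp
            ring
        _ ≤ (K₁ + K₂ + K₃) / ‖s‖ ^ (N + 1) * (n * ((n + 1 : ℕ) : ℝ) ^ (J + 1) * q ^ (n + 1)) +
            (K₁ + K₂ + K₃) / ‖s‖ ^ (N + 1) * (((n + 1 : ℕ) : ℝ) ^ (J + 1) * q ^ (n + 1)) := by
            -- With this weakening the two contributions add up to n(n+1)^(J+1) + (n+1)^(J+1) =
            -- (n+1)^(J+2).
            have h1 : (n : ℝ) ^ (J + 2) ≤ n * ((n + 1 : ℕ) : ℝ) ^ (J + 1) := by
              rw [pow_succ']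
              gcongr
              omega
            have h2 : K₁ ≤ K₁ + K₂ + K₃ := by linarith
            gcongr
        _ = _ := by push_cast; ring

/-! ### Power series for the cotangent and its derivatives with even zeta values. -/

theorem hasSum_of_eq {ι : Type*} {f g : ι → ℂ} {a b : ℂ} (h : HasSum f a) (hf : ∀ i, g i = f i)
    (hab : b = a) : HasSum g b := by
  rw [hab, funext hf]; exact h

theorem hasSum_zeta_nat_add_one {m : ℕ} (hm : 1 < m) :
    HasSum (fun n : ℕ => 1 / ((n : ℂ) + 1) ^ m) (riemannZeta m) := by
  have h1 : 1 < ((m : ℕ) : ℂ).re := by rw [natCast_re]; exact_mod_cast hm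
  have h := zeta_eq_tsum_one_div_nat_add_one_cpow h1
  simp only [cpow_natCast] at h
  rw [h]
  refine Summable.hasSum ?_
  have h3 := (Complex.summable_one_div_nat_cpow (p := m)).2 h1
  have := (summable_nat_add_iff 1).2 h3
  simpa using this

theorem norm_zeta_nat_le_two {m : ℕ} (hm : 1 < m) : ‖riemannZeta m‖ ≤ 2 := by
  have hs : Summable fun n : ℕ => 1 / ((n : ℝ) + 1) ^ 2 := by
    have := (summable_nat_add_iff 1).2 (Real.summable_one_div_nat_pow.2 one_lt_two)
    simpa using this
  rw [← (hasSum_zeta_nat_add_one hm).tsum_eq]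
  have hb : ∀ n : ℕ, ‖1 / ((n : ℂ) + 1) ^ m‖ ≤ 1 / ((n : ℝ) + 1) ^ 2 := by
    intro n
    rw [norm_div, norm_one, norm_pow, ← Nat.cast_succ, Complex.norm_natCast, Nat.cast_succ]
    apply one_div_le_one_div_of_le (by positivity)
    exact pow_le_pow_right₀ (by linarith [n.cast_nonneg (α := ℝ)]) hm
  refine (tsum_of_norm_bounded hs.hasSum hb).trans ?_
  have h2 : ∑' n : ℕ, 1 / ((n : ℝ) + 1) ^ 2 = Real.pi ^ 2 / 6 := by
    have h := hasSum_zeta_two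
    have := (hasSum_nat_add_iff' 1).2 h
    simpa using this.tsum_eq
  rw [h2]
  nlinarith [Real.pi_lt_d2, Real.pi_pos]

theorem norm_lt_one_mem_integerComplement {x : ℂ} (h0 : x ≠ 0) (h1 : ‖x‖ < 1) :
    x ∈ integerComplement := by
  rintro ⟨n, rfl⟩
  rw [Complex.norm_intCast] at h1
  have : n = 0 := Int.abs_lt_one_iff.1 (by exact_mod_cast h1)
  simp [this] at h0

/-- Writing ζ(2k+2) as a series gives an absolutely convergent double sum. Summing over k first is a
geometric series, and the result is the partial fraction expansion of the cotangent. -/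
theorem hasSum_zeta_mul_pow {x : ℂ} (h0 : x ≠ 0) (h1 : ‖x‖ < 1) :
    HasSum (fun k : ℕ => riemannZeta ((2 * k + 2 : ℕ) : ℂ) * x ^ (2 * k + 1))
      ((x⁻¹ - Real.pi * cot (Real.pi * x)) / 2) := by
  have hx := norm_lt_one_mem_integerComplement h0 h1
  set F : ℕ × ℕ → ℂ := fun p => x ^ (2 * p.2 + 1) / ((p.1 : ℂ) + 1) ^ (2 * p.2 + 2) with hF
  have hs2 : Summable fun n : ℕ => 1 / ((n : ℝ) + 1) ^ 2 := by
    have := (summable_nat_add_iff 1).2 (Real.summable_one_div_nat_pow.2 one_lt_two)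
    simpa using this
  have hgeo : Summable fun k : ℕ => ‖x‖ ^ (2 * k + 1) :=
    (summable_geometric_of_lt_one (norm_nonneg _) h1).comp_injective
      (i := fun k : ℕ => 2 * k + 1) (fun a b h => by simpa using h)
  have hsum : Summable F := by
    have hprod := Summable.mul_of_nonneg hs2 hgeo (fun n => by positivity)
      (fun n => by positivity)
    refine Summable.of_norm_bounded hprod fun p => ?_
    have hp : (1 : ℝ) ≤ p.1 + 1 := by linarith [p.1.cast_nonneg (α := ℝ)]
    rw [hF, norm_div, norm_pow, norm_pow, ← Nat.cast_succ, Complex.norm_natCast, Nat.cast_succ,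
      div_eq_inv_mul, ← one_div]
    refine mul_le_mul_of_nonneg_right ?_ (by positivity)
    exact one_div_le_one_div_of_le (by positivity) (pow_le_pow_right₀ hp (by omega))
  have hrow : ∀ n : ℕ, HasSum (fun k => F (n, k))
      ((-1 / 2) * (1 / (x - (n + 1)) + 1 / (x + (n + 1)))) := by
    intro n
    have hn : (n : ℂ) + 1 ≠ 0 := by exact_mod_cast Nat.succ_ne_zero n
    have hlt : ‖(x / (n + 1)) ^ 2‖ < 1 := by
      rw [norm_pow, norm_div, ← Nat.cast_succ, Complex.norm_natCast, Nat.cast_succ]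
      refine pow_lt_one₀ (by positivity) ?_ two_ne_zero
      rw [div_lt_one (by positivity)]
      linarith [n.cast_nonneg (α := ℝ)]
    have hg := (hasSum_geometric_of_norm_lt_one hlt).mul_left (x / ((n : ℂ) + 1) ^ 2)
    have e1 := integerComplement_add_ne_zero hx (n + 1 : ℤ)
    have e2 := integerComplement_add_ne_zero hx (-(n + 1) : ℤ)
    push_cast at e1 e2
    rw [← sub_eq_add_neg] at e2
    refine hasSum_of_eq hg (fun k => ?_) ?_
    · simp only [hF, div_pow]
      field_simp
      rw [← pow_mul]; ring
    · have e3 : 1 - (x / ((n : ℂ) + 1)) ^ 2 ≠ 0 := by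
        intro h
        rw [← sub_eq_zero.1 h] at hlt
        simp at hlt
      have e4 : ((n : ℂ) + 1) ^ 2 - x ^ 2 ≠ 0 := by
        intro h
        apply e3
        rw [div_pow, ← sub_eq_zero.1 h, div_self (pow_ne_zero _ hn), sub_self]
      have e5 : 1 - (x / ((n : ℂ) + 1)) ^ 2 = (((n : ℂ) + 1) ^ 2 - x ^ 2) / ((n : ℂ) + 1) ^ 2 := by
        field_simp
      rw [e5]
      have e6 : ((n : ℂ) + 1) ^ 2 - x ^ 2 = -((x - (n + 1)) * (x + (n + 1))) := by ring
      rw [e6]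
      field_simp
      ring
  have hcol : ∀ k : ℕ, HasSum (fun n => F (n, k))
      (riemannZeta ((2 * k + 2 : ℕ) : ℂ) * x ^ (2 * k + 1)) := by
    intro k
    refine hasSum_of_eq ((hasSum_zeta_nat_add_one (m := 2 * k + 2) (by omega)).mul_right
      (x ^ (2 * k + 1))) (fun n => ?_) rfl
    simp only [hF]
    ring
  have h1 := hsum.hasSum.prod_fiberwise hrow
  have h2 := hsum.prod_symm.hasSum.prod_fiberwise hcol
  have h3 : ∑' p : ℕ × ℕ, F p.swap = ∑' p, F p := (Equiv.prodComm ℕ ℕ).tsum_eq F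
  have h4 := cot_series_rep' hx
  have h5 := h1.tsum_eq
  rw [tsum_mul_left, ← h4] at h5
  rw [h3, ← h5] at h2
  refine hasSum_of_eq h2 (fun _ => rfl) ?_
  ring

/-- The `j`-fold termwise derivative of `∑ ζ(2k+2) x^(2k+1)`. -/
noncomputable def cotTermDeriv (j k : ℕ) (x : ℂ) : ℂ :=
  riemannZeta ((2 * k + 2 : ℕ) : ℂ) * ((2 * k + 1).descFactorial j : ℂ) * x ^ (2 * k + 1 - j)

theorem hasDerivAt_cotTermDeriv (j k : ℕ) (x : ℂ) :
    HasDerivAt (cotTermDeriv j k) (cotTermDeriv (j + 1) k x) x := by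
  have h := (hasDerivAt_pow (2 * k + 1 - j) x).const_mul
    (riemannZeta ((2 * k + 2 : ℕ) : ℂ) * ((2 * k + 1).descFactorial j : ℂ))
  refine HasDerivAt.congr_deriv (f := cotTermDeriv j k) h ?_
  simp only [cotTermDeriv, Nat.descFactorial_succ, ← Nat.sub_sub, Nat.cast_mul]
  ring

theorem norm_cotTermDeriv_le (j k : ℕ) {x : ℂ} {ρ : ℝ} (h0 : 0 < ρ) (hρ : ρ ≤ 1) (h1 : ‖x‖ ≤ ρ) :
    ‖cotTermDeriv j k x‖ ≤ 2 / ρ ^ j * (((2 * k + 1 : ℕ) : ℝ) ^ j * ρ ^ (2 * k + 1)) := by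
  rw [cotTermDeriv, norm_mul, norm_mul, norm_pow, Complex.norm_natCast]
  have h2 : ‖x‖ ^ (2 * k + 1 - j) ≤ ρ ^ (2 * k + 1) / ρ ^ j := by
    rw [le_div_iff₀ (by positivity)]
    calc ‖x‖ ^ (2 * k + 1 - j) * ρ ^ j ≤ ρ ^ (2 * k + 1 - j) * ρ ^ j := by gcongr
      _ = ρ ^ (2 * k + 1 - j + j) := by rw [pow_add]
      _ ≤ _ := pow_le_pow_of_le_one h0.le hρ (by omega)
  have h3 : ((2 * k + 1).descFactorial j : ℝ) ≤ ((2 * k + 1 : ℕ) : ℝ) ^ j := by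
    exact_mod_cast Nat.descFactorial_le_pow (2 * k + 1) j
  calc _ ≤ 2 * ((2 * k + 1 : ℕ) : ℝ) ^ j * (ρ ^ (2 * k + 1) / ρ ^ j) := by
        gcongr
        exact norm_zeta_nat_le_two (by omega)
    _ = _ := by ring

theorem summable_pow_mul_geometric_odd (j : ℕ) {ρ : ℝ} (h0 : 0 < ρ) (hρ : ρ < 1) :
    Summable fun k : ℕ => ((2 * k + 1 : ℕ) : ℝ) ^ j * ρ ^ (2 * k + 1) := by
  have h := summable_pow_mul_geometric_of_norm_lt_one j (r := ρ) (by
    rw [Real.norm_eq_abs, abs_of_pos h0]; exact hρ)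
  exact h.comp_injective (i := fun k : ℕ => 2 * k + 1) (fun a b h => by simpa using h)

theorem iteratedDeriv_cotSeries (j : ℕ) {x : ℂ} (hx : ‖x‖ < 1) :
    HasSum (fun k => cotTermDeriv j k x)
      (iteratedDeriv j (fun y => ∑' k, cotTermDeriv 0 k y) x) := by
  have hbound : ∀ (j : ℕ) {x : ℂ}, ‖x‖ < 1 → ∃ ρ : ℝ, 0 < ρ ∧ ρ < 1 ∧ ‖x‖ < ρ := by
    intro j x hx
    obtain ⟨ρ, h1, h2⟩ := exists_between hx
    exact ⟨ρ, (norm_nonneg _).trans_lt h1, h2, h1⟩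
  have hsum : ∀ (j : ℕ) {x : ℂ}, ‖x‖ < 1 → Summable fun k => cotTermDeriv j k x := by
    intro j x hx
    obtain ⟨ρ, h0, h1, h2⟩ := hbound j hx
    exact Summable.of_norm_bounded ((summable_pow_mul_geometric_odd j h0 h1).mul_left _)
      fun k => norm_cotTermDeriv_le j k h0 h1.le h2.le
  suffices h : ∀ x : ℂ, ‖x‖ < 1 →
      iteratedDeriv j (fun y => ∑' k, cotTermDeriv 0 k y) x = ∑' k, cotTermDeriv j k x by
    rw [h x hx]; exact (hsum j hx).hasSum
  clear hx x
  induction j with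
  | zero => intro x _; simp
  | succ j ih =>
    intro x hx
    have hev : iteratedDeriv j (fun y => ∑' k, cotTermDeriv 0 k y) =ᶠ[nhds x]
        fun y => ∑' k, cotTermDeriv j k y := by
      filter_upwards [(isOpen_lt continuous_norm continuous_const).mem_nhds hx] with y hy
      exact ih y hy
    rw [iteratedDeriv_succ, hev.deriv_eq]
    obtain ⟨ρ, h0, h1, h2⟩ := hbound j hx
    have := hasSum_deriv_of_summable_norm (F := fun k y => cotTermDeriv j k y)
      (U := Metric.ball 0 ρ) ((summable_pow_mul_geometric_odd j h0 h1).mul_left (2 / ρ ^ j))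
      (fun k y _ => (hasDerivAt_cotTermDeriv j k y).differentiableAt.differentiableWithinAt)
      Metric.isOpen_ball (fun k y hy => norm_cotTermDeriv_le j k h0 h1.le
        (by simpa using (Metric.mem_ball.1 hy).le)) (z := x) (by simpa using h2)
    rw [← this.tsum_eq]
    exact tsum_congr fun k => (hasDerivAt_cotTermDeriv j k x).deriv

theorem contDiffAt_cotSeries (j : ℕ) {x : ℂ} (hx : ‖x‖ < 1) :
    ContDiffAt ℂ j (fun y => ∑' k, cotTermDeriv 0 k y) x := by
  obtain ⟨ρ, h1, h2⟩ := exists_between hx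
  have h0 : 0 < ρ := (norm_nonneg _).trans_lt h1
  have hd : DifferentiableOn ℂ (fun y => ∑' k, cotTermDeriv 0 k y) (Metric.ball 0 ρ) :=
    differentiableOn_tsum_of_summable_norm
      ((summable_pow_mul_geometric_odd 0 h0 h2).mul_left (2 / ρ ^ 0))
      (fun k y _ => (hasDerivAt_cotTermDeriv 0 k y).differentiableAt.differentiableWithinAt)
      Metric.isOpen_ball (fun k y hy => norm_cotTermDeriv_le 0 k h0 h2.le
        (by simpa using (Metric.mem_ball.1 hy).le))
  exact (hd.analyticAt (Metric.isOpen_ball.mem_nhds (by simpa using h1))).contDiffAt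

theorem iteratedDeriv_cot_pi_mul (j : ℕ) (x : ℂ) :
    iteratedDeriv j (fun y => cot (Real.pi * y)) x =
      (Real.pi : ℂ) ^ j * iteratedDeriv j cot (Real.pi * x) := by
  induction j generalizing x with
  | zero => simp
  | succ j ih =>
    rw [iteratedDeriv_succ, funext ih, deriv_const_mul_field]
    rw [deriv_comp_mul_left (Real.pi : ℂ) (iteratedDeriv j cot) x, iteratedDeriv_succ]
    simp only [smul_eq_mul]
    ring

/-- This is the preceding series differentiated j times and divided by j!. The derivative of 1/x
produces exactly the coefficients of `truncMomentNegOne`. Truncated subtraction in the exponent is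
harmless because the binomial coefficient vanishes there. -/
theorem hasSum_cot_iteratedDeriv (j : ℕ) {x : ℂ} (h0 : x ≠ 0) (h1 : ‖x‖ < 1) :
    HasSum (fun k : ℕ => riemannZeta ((2 * k + 2 : ℕ) : ℂ) *
        (((2 * k + 1).choose j : ℂ) * x ^ (2 * k + 1 - j)))
      (((-1) ^ j * x⁻¹ ^ (j + 1) - Real.pi * ((Real.pi : ℂ) ^ j *
        iteratedDeriv j cot (Real.pi * x) / (Nat.factorial j : ℂ))) / 2) := by
  have hf : (Nat.factorial j : ℂ) ≠ 0 := by exact_mod_cast Nat.factorial_ne_zero j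
  have hev : (fun y => (Real.pi : ℂ) * cot (Real.pi * y)) =ᶠ[nhds x]
      fun y => y⁻¹ - 2 * ∑' k, cotTermDeriv 0 k y := by
    filter_upwards [(isOpen_lt continuous_norm continuous_const).mem_nhds h1,
      isOpen_ne.mem_nhds h0] with y hy1 hy0
    have := (hasSum_zeta_mul_pow hy0 hy1).tsum_eq
    simp only [cotTermDeriv, Nat.descFactorial_zero, Nat.cast_one, mul_one, Nat.sub_zero, this]
    ring
  have hI := hev.iteratedDeriv_eq j
  rw [iteratedDeriv_const_mul_field, iteratedDeriv_cot_pi_mul,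
    iteratedDeriv_fun_sub (contDiffAt_inv ℂ h0) (contDiffAt_const.mul (contDiffAt_cotSeries j h1)),
    iteratedDeriv_const_mul_field, iteratedDeriv_eq_iterate (f := fun y : ℂ => y⁻¹),
    show (fun y : ℂ => y⁻¹) = Inv.inv from rfl, iter_deriv_inv] at hI
  have hS := (iteratedDeriv_cotSeries j h1).div_const (Nat.factorial j : ℂ)
  refine hasSum_of_eq hS (fun k => ?_) ?_
  · rw [cotTermDeriv, Nat.descFactorial_eq_factorial_mul_choose]
    push_cast
    field_simp
  · have hz : x ^ (-1 - (j : ℤ)) = x⁻¹ ^ (j + 1) := by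
      rw [inv_pow, ← zpow_natCast, ← zpow_neg]; congr 1; push_cast; ring
    rw [hz] at hI
    generalize iteratedDeriv j cot (Real.pi * x) = D at *
    field_simp
    linear_combination (-1 : ℂ) * hI

/-! ### Bernoulli polynomials and the Euler–Maclaurin remainder. -/

/-- The coefficient `B_j / j!`. -/
noncomputable def bernCoeff (j : ℕ) : ℂ := (bernoulli j : ℂ) / (Nat.factorial j : ℂ)

/-- The normalized Bernoulli polynomial `B_j(t) / j!`. -/
noncomputable def bernPoly (j : ℕ) (t : ℝ) : ℝ := bernoulliFun j t / (Nat.factorial j : ℝ)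

theorem bernCoeff_zero : bernCoeff 0 = 1 := by simp [bernCoeff]

theorem bernCoeff_one : bernCoeff 1 = -1 / 2 := by simp [bernCoeff, bernoulli_one]

theorem bernCoeff_odd (k : ℕ) : bernCoeff (2 * k + 3) = 0 := by
  rw [bernCoeff, bernoulli_eq_zero_of_odd ⟨k + 1, by ring⟩ (by omega)]; simp

theorem bernCoeff_even (k : ℕ) : bernCoeff (2 * k + 2) =
    (-1) ^ k * 2 * riemannZeta ((2 * k + 2 : ℕ) : ℂ) / (2 * Real.pi) ^ (2 * k + 2) := by
  have h := riemannZeta_two_mul_nat (Nat.succ_ne_zero k)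
  rw [show (2 : ℂ) * ((k + 1 : ℕ) : ℂ) = ((2 * k + 2 : ℕ) : ℂ) by push_cast; ring,
    show 2 * (k + 1) = 2 * k + 2 by ring] at h
  rw [h, bernCoeff, show 2 * k + 2 - 1 = 2 * k + 1 by omega]
  have hpi : (Real.pi : ℂ) ≠ 0 := by exact_mod_cast Real.pi_ne_zero
  have hf : (Nat.factorial (2 * k + 2) : ℂ) ≠ 0 := by exact_mod_cast Nat.factorial_ne_zero _
  rw [mul_pow]
  field_simp
  have h1 : (-1 : ℂ) ^ k * (-1) ^ k = 1 := by rw [← mul_pow]; norm_num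
  rw [Nat.succ_eq_add_one, pow_succ _ (k + 1), pow_succ _ k]
  linear_combination (-2 * 2 ^ (2 * k + 1) * (bernoulli (2 * k + 2) : ℂ)) * h1

/-- The Fourier series of the Bernoulli polynomial is dominated by 2ζ(2) = π²/3 ≤ 4, uniformly in k
≥ 2. -/
theorem norm_bernPoly_le {k : ℕ} (hk : 2 ≤ k) {x : ℝ} (hx : x ∈ Set.Icc (0 : ℝ) 1) :
    ‖bernPoly k x‖ ≤ 4 / (2 * Real.pi) ^ k := by
  have h := hasSum_one_div_nat_pow_mul_fourier hk hx
  have hb : ∀ n : ℕ, ‖(1 : ℂ) / (n : ℂ) ^ k * (fourier n (x : UnitAddCircle) + (-1 : ℂ) ^ k *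
      fourier (-n) (x : UnitAddCircle))‖ ≤ 1 / (n : ℝ) ^ 2 * 2 := by
    intro n
    rw [norm_mul]
    refine mul_le_mul ?_ ?_ (norm_nonneg _) (by positivity)
    · rw [norm_div, norm_one, norm_pow, Complex.norm_natCast]
      rcases Nat.eq_zero_or_pos n with rfl | hn
      · simp [show k ≠ 0 by omega]
      · have hn1 : (1 : ℝ) ≤ n := by exact_mod_cast hn
        exact one_div_le_one_div_of_le (by positivity) (pow_le_pow_right₀ hn1 hk)
    · refine (norm_add_le _ _).trans ?_
      rw [norm_mul, norm_pow, norm_neg, norm_one, one_pow, one_mul]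
      simp only [fourier_apply, Circle.norm_coe]
      norm_num
  have h2 := tsum_of_norm_bounded (hasSum_zeta_two.mul_right 2) hb
  rw [h.tsum_eq] at h2
  have hpi := Real.pi_pos
  rw [norm_mul, norm_div, norm_neg, norm_pow, Complex.norm_natCast, Complex.norm_real] at h2
  have e : ‖2 * (Real.pi : ℂ) * I‖ = 2 * Real.pi := by simp [abs_of_pos hpi]
  rw [e] at h2
  rw [bernPoly, norm_div, Real.norm_natCast, le_div_iff₀ (by positivity)]
  calc _ = (2 * Real.pi) ^ k / (Nat.factorial k : ℝ) * ‖bernoulliFun k x‖ := by ring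
    _ ≤ Real.pi ^ 2 / 6 * 2 := h2
    _ ≤ 4 := by nlinarith [Real.pi_lt_d2]

theorem ofReal_bernPoly_zero (k : ℕ) : (bernPoly k 0 : ℂ) = bernCoeff k := by
  rw [bernPoly, bernoulliFun_eval_zero, bernCoeff]
  push_cast
  rfl

theorem ofReal_bernPoly_one {k : ℕ} (hk : k ≠ 1) : (bernPoly k 1 : ℂ) = bernCoeff k := by
  rw [← ofReal_bernPoly_zero, bernPoly, bernPoly, bernoulliFun_endpoints_eq_of_ne_one hk]

theorem norm_bernCoeff_le {k : ℕ} (hk : 2 ≤ k) : ‖bernCoeff k‖ ≤ 4 / (2 * Real.pi) ^ k := by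
  rw [← ofReal_bernPoly_zero, Complex.norm_real]
  exact norm_bernPoly_le hk (by simp)

theorem hasDerivAt_bernPoly (k : ℕ) (t : ℝ) :
    HasDerivAt (bernPoly (k + 1)) (bernPoly k t) t := by
  refine ((hasDerivAt_bernoulliFun (k + 1) t).div_const _).congr_deriv ?_
  rw [bernPoly, Nat.factorial_succ, Nat.add_sub_cancel]
  have : (Nat.factorial k : ℝ) ≠ 0 := by exact_mod_cast Nat.factorial_ne_zero k
  push_cast
  field_simp

theorem continuous_bernPoly (k : ℕ) : Continuous (bernPoly k) :=
  (continuous_bernoulliFun k).div_const _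

/-- `(w)_(j-1)`, with the convention `(w)_(-1) = 1 / (w - 1)`. -/
noncomputable def shiftPoch : ℕ → ℂ → ℂ
  | 0, w => (w - 1)⁻¹
  | j + 1, w => (ascPochhammer ℂ j).eval w

/-- The remainder of order `p` in the Euler-Maclaurin formula for `x ↦ x ^ (-w)` on
`[n, n + 1]`. -/
noncomputable def emRem (p n : ℕ) (w : ℂ) : ℂ :=
  ((n : ℂ) + 1) ^ (-w) + ∑ j ∈ Finset.range p, bernCoeff j * shiftPoch j w *
    (((n : ℂ) + 1) ^ (1 - w - j) - (n : ℂ) ^ (1 - w - j))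

theorem emRem_succ (p n : ℕ) (w : ℂ) : emRem (p + 1) n w = emRem p n w +
    bernCoeff p * shiftPoch p w * (((n : ℂ) + 1) ^ (1 - w - p) - (n : ℂ) ^ (1 - w - p)) := by
  rw [emRem, emRem, Finset.sum_range_succ, add_assoc]

theorem hasDerivAt_add_cpow {n : ℕ} (hn : 0 < n) (c : ℂ) {t : ℝ} (ht : 0 ≤ t) :
    HasDerivAt (fun t : ℝ => ((n : ℂ) + t) ^ c) (c * ((n : ℂ) + t) ^ (c - 1)) t := by
  have h1 : HasDerivAt (fun z : ℂ => (n : ℂ) + z) 1 (t : ℂ) := (hasDerivAt_id _).const_add _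
  have h2 : (n : ℂ) + t ∈ slitPlane := by
    refine Or.inl ?_
    have : (0 : ℝ) < n := by exact_mod_cast hn
    simp; linarith
  simpa using (h1.cpow_const (c := c) h2).comp_ofReal

theorem continuousOn_add_cpow {n : ℕ} (hn : 0 < n) (c : ℂ) :
    ContinuousOn (fun t : ℝ => ((n : ℂ) + t) ^ c) (Set.uIcc 0 1) := fun t ht =>
  (hasDerivAt_add_cpow hn c (by simpa using ht.1)).continuousAt.continuousWithinAt

theorem intervalIntegrable_bernPoly_mul {n : ℕ} (hn : 0 < n) (k : ℕ) (c : ℂ) :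
    IntervalIntegrable (fun t : ℝ => (bernPoly k t : ℂ) * ((n : ℂ) + t) ^ c)
      MeasureTheory.volume 0 1 :=
  ((continuous_ofReal.comp (continuous_bernPoly k)).continuousOn.mul
    (continuousOn_add_cpow hn c)).intervalIntegrable

theorem integral_bernPoly_mul_by_parts {n : ℕ} (hn : 0 < n) (k : ℕ) (c : ℂ) :
    (∫ t in (0 : ℝ)..1, (bernPoly k t : ℂ) * ((n : ℂ) + t) ^ c) +
      c * ∫ t in (0 : ℝ)..1, (bernPoly (k + 1) t : ℂ) * ((n : ℂ) + t) ^ (c - 1) =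
    (bernPoly (k + 1) 1 : ℂ) * ((n : ℂ) + 1) ^ c - (bernPoly (k + 1) 0 : ℂ) * (n : ℂ) ^ c := by
  have hd : ∀ t ∈ Set.uIcc (0 : ℝ) 1,
      HasDerivAt (fun t : ℝ => (bernPoly (k + 1) t : ℂ) * ((n : ℂ) + t) ^ c)
        ((bernPoly k t : ℂ) * ((n : ℂ) + t) ^ c +
          c * ((bernPoly (k + 1) t : ℂ) * ((n : ℂ) + t) ^ (c - 1))) t := by
    intro t ht
    have ht0 : 0 ≤ t := by
      rw [Set.uIcc_of_le zero_le_one] at ht; exact ht.1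
    refine ((hasDerivAt_bernPoly k t).ofReal_comp.mul (hasDerivAt_add_cpow hn c ht0)).congr_deriv ?_
    ring
  have h1 := intervalIntegrable_bernPoly_mul hn k c
  have h2 := (intervalIntegrable_bernPoly_mul hn (k + 1) (c - 1)).const_mul c
  have h := intervalIntegral.integral_eq_sub_of_hasDerivAt hd (h1.add h2)
  rw [intervalIntegral.integral_add h1 h2, intervalIntegral.integral_const_mul] at h
  simpa using h

theorem integral_add_cpow {n : ℕ} (hn : 0 < n) {w : ℂ} (hw : w ≠ 1) :
    ∫ t in (0 : ℝ)..1, ((n : ℂ) + t) ^ (-w) =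
      (((n : ℂ) + 1) ^ (1 - w) - (n : ℂ) ^ (1 - w)) / (1 - w) := by
  have hne : 1 - w ≠ 0 := sub_ne_zero.2 hw.symm
  have hd : ∀ t ∈ Set.uIcc (0 : ℝ) 1,
      HasDerivAt (fun t : ℝ => ((n : ℂ) + t) ^ (1 - w) / (1 - w)) (((n : ℂ) + t) ^ (-w)) t := by
    intro t ht
    have ht0 : 0 ≤ t := by
      rw [Set.uIcc_of_le zero_le_one] at ht; exact ht.1
    refine ((hasDerivAt_add_cpow hn (1 - w) ht0).div_const (1 - w)).congr_deriv ?_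
    rw [mul_div_cancel_left₀ _ hne]
    congr 1
    ring
  rw [intervalIntegral.integral_eq_sub_of_hasDerivAt hd
    (continuousOn_add_cpow hn (-w)).intervalIntegrable]
  simp [sub_div]

/-- Repeated integration by parts against B_k(t)/k!. Only B_1 takes different values at 0 and 1, so
the start of the induction is computed by hand; from then on both endpoints carry the same
`bernCoeff`. -/
theorem emRem_eq_integral {n : ℕ} (hn : 0 < n) {w : ℂ} (hw : w ≠ 1) (q : ℕ) :
    emRem (q + 2) n w = -((ascPochhammer ℂ (q + 1)).eval w *
      ∫ t in (0 : ℝ)..1, (bernPoly (q + 1) t : ℂ) * ((n : ℂ) + t) ^ (-w - (q + 1))) := by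
  have hne : 1 - w ≠ 0 := sub_ne_zero.2 hw.symm
  induction q with
  | zero =>
    have h := integral_bernPoly_mul_by_parts hn 0 (-w)
    have h0 : ∀ t : ℝ, bernPoly 0 t = 1 := by intro t; simp [bernPoly]
    simp only [h0, ofReal_one, one_mul, zero_add] at h
    rw [integral_add_cpow hn hw] at h
    have h1 : (bernPoly 1 1 : ℂ) = 1 / 2 := by simp [bernPoly]; norm_num
    have h2 : (bernPoly 1 0 : ℂ) = -1 / 2 := by simp [bernPoly]; norm_num
    rw [h1, h2] at h
    have hi : (w - 1)⁻¹ = -(1 - w)⁻¹ := by rw [← inv_neg, neg_sub]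
    simp only [emRem, Finset.sum_range_succ, Finset.sum_range_zero, bernCoeff_zero, bernCoeff_one,
      shiftPoch, hi]
    simp only [zero_add, ascPochhammer_zero, ascPochhammer_one, Polynomial.eval_one,
      Polynomial.eval_X, Nat.cast_zero, Nat.cast_one, sub_zero]
    rw [show (1 : ℂ) - w - 1 = -w by ring]
    linear_combination -h
  | succ q ih =>
    rw [show q + 1 + 2 = q + 2 + 1 by ring, emRem_succ, ih]
    have h := integral_bernPoly_mul_by_parts hn (q + 1) (-w - (q + 1))
    rw [ofReal_bernPoly_one (by omega), ofReal_bernPoly_zero] at h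
    have e1 : (1 : ℂ) - w - ((q + 2 : ℕ) : ℂ) = -w - (q + 1) := by push_cast; ring
    have e2 : -w - (q + 1) - 1 = -w - (((q + 1 : ℕ) : ℂ) + 1) := by push_cast; ring
    rw [e1, shiftPoch, ascPochhammer_succ_eval (q + 1) w]
    rw [e2] at h
    push_cast at *
    linear_combination (-Polynomial.eval w (ascPochhammer ℂ (q + 1))) * h

theorem norm_add_cpow_le {n : ℕ} (hn : 0 < n) {c : ℂ} (hc : c.re ≤ 0) {t : ℝ} (ht : 0 ≤ t) :
    ‖((n : ℂ) + t) ^ c‖ ≤ (n : ℝ) ^ c.re := by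
  have hn0 : (0 : ℝ) < n := by exact_mod_cast hn
  have e : (n : ℂ) + t = ((n + t : ℝ) : ℂ) := by push_cast; ring
  rw [e, Complex.norm_cpow_eq_rpow_re_of_pos (by linarith)]
  exact Real.rpow_le_rpow_of_nonpos hn0 (by linarith) hc

/-- Order q + 3 makes the Bernoulli polynomial in the integral have index q + 2 ≥ 2, where the
Fourier bound applies. -/
theorem norm_emRem_le {n : ℕ} (hn : 0 < n) {w : ℂ} (hw : w ≠ 1) (q : ℕ)
    (hq : 0 ≤ w.re + (q + 2)) :
    ‖emRem (q + 3) n w‖ ≤ ‖(ascPochhammer ℂ (q + 2)).eval w‖ * (4 / (2 * Real.pi) ^ (q + 2)) *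
      (n : ℝ) ^ (-(w.re + (q + 2))) := by
  rw [emRem_eq_integral hn hw (q + 1), norm_neg, norm_mul, mul_assoc]
  refine mul_le_mul_of_nonneg_left ?_ (norm_nonneg _)
  have e : (-w - (((q + 1 : ℕ) : ℂ) + 1)).re = -(w.re + (q + 2)) := by
    simp; ring
  have h := intervalIntegral.norm_integral_le_of_norm_le_const (a := (0 : ℝ)) (b := 1)
    (f := fun t : ℝ => (bernPoly (q + 1 + 1) t : ℂ) * ((n : ℂ) + t) ^ (-w - (((q + 1 : ℕ) : ℂ) + 1)))
    (C := 4 / (2 * Real.pi) ^ (q + 2) * (n : ℝ) ^ (-(w.re + (q + 2)))) ?_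
  · simpa using h
  · intro t ht
    rw [Set.uIoc_of_le zero_le_one] at ht
    rw [norm_mul, Complex.norm_real]
    refine mul_le_mul (norm_bernPoly_le (by omega) ⟨ht.1.le, ht.2⟩) ?_ (norm_nonneg _)
      (by positivity)
    rw [← e]
    exact norm_add_cpow_le hn (by rw [e]; linarith) ht.1.le

/-! ### Double series over pairs and their telescoping. -/

theorem summable_pair_rpow {η : ℝ} (hη : 0 < η) : Summable fun x : ℕ × ℕ =>
    ((x.1 : ℝ) + 1) ^ (-(1 + η)) * ((x.2 : ℝ) + 1) ^ (-(1 + η)) := by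
  have h : Summable fun n : ℕ => ((n : ℝ) + 1) ^ (-(1 + η)) := by
    have := (summable_nat_add_iff 1).2 (Real.summable_nat_rpow.2 (show -(1 + η) < -1 by linarith))
    simpa using this
  exact h.mul_of_nonneg h (fun n => by positivity) (fun n => by positivity)

/-- The part of the exponent x₂ beyond 1 + η is moved from the larger index to the smaller one,
which separates the variables. -/
theorem pair_rpow_le {η x₁ x₂ : ℝ} (hη : 0 < η) (h₂ : 1 + η ≤ x₂) (h : 2 + 2 * η ≤ x₁ + x₂)
    (m k : ℕ) : ((m : ℝ) + 1) ^ (-x₁) * ((m + 1 + k : ℕ) : ℝ) ^ (-x₂) ≤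
      ((m : ℝ) + 1) ^ (-(1 + η)) * ((k : ℝ) + 1) ^ (-(1 + η)) := by
  have hm : (1 : ℝ) ≤ m + 1 := by linarith [m.cast_nonneg (α := ℝ)]
  have hk : (0 : ℝ) ≤ k := k.cast_nonneg
  push_cast
  set M : ℝ := (m : ℝ) + 1 with hM
  have hM0 : 0 < M := by linarith
  have e : (M + k) ^ (-x₂) = (M + k) ^ (-(1 + η)) * (M + k) ^ (-(x₂ - (1 + η))) := by
    rw [← Real.rpow_add (by linarith)]; congr 1; ring
  rw [e]
  have h1 : (M + k) ^ (-(x₂ - (1 + η))) ≤ M ^ (-(x₂ - (1 + η))) :=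
    Real.rpow_le_rpow_of_nonpos hM0 (by linarith) (by linarith)
  have h2 : (M + k) ^ (-(1 + η)) ≤ ((k : ℝ) + 1) ^ (-(1 + η)) :=
    Real.rpow_le_rpow_of_nonpos (by linarith) (by linarith) (by linarith)
  have h3 : M ^ (-x₁) * M ^ (-(x₂ - (1 + η))) ≤ M ^ (-(1 + η)) := by
    rw [← Real.rpow_add hM0]
    exact Real.rpow_le_rpow_of_exponent_le hm (by linarith)
  calc _ ≤ M ^ (-x₁) * (((k : ℝ) + 1) ^ (-(1 + η)) * M ^ (-(x₂ - (1 + η)))) := by gcongr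
    _ = (M ^ (-x₁) * M ^ (-(x₂ - (1 + η)))) * ((k : ℝ) + 1) ^ (-(1 + η)) := by ring
    _ ≤ _ := by gcongr

theorem exists_pair_exponent {x₁ x₂ : ℝ} (h₂ : 1 < x₂) (h : 2 < x₁ + x₂) :
    ∃ η : ℝ, 0 < η ∧ 1 + η ≤ x₂ ∧ 2 + 2 * η ≤ x₁ + x₂ :=
  ⟨min (x₂ - 1) ((x₁ + x₂ - 2) / 2), lt_min (by linarith) (by linarith),
    by linarith [min_le_left (x₂ - 1) ((x₁ + x₂ - 2) / 2)],
    by linarith [min_le_right (x₂ - 1) ((x₁ + x₂ - 2) / 2)]⟩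

theorem norm_nat_add_one_cpow (m : ℕ) (c : ℂ) : ‖((m : ℂ) + 1) ^ c‖ = ((m : ℝ) + 1) ^ c.re := by
  have e : (m : ℂ) + 1 = ((m + 1 : ℝ) : ℂ) := by push_cast; ring
  rw [e, Complex.norm_cpow_eq_rpow_re_of_pos (by positivity)]

theorem norm_cpow_sub_cpow_succ_le {n : ℕ} (hn : 0 < n) {v : ℂ} (hv : 0 ≤ v.re) :
    ‖(n : ℂ) ^ (-v) - ((n : ℂ) + 1) ^ (-v)‖ ≤ ‖v‖ * (n : ℝ) ^ (-(v.re + 1)) := by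
  have h := norm_image_sub_le_of_norm_deriv_le_segment_01' (E := ℂ)
    (f := fun t : ℝ => ((n : ℂ) + t) ^ (-v)) (f' := fun t : ℝ => -v * ((n : ℂ) + t) ^ (-v - 1))
    (C := ‖v‖ * (n : ℝ) ^ (-(v.re + 1)))
    (fun t ht => (hasDerivAt_add_cpow hn (-v) ht.1).hasDerivWithinAt) ?_
  · rw [norm_sub_rev]; simpa using h
  · intro t ht
    rw [norm_mul, norm_neg]
    have e : (-v - 1).re = -(v.re + 1) := by simp; ring
    rw [← e]
    gcongr
    exact norm_add_cpow_le hn (by rw [e]; linarith) ht.1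

theorem tendsto_nat_cpow_neg {v : ℂ} (hv : 0 < v.re) (m : ℕ) :
    Filter.Tendsto (fun k : ℕ => ((m + 1 + k : ℕ) : ℂ) ^ (-v)) Filter.atTop (nhds 0) := by
  rw [tendsto_zero_iff_norm_tendsto_zero]
  have h := (tendsto_rpow_neg_atTop hv).comp (tendsto_natCast_atTop_atTop (R := ℝ))
  have h2 := h.comp (Filter.tendsto_add_atTop_nat (m + 1))
  refine h2.congr fun k => ?_
  simp only [Function.comp_apply]
  rw [Complex.norm_natCast_cpow_of_pos (by omega), add_comm k, neg_re]

/-- Summation over the second index telescopes to m^(-v), and m^(-s₁-v) then sums to ζ(s₁ + v).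
Absolute convergence of the double series holds because a difference of consecutive powers gains one
in the exponent. -/
theorem hasSum_pair_cpow_sub {s₁ v : ℂ} (hv : 0 < v.re) (h : 1 < (s₁ + v).re) :
    HasSum (fun x : ℕ × ℕ => ((x.1 : ℂ) + 1) ^ (-s₁) *
      (((x.1 + 1 + x.2 : ℕ) : ℂ) ^ (-v) - (((x.1 + 1 + x.2 : ℕ) : ℂ) + 1) ^ (-v)))
      (riemannZeta (s₁ + v)) := by
  set F : ℕ × ℕ → ℂ := fun x => ((x.1 : ℂ) + 1) ^ (-s₁) *
      (((x.1 + 1 + x.2 : ℕ) : ℂ) ^ (-v) - (((x.1 + 1 + x.2 : ℕ) : ℂ) + 1) ^ (-v)) with hF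
  rw [add_re] at h
  obtain ⟨η, hη, h1, h2⟩ := exists_pair_exponent (x₁ := s₁.re) (x₂ := v.re + 1)
    (by linarith) (by linarith)
  have hs : Summable F := by
    refine Summable.of_norm_bounded ((summable_pair_rpow hη).mul_left ‖v‖) fun x => ?_
    simp only [hF]
    rw [norm_mul, norm_nat_add_one_cpow, neg_re]
    calc _ ≤ ((x.1 : ℝ) + 1) ^ (-s₁.re) * (‖v‖ * ((x.1 + 1 + x.2 : ℕ) : ℝ) ^ (-(v.re + 1))) := by
          gcongr
          exact norm_cpow_sub_cpow_succ_le (by omega) hv.le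
      _ = ‖v‖ * (((x.1 : ℝ) + 1) ^ (-s₁.re) * ((x.1 + 1 + x.2 : ℕ) : ℝ) ^ (-(v.re + 1))) := by ring
      _ ≤ _ := mul_le_mul_of_nonneg_left (pair_rpow_le hη h1 h2 _ _) (norm_nonneg _)
  have hrow : ∀ m : ℕ, HasSum (fun k => F (m, k)) (1 / ((m : ℂ) + 1) ^ (s₁ + v)) := by
    intro m
    have hsm : Summable fun k => F (m, k) :=
      hs.comp_injective (i := fun k : ℕ => (m, k)) (fun a b h => by simpa using h)
    rw [Summable.hasSum_iff_tendsto_nat hsm]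
    have ht := ((tendsto_nat_cpow_neg hv m).const_sub (((m + 1 : ℕ) : ℂ) ^ (-v))).const_mul
      (((m : ℂ) + 1) ^ (-s₁))
    have hm : (m : ℂ) + 1 ≠ 0 := by exact_mod_cast Nat.succ_ne_zero m
    rw [sub_zero, Nat.cast_succ, ← cpow_add _ _ hm, ← neg_add, cpow_neg _ (s₁ + v), ← one_div] at ht
    refine ht.congr fun K => ?_
    simp only [hF]
    rw [← Finset.mul_sum]
    have := Finset.sum_range_sub' (fun k : ℕ => ((m + 1 + k : ℕ) : ℂ) ^ (-v)) K
    simp only [← add_assoc, Nat.cast_add, Nat.cast_one, add_zero] at this ⊢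
    rw [this]
  have h3 := hs.hasSum.prod_fiberwise hrow
  have h4 : HasSum (fun m : ℕ => 1 / ((m : ℂ) + 1) ^ (s₁ + v)) (riemannZeta (s₁ + v)) := by
    have hre : 1 < (s₁ + v).re := by rw [add_re]; exact h
    rw [zeta_eq_tsum_one_div_nat_add_one_cpow hre]
    exact h3.summable.hasSum
  rw [h4.unique h3]
  exact hs.hasSum

/-- The terms `m ^ (-s₁) * emRem p n s₂`, indexed by `m ≤ n` via `(m, n) = (x.1 + 1, x.1 + 1 + x.2)`. -/
noncomputable def pairTerm (p : ℕ) (s : ℂ × ℂ) (x : ℕ × ℕ) : ℂ :=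
  ((x.1 : ℂ) + 1) ^ (-s.1) * emRem p (x.1 + 1 + x.2) s.2

theorem hasSum_pairTerm_succ {p : ℕ} {s : ℂ × ℂ} {V : ℂ} (h : HasSum (pairTerm p s) V)
    (h₂ : 0 < s.2.re + p - 1) (h₁ : 1 < (s.1 + s.2).re + p - 1) :
    HasSum (pairTerm (p + 1) s)
      (V - bernCoeff p * shiftPoch p s.2 * riemannZeta (s.1 + s.2 + p - 1)) := by
  have hd := hasSum_pair_cpow_sub (s₁ := s.1) (v := s.2 + p - 1) (by simpa using h₂)
    (by rw [add_re] at h₁; simp; linarith)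
  rw [show s.1 + (s.2 + p - 1) = s.1 + s.2 + p - 1 by ring] at hd
  refine hasSum_of_eq (h.sub (hd.mul_left (bernCoeff p * shiftPoch p s.2))) (fun x => ?_) rfl
  simp only [pairTerm, emRem_succ]
  rw [show 1 - s.2 - p = -(s.2 + p - 1) by ring]
  ring

theorem norm_pairTerm_le {q : ℕ} {s : ℂ × ℂ} {η : ℝ} (hs : s.2 ≠ 1) (hη : 0 < η)
    (h₂ : 1 + η ≤ s.2.re + (q + 2)) (h₁ : 2 + 2 * η ≤ s.1.re + (s.2.re + (q + 2))) (x : ℕ × ℕ) :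
    ‖pairTerm (q + 3) s x‖ ≤ ‖(ascPochhammer ℂ (q + 2)).eval s.2‖ * (4 / (2 * Real.pi) ^ (q + 2)) *
      (((x.1 : ℝ) + 1) ^ (-(1 + η)) * ((x.2 : ℝ) + 1) ^ (-(1 + η))) := by
  rw [pairTerm, norm_mul, norm_nat_add_one_cpow, neg_re]
  have hpi := Real.pi_pos
  calc _ ≤ ((x.1 : ℝ) + 1) ^ (-s.1.re) * (‖(ascPochhammer ℂ (q + 2)).eval s.2‖ *
        (4 / (2 * Real.pi) ^ (q + 2)) * ((x.1 + 1 + x.2 : ℕ) : ℝ) ^ (-(s.2.re + (q + 2)))) := by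
        gcongr
        exact norm_emRem_le (by omega) hs q (by linarith)
    _ = ‖(ascPochhammer ℂ (q + 2)).eval s.2‖ * (4 / (2 * Real.pi) ^ (q + 2)) *
        (((x.1 : ℝ) + 1) ^ (-s.1.re) * ((x.1 + 1 + x.2 : ℕ) : ℝ) ^ (-(s.2.re + (q + 2)))) := by ring
    _ ≤ _ := mul_le_mul_of_nonneg_left (pair_rpow_le hη h₂ h₁ _ _) (by positivity)

/-! ### Analytic continuation of the double zeta function and its uniqueness. -/

/-- The region in which the Euler-Maclaurin formula of order `q + 3` represents the double zeta
function. -/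
def emRegion (q : ℕ) : Set (ℂ × ℂ) :=
  {s | s.2 ≠ 1 ∧ 1 < s.2.re + (q + 2) ∧ 2 < s.1.re + (s.2.re + (q + 2))}

theorem summable_pairTerm {q : ℕ} {s : ℂ × ℂ} (hs : s ∈ emRegion q) :
    Summable (pairTerm (q + 3) s) := by
  obtain ⟨h0, h2, h1⟩ := hs
  obtain ⟨η, hη, a, b⟩ := exists_pair_exponent h2 h1
  exact Summable.of_norm_bounded ((summable_pair_rpow hη).mul_left _)
    fun x => norm_pairTerm_le h0 hη a b x

theorem emRegion_mono {q r : ℕ} (h : q ≤ r) : emRegion q ⊆ emRegion r := by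
  rintro s ⟨h0, h2, h1⟩
  have : (q : ℝ) ≤ r := by exact_mod_cast h
  exact ⟨h0, by linarith, by linarith⟩

theorem isOpen_emRegion (q : ℕ) : IsOpen (emRegion q) := by
  have h1 : IsOpen {s : ℂ × ℂ | s.2 ≠ 1} := isOpen_ne_fun continuous_snd continuous_const
  have h2 : IsOpen {s : ℂ × ℂ | 1 < s.2.re + (q + 2)} := isOpen_lt (by fun_prop) (by fun_prop)
  have h3 : IsOpen {s : ℂ × ℂ | 2 < s.1.re + (s.2.re + (q + 2))} :=
    isOpen_lt (by fun_prop) (by fun_prop)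
  exact h1.inter (h2.inter h3)

/-- A Weierstrass theorem on a complex normed space: Cauchy's estimate on the complex line through w
in direction v turns the bound on F i into one on its Fréchet derivative, and the series is then
differentiated termwise. -/
theorem differentiableAt_tsum_of_norm_le {E ι : Type*} [NormedAddCommGroup E] [NormedSpace ℂ E]
    {F : ι → E → ℂ} {u : ι → ℝ} {z : E} {r : ℝ} (hr : 0 < r) (hu : Summable u)
    (hF : ∀ i, DifferentiableOn ℂ (F i) (Metric.ball z r))
    (hb : ∀ i, ∀ w ∈ Metric.ball z r, ‖F i w‖ ≤ u i) :
    DifferentiableAt ℂ (fun w => ∑' i, F i w) z := by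
  have hFd : ∀ i, ∀ w ∈ Metric.ball z r, DifferentiableAt ℂ (F i) w := fun i w hw =>
    (hF i).differentiableAt (Metric.isOpen_ball.mem_nhds hw)
  have hu0 : ∀ i, 0 ≤ u i := fun i => (norm_nonneg _).trans (hb i z (Metric.mem_ball_self hr))
  have hbd : ∀ i, ∀ w ∈ Metric.ball z (r / 2), ‖fderiv ℂ (F i) w‖ ≤ u i * (4 / r) := by
    intro i w hw
    refine ContinuousLinearMap.opNorm_le_bound _ (mul_nonneg (hu0 i) (by positivity)) fun v => ?_
    rcases eq_or_ne v 0 with rfl | hv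
    · simp
    have hv' : 0 < ‖v‖ := norm_pos_iff.2 hv
    -- With w in the half-radius ball, this disc moves w by at most r/4 and so stays inside the ball
    -- of radius r.
    set ρ := r / 4 / ‖v‖ with hρ
    have hρ0 : 0 < ρ := by positivity
    have hmem : ∀ t ∈ Metric.closedBall (0 : ℂ) ρ, w + t • v ∈ Metric.ball z r := by
      intro t ht
      rw [mem_closedBall_zero_iff] at ht
      rw [mem_ball_iff_norm] at hw ⊢
      calc ‖w + t • v - z‖ = ‖(w - z) + t • v‖ := by congr 1; abel
        _ ≤ ‖w - z‖ + ‖t‖ * ‖v‖ := (norm_add_le _ _).trans (by rw [norm_smul])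
        _ ≤ ‖w - z‖ + ρ * ‖v‖ := by gcongr
        _ = ‖w - z‖ + r / 4 := by rw [hρ]; field_simp
        _ < r := by linarith
    have hline : ∀ t : ℂ, HasDerivAt (fun t : ℂ => w + t • v) v t := fun t => by
      simpa using ((hasDerivAt_id t).smul_const v).const_add w
    have hφ : ∀ t ∈ Metric.closedBall (0 : ℂ) ρ, HasDerivAt (fun t : ℂ => F i (w + t • v))
        (fderiv ℂ (F i) (w + t • v) v) t := fun t ht =>
      (hFd i _ (hmem t ht)).hasFDerivAt.comp_hasDerivAt t (hline t)
    have hd : DiffContOnCl ℂ (fun t : ℂ => F i (w + t • v)) (Metric.ball 0 ρ) := by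
      refine DifferentiableOn.diffContOnCl fun t ht => ?_
      exact (hφ t (Metric.closure_ball_subset_closedBall ht)).differentiableAt.differentiableWithinAt
    have := Complex.norm_deriv_le_of_forall_mem_sphere_norm_le hρ0 hd (C := u i) fun t ht =>
      hb i _ (hmem t (Metric.sphere_subset_closedBall ht))
    rw [(hφ 0 (by simp [hρ0.le])).deriv] at this
    simp only [zero_smul, add_zero] at this
    refine this.trans (le_of_eq ?_)
    rw [hρ]; field_simp
  have hsub : Metric.ball z (r / 2) ⊆ Metric.ball z r := Metric.ball_subset_ball (by linarith)
  have hz : z ∈ Metric.ball z (r / 2) := Metric.mem_ball_self (by linarith)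
  exact (hasFDerivAt_tsum_of_isPreconnected (hu.mul_right (4 / r)) Metric.isOpen_ball
    (convex_ball z (r / 2)).isPreconnected
    (fun i w hw => (hFd i w (hsub hw)).hasFDerivAt) hbd hz
    (Summable.of_norm_bounded hu fun i => hb i z (hsub hz)) hz).differentiableAt

theorem differentiableAt_shiftPoch (j : ℕ) {w : ℂ} (hw : w ≠ 1) :
    DifferentiableAt ℂ (shiftPoch j) w := by
  cases j with
  | zero => exact (differentiableAt_id.sub_const 1).inv (sub_ne_zero.2 hw)
  | succ j => exact (ascPochhammer ℂ j).differentiable w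

theorem differentiableAt_emRem (p : ℕ) {n : ℕ} (hn : 0 < n) {w : ℂ} (hw : w ≠ 1) :
    DifferentiableAt ℂ (emRem p n) w := by
  have h1 : (n : ℂ) + 1 ≠ 0 := by exact_mod_cast Nat.succ_ne_zero n
  have h2 : (n : ℂ) ≠ 0 := by exact_mod_cast hn.ne'
  unfold emRem
  refine DifferentiableAt.add (DifferentiableAt.const_cpow (by fun_prop) (Or.inl h1))
    (DifferentiableAt.fun_sum fun j _ => ?_)
  refine DifferentiableAt.mul ((differentiableAt_shiftPoch j hw).const_mul _) ?_
  exact DifferentiableAt.sub (DifferentiableAt.const_cpow (by fun_prop) (Or.inl h1))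
    (DifferentiableAt.const_cpow (by fun_prop) (Or.inl h2))

theorem differentiableAt_pairTerm (p : ℕ) (x : ℕ × ℕ) {s : ℂ × ℂ} (hs : s.2 ≠ 1) :
    DifferentiableAt ℂ (fun s => pairTerm p s x) s := by
  have h1 : (x.1 : ℂ) + 1 ≠ 0 := by exact_mod_cast Nat.succ_ne_zero x.1
  unfold pairTerm
  refine DifferentiableAt.mul (DifferentiableAt.const_cpow (by fun_prop) (Or.inl h1)) ?_
  exact (differentiableAt_emRem p (by omega) hs).comp s differentiableAt_snd

theorem differentiableAt_tsum_pairTerm {q : ℕ} {s : ℂ × ℂ} (hs : s ∈ emRegion q) :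
    DifferentiableAt ℂ (fun s => ∑' x, pairTerm (q + 3) s x) s := by
  obtain ⟨h0, h2, h1⟩ := hs
  obtain ⟨η, hη, a, b⟩ := exists_pair_exponent h2 h1
  have hcont : ContinuousAt (fun s : ℂ × ℂ => ‖(ascPochhammer ℂ (q + 2)).eval s.2‖) s :=
    (((ascPochhammer ℂ (q + 2)).continuous.comp continuous_snd).norm).continuousAt
  set P := ‖(ascPochhammer ℂ (q + 2)).eval s.2‖ with hP
  have hev : ∀ᶠ t : ℂ × ℂ in nhds s, t.2 ≠ 1 ∧ 1 + η / 2 < t.2.re + (q + 2) ∧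
      2 + 2 * (η / 2) < t.1.re + (t.2.re + (q + 2)) ∧
      ‖(ascPochhammer ℂ (q + 2)).eval t.2‖ < P + 1 := by
    refine Filter.Eventually.and ?_ (Filter.Eventually.and ?_ (Filter.Eventually.and ?_ ?_))
    · exact (isOpen_ne_fun (by fun_prop) (by fun_prop)).mem_nhds h0
    · exact (isOpen_lt (f := fun _ : ℂ × ℂ => 1 + η / 2)
        (g := fun t : ℂ × ℂ => t.2.re + (q + 2)) (by fun_prop) (by fun_prop)).mem_nhds
        (show 1 + η / 2 < s.2.re + (q + 2) by linarith)
    · exact (isOpen_lt (f := fun _ : ℂ × ℂ => 2 + 2 * (η / 2))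
        (g := fun t : ℂ × ℂ => t.1.re + (t.2.re + (q + 2))) (by fun_prop) (by fun_prop)).mem_nhds
        (show 2 + 2 * (η / 2) < s.1.re + (s.2.re + (q + 2)) by linarith)
    · exact hcont.eventually_lt continuousAt_const (by linarith)
  obtain ⟨r, hr, hball⟩ := Metric.eventually_nhds_iff_ball.1 hev
  refine differentiableAt_tsum_of_norm_le hr
    ((summable_pair_rpow (half_pos hη)).mul_left ((P + 1) * (4 / (2 * Real.pi) ^ (q + 2))))
    (fun x t ht => (differentiableAt_pairTerm _ x (hball t ht).1).differentiableWithinAt) ?_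
  intro x t ht
  obtain ⟨b0, b1, b2, b3⟩ := hball t ht
  have hpi := Real.pi_pos
  refine (norm_pairTerm_le b0 (half_pos hη) b1.le b2.le x).trans ?_
  gcongr

/-- The Euler-Maclaurin representation of order `q + 3` of the double zeta function. -/
noncomputable def emZeta (q : ℕ) (s : ℂ × ℂ) : ℂ :=
  ∑ j ∈ Finset.range (q + 3), bernCoeff j * shiftPoch j s.2 * riemannZeta (s.1 + s.2 + j - 1) +
    ∑' x, pairTerm (q + 3) s x

theorem emZeta_succ {q : ℕ} {s : ℂ × ℂ} (hs : s ∈ emRegion q) : emZeta (q + 1) s = emZeta q s := by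
  have h := hasSum_pairTerm_succ (summable_pairTerm hs).hasSum
    (by have := hs.2.1; push_cast; linarith) (by have := hs.2.2; push_cast; rw [add_re]; linarith)
  rw [emZeta, emZeta, show q + 1 + 3 = q + 3 + 1 by ring, h.tsum_eq, Finset.sum_range_succ]
  ring

theorem emZeta_eq_of_le {q r : ℕ} (h : q ≤ r) {s : ℂ × ℂ} (hs : s ∈ emRegion q) :
    emZeta r s = emZeta q s := by
  induction r, h using Nat.le_induction with
  | base => rfl
  | succ r hr ih => rw [emZeta_succ (emRegion_mono hr hs), ih]

theorem emZeta_eq {q r : ℕ} {s : ℂ × ℂ} (hq : s ∈ emRegion q) (hr : s ∈ emRegion r) :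
    emZeta q s = emZeta r s := by
  rcases le_total q r with h | h
  · exact (emZeta_eq_of_le h hq).symm
  · exact emZeta_eq_of_le h hr

/-- The poles of ζ(s₁ + s₂ + j - 1) lie on s₁ + s₂ = 2 - j. For odd j ≥ 3 the Bernoulli number
vanishes, so only the hyperplanes excluded from the domain remain. -/
theorem differentiableAt_emZeta {q : ℕ} {s : ℂ × ℂ} (hs : s ∈ emRegion q)
    (hd : s ∈ doubleZetaDomain) : DifferentiableAt ℂ (emZeta q) s := by
  obtain ⟨h0, h1, h2⟩ := hd
  refine DifferentiableAt.add (DifferentiableAt.fun_sum fun j _ => ?_)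
    (differentiableAt_tsum_pairTerm hs)
  have hP : DifferentiableAt ℂ (fun s : ℂ × ℂ => shiftPoch j s.2) s :=
    (differentiableAt_shiftPoch j h0).comp s differentiableAt_snd
  have hz : ∀ j : ℕ, s.1 + s.2 + j - 1 ≠ 1 →
      DifferentiableAt ℂ (fun s : ℂ × ℂ => riemannZeta (s.1 + s.2 + j - 1)) s := fun j hj =>
    (differentiableAt_riemannZeta hj).comp s
      (f := fun s : ℂ × ℂ => s.1 + s.2 + j - 1) (by fun_prop)
  rcases j with _ | _ | j
  · refine (hP.const_mul _).mul (hz 0 fun h => h2 0 ?_)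
    push_cast at h ⊢
    linear_combination h
  · refine (hP.const_mul _).mul (hz 1 fun h => h1 ?_)
    push_cast at h
    linear_combination h
  · rcases Nat.even_or_odd' j with ⟨k, rfl | rfl⟩
    · refine (hP.const_mul _).mul (hz (2 * k + 1 + 1) fun h => h2 (k + 1) ?_)
      push_cast at h ⊢
      linear_combination h
    · rw [show 2 * k + 1 + 1 + 1 = 2 * k + 3 by ring, bernCoeff_odd]
      simp

/-- The equivalence `(m, k) ↦ (m + 1, m + k + 2)` onto the pairs `0 < m₁ < m₂`. -/
def pairEquiv : ℕ × ℕ ≃ {m : ℕ × ℕ // 0 < m.1 ∧ m.1 < m.2} where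
  toFun x := ⟨(x.1 + 1, x.1 + 1 + x.2 + 1), by constructor <;> simp⟩
  invFun m := (m.1.1 - 1, m.1.2 - m.1.1 - 1)
  left_inv x := by ext <;> simp; omega
  right_inv m := by
    obtain ⟨⟨a, b⟩, h1, h2⟩ := m
    simp only at h1 h2
    refine Subtype.ext (Prod.ext ?_ ?_) <;> simp only <;> omega

theorem summable_pairTerm_zero {s : ℂ × ℂ} (h₂ : 1 < s.2.re) (h₁ : 2 < (s.1 + s.2).re) :
    Summable (pairTerm 0 s) := by
  rw [add_re] at h₁
  obtain ⟨η, hη, a, b⟩ := exists_pair_exponent h₂ h₁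
  refine Summable.of_norm_bounded (summable_pair_rpow hη) fun x => ?_
  refine le_trans ?_ (pair_rpow_le hη a b x.1 x.2)
  rw [pairTerm, emRem, Finset.sum_range_zero, add_zero, norm_mul, norm_nat_add_one_cpow,
    norm_nat_add_one_cpow, neg_re, neg_re]
  refine mul_le_mul_of_nonneg_left ?_ (by positivity)
  exact Real.rpow_le_rpow_of_nonpos (by positivity) (by linarith) (by linarith)

theorem hasSum_emZeta {s : ℂ × ℂ} (h₂ : 1 < s.2.re) (h₁ : 2 < (s.1 + s.2).re) :
    HasSum (pairTerm 0 s) (emZeta 0 s) := by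
  have h0 := (summable_pairTerm_zero h₂ h₁).hasSum
  have h1 := hasSum_pairTerm_succ h0 (by simpa using h₂) (by push_cast; linarith)
  have h2 := hasSum_pairTerm_succ h1 (by push_cast; linarith) (by push_cast; linarith)
  have h3 := hasSum_pairTerm_succ h2 (by push_cast; linarith) (by push_cast; linarith)
  have e : emZeta 0 s = ∑' x, pairTerm 0 s x := by
    rw [emZeta, show 0 + 3 = 2 + 1 by rfl, show (2 : ℕ) + 1 = 1 + 1 + 1 by rfl,
      show (1 : ℕ) + 1 + 1 = 0 + 1 + 1 + 1 by rfl, h3.tsum_eq]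
    simp only [Finset.sum_range_succ, Finset.sum_range_zero]
    ring
  rw [e]; exact h0

/-- An index `q` with `s ∈ emRegion q`. -/
noncomputable def emIndex (s : ℂ × ℂ) : ℕ := ⌈|s.2.re| + |s.1.re|⌉₊ + 1

theorem mem_emRegion_emIndex {s : ℂ × ℂ} (hs : s.2 ≠ 1) : s ∈ emRegion (emIndex s) := by
  have h := Nat.le_ceil (|s.2.re| + |s.1.re|)
  have h1 := neg_abs_le s.1.re
  have h2 := neg_abs_le s.2.re
  have h3 := abs_nonneg s.1.re
  have h4 := abs_nonneg s.2.re
  refine ⟨hs, ?_, ?_⟩ <;> rw [emIndex] <;> push_cast <;> linarith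

/-- Representations of different orders agree where both are valid, so near a point the varying
index may be replaced by a fixed one. -/
theorem isDoubleZetaContinuation_emZeta :
    IsDoubleZetaContinuation fun s => emZeta (emIndex s) s := by
  constructor
  · intro s hs
    have hr := mem_emRegion_emIndex hs.1
    refine DifferentiableAt.differentiableWithinAt ?_
    refine (differentiableAt_emZeta hr hs).congr_of_eventuallyEq ?_
    filter_upwards [(isOpen_emRegion _).mem_nhds hr] with t ht
    exact emZeta_eq (mem_emRegion_emIndex ht.1) ht
  · intro s h2 h1
    have hne : s.2 ≠ 1 := fun h => by rw [h] at h2; simp at h2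
    have h0 : s ∈ emRegion 0 := by
      rw [add_re] at h1
      exact ⟨hne, by push_cast; linarith, by push_cast; linarith⟩
    beta_reduce
    rw [emZeta_eq (mem_emRegion_emIndex hne) h0, ← pairEquiv.hasSum_iff]
    refine hasSum_of_eq (hasSum_emZeta h2 h1) (fun x => ?_) rfl
    simp only [Function.comp_apply, pairTerm, emRem, pairEquiv, Equiv.coe_fn_mk,
      Finset.sum_range_zero, add_zero, cpow_neg]
    push_cast
    rw [one_div, mul_inv]

theorem isOpen_doubleZetaDomain : IsOpen doubleZetaDomain := by
  have h1 : IsOpen {s : ℂ × ℂ | s.2 ≠ 1} := isOpen_ne_fun continuous_snd continuous_const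
  have h2 : IsOpen {s : ℂ × ℂ | s.1 + s.2 ≠ 1} := isOpen_ne_fun (by fun_prop) continuous_const
  have h3 : IsOpen {s : ℂ × ℂ | ∀ n : ℕ, s.1 + s.2 ≠ 2 - 2 * (n : ℂ)} := by
    have hc : IsClosed (Set.range fun n : ℕ => (((n : ℝ)) : ℂ)) :=
      (Complex.isometry_ofReal.isClosedEmbedding.comp Nat.isClosedEmbedding_coe_real).isClosed_range
    convert (hc.preimage (f := fun s : ℂ × ℂ => 1 - (s.1 + s.2) / 2) (by fun_prop)).isOpen_compl
      using 1
    ext s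
    simp only [Set.mem_ofPred_eq, Set.mem_compl_iff, Set.mem_preimage, Set.mem_range, not_exists,
      ofReal_natCast]
    refine forall_congr' fun n => not_congr ?_
    constructor <;> intro h
    · rw [h]; ring
    · linear_combination 2 * h
  exact h1.inter (h2.inter h3)

/-- The identity theorem is used in one variable, on the line t ↦ (s₁ + t, s₂ + t). This line meets
the excluded hyperplanes in a countable set, whose complement in ℂ is connected, and it enters the
region of convergence for large Re t. -/
theorem IsDoubleZetaContinuation.eqOn {Z W : ℂ × ℂ → ℂ} (hZ : IsDoubleZetaContinuation Z)
    (hW : IsDoubleZetaContinuation W) : Set.EqOn Z W doubleZetaDomain := by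
  intro s hs
  set L : ℂ → ℂ × ℂ := fun t => (s.1 + t, s.2 + t) with hL
  set E : Set ℂ := {1 - s.2} ∪ ({(1 - (s.1 + s.2)) / 2} ∪
    Set.range fun n : ℕ => (2 - 2 * (n : ℂ) - (s.1 + s.2)) / 2) with hE
  have hEc : E.Countable :=
    (Set.countable_singleton _).union ((Set.countable_singleton _).union (Set.countable_range _))
  have hmem : ∀ t, t ∈ Eᶜ ↔ L t ∈ doubleZetaDomain := by
    intro t
    simp only [hE, hL, doubleZetaDomain, Set.mem_compl_iff, Set.mem_union, Set.mem_singleton_iff,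
      Set.mem_range, Set.mem_ofPred_eq, not_or, not_exists]
    refine and_congr (not_congr ?_) (and_congr (not_congr ?_) (forall_congr' fun n => not_congr ?_))
    · constructor <;> intro h
      · rw [h]; ring
      · linear_combination h
    · constructor <;> intro h
      · rw [h]; ring
      · linear_combination h / 2
    · constructor <;> intro h
      · rw [← h]; ring
      · linear_combination -h / 2
  have hEo : IsOpen Eᶜ := by
    have : Eᶜ = L ⁻¹' doubleZetaDomain := Set.ext hmem
    rw [this]
    exact isOpen_doubleZetaDomain.preimage (by fun_prop)
  have hconn : IsPreconnected Eᶜ :=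
    (hEc.isConnected_compl_of_one_lt_rank (by simp)).isPreconnected
  have han : ∀ {Z : ℂ × ℂ → ℂ}, IsDoubleZetaContinuation Z → AnalyticOnNhd ℂ (Z ∘ L) Eᶜ := by
    intro Z hZ
    refine DifferentiableOn.analyticOnNhd ?_ hEo
    refine hZ.1.comp (fun t _ => ?_) fun t ht => (hmem t).1 ht
    exact ((differentiableAt_id.const_add _).prodMk (differentiableAt_id.const_add _)).differentiableWithinAt
  set t₀ : ℝ := |s.1.re| + |s.2.re| + 2 with ht₀
  have hbig : ∀ t : ℂ, t₀ < t.re → 1 < (L t).2.re ∧ 2 < ((L t).1 + (L t).2).re := by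
    intro t ht
    have h1 := neg_abs_le s.1.re
    have h2 := neg_abs_le s.2.re
    have h3 := abs_nonneg s.1.re
    have h4 := abs_nonneg s.2.re
    simp only [hL, add_re]
    constructor <;> linarith
  have hev : ∀ t : ℂ, t₀ < t.re → Z (L t) = W (L t) := fun t ht =>
    (hZ.2 _ (hbig t ht).1 (hbig t ht).2).unique (hW.2 _ (hbig t ht).1 (hbig t ht).2)
  have hmem₁ : ((t₀ + 1 : ℝ) : ℂ) ∈ Eᶜ := by
    rw [hmem]
    obtain ⟨h2, h1⟩ := hbig ((t₀ + 1 : ℝ) : ℂ) (by simp)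
    refine ⟨fun h => ?_, fun h => ?_, fun n h => ?_⟩
    · rw [h] at h2; simp at h2
    · rw [h] at h1; norm_num at h1
    · rw [h] at h1
      have : (0 : ℝ) ≤ n := n.cast_nonneg
      simp at h1
      linarith
  have heq := (han hZ).eqOn_of_preconnected_of_eventuallyEq (han hW) hconn hmem₁ (by
    filter_upwards [(isOpen_lt continuous_const continuous_re).mem_nhds
      (show t₀ < ((t₀ + 1 : ℝ) : ℂ).re by simp)] with t ht
    exact hev t ht)
  have h0 : (0 : ℂ) ∈ Eᶜ := (hmem 0).2 (by simpa [hL] using hs)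
  simpa [hL] using heq h0

theorem isDoubleZetaContinuation_doubleZeta : IsDoubleZetaContinuation doubleZeta := by
  have h : ∃ Z : ℂ × ℂ → ℂ, IsDoubleZetaContinuation Z := ⟨_, isDoubleZetaContinuation_emZeta⟩
  rw [doubleZeta, dif_pos h]
  exact h.choose_spec

theorem doubleZeta_eq_emZeta {q : ℕ} {s : ℂ × ℂ} (hs : s ∈ doubleZetaDomain)
    (hq : s ∈ emRegion q) : doubleZeta s = emZeta q s := by
  rw [isDoubleZetaContinuation_doubleZeta.eqOn isDoubleZetaContinuation_emZeta hs]
  exact emZeta_eq (mem_emRegion_emIndex hs.1) hq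

/-! ### Bounds for trigonometric functions, Γ, f and ζ. -/

theorem norm_cos_le_exp (z : ℂ) : ‖Complex.cos z‖ ≤ Real.exp |z.im| := by
  have h1 : ‖Complex.exp (z * I)‖ ≤ Real.exp |z.im| := by
    rw [Complex.norm_exp, Real.exp_le_exp]; simpa using neg_le_abs z.im
  have h2 : ‖Complex.exp (-z * I)‖ ≤ Real.exp |z.im| := by
    rw [Complex.norm_exp, Real.exp_le_exp]; simpa using le_abs_self z.im
  rw [Complex.cos, norm_div, Complex.norm_two, div_le_iff₀ two_pos]
  exact (norm_add_le _ _).trans (by linarith)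

theorem norm_sin_le_exp (z : ℂ) : ‖Complex.sin z‖ ≤ Real.exp |z.im| := by
  rw [← Complex.cos_sub_pi_div_two]
  refine (norm_cos_le_exp _).trans (le_of_eq ?_)
  have e : ((Real.pi : ℂ) / 2).im = 0 := by
    rw [show (Real.pi : ℂ) / 2 = ((Real.pi / 2 : ℝ) : ℂ) by push_cast; ring, ofReal_im]
  rw [sub_im, e, sub_zero]

theorem norm_Gamma_le {z : ℂ} (hz : 0 < z.re) : ‖Complex.Gamma z‖ ≤ Real.Gamma z.re := by
  rw [Complex.Gamma_eq_integral hz, Complex.GammaIntegral, Real.Gamma_eq_integral hz]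
  refine (MeasureTheory.norm_integral_le_integral_norm _).trans (le_of_eq ?_)
  refine MeasureTheory.setIntegral_congr_fun measurableSet_Ioi fun x hx => ?_
  rw [norm_mul, Complex.norm_real, Real.norm_of_nonneg (Real.exp_pos _).le,
    Complex.norm_cpow_eq_rpow_re_of_pos hx, sub_re, one_re]

/-- The ratio |Γ(z)|/Γ(Re z) has a positive minimum on the compact rectangle 1 ≤ Re z ≤ 2, and the
recursion Γ(z + 1) = zΓ(z) can only increase it because |z| ≥ Re z. -/
theorem exists_mul_Gamma_le_norm_Gamma (T : ℝ) : ∃ c : ℝ, 0 < c ∧ ∀ z : ℂ, 1 ≤ z.re → |z.im| ≤ T →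
    c * Real.Gamma z.re ≤ ‖Complex.Gamma z‖ := by
  set S : Set ℂ := Set.Icc (1 : ℝ) 2 ×ℂ Set.Icc (-T) T with hS
  have hScomp : IsCompact S := isCompact_Icc.reProdIm isCompact_Icc
  have hcont : ContinuousOn (fun z : ℂ => ‖Complex.Gamma z‖ / Real.Gamma z.re) S := by
    intro z hz
    have hre : 1 ≤ z.re := (mem_reProdIm.1 hz).1.1
    have h1 : ContinuousAt Complex.Gamma z :=
      (Complex.differentiableAt_Gamma z fun m h => by
        have : z.re = -m := by rw [h]; simp
        have := m.cast_nonneg (α := ℝ)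
        linarith).continuousAt
    have h2 : ContinuousAt (fun z : ℂ => Real.Gamma z.re) z :=
      ContinuousAt.comp (f := Complex.re) (g := Real.Gamma)
        (Real.differentiableAt_Gamma fun m h => by
          have := m.cast_nonneg (α := ℝ)
          linarith).continuousAt continuous_re.continuousAt
    exact (h1.norm.div h2 (Real.Gamma_pos_of_pos (by linarith)).ne').continuousWithinAt
  have hmin : ∃ c : ℝ, 0 < c ∧ ∀ z ∈ S, c ≤ ‖Complex.Gamma z‖ / Real.Gamma z.re := by
    rcases S.eq_empty_or_nonempty with h | h
    · exact ⟨1, one_pos, fun z hz => by rw [h] at hz; exact hz.elim⟩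
    · obtain ⟨z₀, hz₀, hmin⟩ := hScomp.exists_isMinOn h hcont
      have hre : 1 ≤ z₀.re := (mem_reProdIm.1 hz₀).1.1
      refine ⟨_, ?_, fun z hz => hmin hz⟩
      exact div_pos (norm_pos_iff.2 (Complex.Gamma_ne_zero_of_re_pos (by linarith)))
        (Real.Gamma_pos_of_pos (by linarith))
  obtain ⟨c, hc, hmin⟩ := hmin
  refine ⟨c, hc, fun z hz hT => ?_⟩
  have main : ∀ n : ℕ, ∀ z : ℂ, 1 ≤ z.re → |z.im| ≤ T → z.re ≤ n + 2 →
      c * Real.Gamma z.re ≤ ‖Complex.Gamma z‖ := by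
    intro n
    induction n with
    | zero =>
      intro z hz hT h2
      have hmem : z ∈ S := mem_reProdIm.2 ⟨⟨hz, by simpa using h2⟩, abs_le.1 hT⟩
      exact (le_div_iff₀ (Real.Gamma_pos_of_pos (by linarith))).1 (hmin z hmem)
    | succ n ih =>
      intro z hz hT h2
      rcases le_or_gt z.re 2 with h | h
      · have hmem : z ∈ S := mem_reProdIm.2 ⟨⟨hz, h⟩, abs_le.1 hT⟩
        exact (le_div_iff₀ (Real.Gamma_pos_of_pos (by linarith))).1 (hmin z hmem)
      · have hw := ih (z - 1) (by simp; linarith) (by simpa using hT)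
          (by push_cast at h2; simp; linarith)
        have hne : z - 1 ≠ 0 := fun h0 => by
          have : (z - 1).re = 0 := by rw [h0]; simp
          simp at this; linarith
        have e1 : Complex.Gamma z = (z - 1) * Complex.Gamma (z - 1) := by
          rw [← Complex.Gamma_add_one _ hne, sub_add_cancel]
        have e2 : Real.Gamma z.re = (z.re - 1) * Real.Gamma (z.re - 1) := by
          rw [← Real.Gamma_add_one (by linarith), sub_add_cancel]
        have e3 : z.re - 1 ≤ ‖z - 1‖ := by simpa using Complex.re_le_norm (z - 1)
        simp only [sub_re, one_re] at hw
        rw [e1, e2, norm_mul]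
        calc _ = (z.re - 1) * (c * Real.Gamma (z.re - 1)) := by ring
          _ ≤ _ := mul_le_mul e3 hw
            (mul_nonneg hc.le (Real.Gamma_pos_of_pos (by linarith)).le) (norm_nonneg _)
  obtain ⟨n, hn⟩ := exists_nat_ge z.re
  exact main n z hz hT (by linarith)

theorem norm_zetaFactor (z : ℂ) :
    ‖zetaFactor z‖ = 2 * (2 * Real.pi) ^ (z.re - 1) * ‖Complex.Gamma (1 - z)‖ := by
  have hpi := Real.pi_pos
  have h2 : (2 : ℂ) = ((2 : ℝ) : ℂ) := by simp
  rw [zetaFactor, norm_mul, norm_mul, Complex.norm_cpow_eq_rpow_re_of_pos hpi, h2,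
    Complex.norm_cpow_eq_rpow_re_of_pos two_pos, Real.mul_rpow zero_le_two hpi.le, sub_re, one_re,
    Real.rpow_sub_one two_ne_zero]
  ring

theorem zetaFactor_add_one {z : ℂ} (hz : z ≠ 0) :
    zetaFactor (z + 1) * z = -(2 * Real.pi) * zetaFactor z := by
  have hpi : (Real.pi : ℂ) ≠ 0 := by exact_mod_cast Real.pi_ne_zero
  have h := Complex.Gamma_add_one (-z) (neg_ne_zero.2 hz)
  rw [zetaFactor, zetaFactor, show (1 : ℂ) - (z + 1) = -z by ring,
    show (1 : ℂ) - z = -z + 1 by ring, h, cpow_add _ _ two_ne_zero, cpow_one, add_sub_cancel_right,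
    cpow_sub _ _ hpi, cpow_one]
  field_simp

theorem zetaFactor_add_nat {s : ℂ} (n : ℕ) (h : ∀ i < n, s + i ≠ 0) :
    zetaFactor (s + n) * (ascPochhammer ℂ n).eval s = (-(2 * Real.pi)) ^ n * zetaFactor s := by
  induction n with
  | zero => simp
  | succ n ih =>
    have h1 := zetaFactor_add_one (h n (by omega))
    have h2 := ih fun i hi => h i (by omega)
    rw [ascPochhammer_succ_eval, Nat.cast_succ, ← add_assoc]
    linear_combination (ascPochhammer ℂ n).eval s * h1 + (-(2 * Real.pi : ℂ)) * h2

theorem zetaFactor_ne_zero {z : ℂ} (hz : z.re < 1) : zetaFactor z ≠ 0 := by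
  have hpi : (Real.pi : ℂ) ≠ 0 := by exact_mod_cast Real.pi_ne_zero
  refine mul_ne_zero (mul_ne_zero ?_ ?_) (Complex.Gamma_ne_zero_of_re_pos (by simp; linarith))
  · simp [cpow_eq_zero_iff]
  · simp [cpow_eq_zero_iff, hpi]

theorem riemannZeta_eq_zetaFactor_mul {z : ℂ} (hz : z.re < 0) :
    riemannZeta z = zetaFactor z * Complex.sin (Real.pi / 2 * z) * riemannZeta (1 - z) := by
  have hpi : (Real.pi : ℂ) ≠ 0 := by exact_mod_cast Real.pi_ne_zero
  have h := riemannZeta_one_sub (s := 1 - z) (fun n h => by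
    have := congrArg Complex.re h
    simp at this
    have := n.cast_nonneg (α := ℝ)
    linarith) (fun h => by
    have := congrArg Complex.re h
    simp at this
    linarith)
  rw [sub_sub_cancel] at h
  rw [h, zetaFactor]
  have e1 : Complex.cos (Real.pi * (1 - z) / 2) = Complex.sin (Real.pi / 2 * z) := by
    rw [← Complex.cos_pi_div_two_sub]; congr 1; ring
  have e2 : (2 * (Real.pi : ℂ)) ^ (-(1 - z)) = 2 ^ (z - 1) * (Real.pi : ℂ) ^ (z - 1) := by
    have := Complex.mul_cpow_ofReal_nonneg (zero_le_two (α := ℝ)) Real.pi_pos.le (z - 1)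
    rw [show -(1 - z) = z - 1 by ring]
    simpa using this
  rw [e1, e2, cpow_sub _ _ (two_ne_zero : (2 : ℂ) ≠ 0), cpow_one]
  ring

theorem norm_zeta_sub_one_le {u : ℂ} (hu : 2 ≤ u.re) :
    ‖riemannZeta u - 1‖ ≤ 8 * 2 ^ (-u.re) := by
  have h1 : 1 < u.re := by linarith
  have hz := zeta_eq_tsum_one_div_nat_add_one_cpow h1
  have hs : Summable fun n : ℕ => 1 / ((n : ℂ) + 1) ^ u := by
    have := (summable_nat_add_iff 1).2 ((Complex.summable_one_div_nat_cpow (p := u)).2 h1)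
    simpa using this
  have h0 : HasSum (fun n : ℕ => 1 / (((n + 1 : ℕ) : ℂ) + 1) ^ u) (riemannZeta u - 1) := by
    have := (hasSum_nat_add_iff' 1).2 (hz ▸ hs.hasSum)
    simpa using this
  have hz2 : HasSum (fun n : ℕ => 1 / ((n + 1 : ℕ) : ℝ) ^ 2) (Real.pi ^ 2 / 6) := by
    have := (hasSum_nat_add_iff' 1).2 hasSum_zeta_two
    simpa using this
  have hb : ∀ n : ℕ, ‖1 / (((n + 1 : ℕ) : ℂ) + 1) ^ u‖ ≤
      2 ^ (-(u.re - 2)) * (1 / ((n + 1 : ℕ) : ℝ) ^ 2) := by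
    intro n
    have hn : (0 : ℝ) ≤ n := n.cast_nonneg
    rw [norm_div, norm_one, norm_nat_add_one_cpow]
    push_cast
    have e : 1 / ((n : ℝ) + 1 + 1) ^ u.re =
        ((n : ℝ) + 1 + 1) ^ (-(u.re - 2)) * (1 / ((n : ℝ) + 1 + 1) ^ 2) := by
      rw [one_div, ← Real.rpow_neg (by positivity), one_div, ← Real.rpow_natCast,
        ← Real.rpow_neg (by positivity), ← Real.rpow_add (by positivity)]
      congr 1
      push_cast; ring
    rw [e]
    refine mul_le_mul ?_ ?_ (by positivity) (by positivity)
    · exact Real.rpow_le_rpow_of_nonpos two_pos (by linarith) (by linarith)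
    · apply one_div_le_one_div_of_le (by positivity)
      gcongr
      linarith
  rw [← h0.tsum_eq]
  refine (tsum_of_norm_bounded (hz2.mul_left _) hb).trans ?_
  have e : (2 : ℝ) ^ (-(u.re - 2)) = 4 * 2 ^ (-u.re) := by
    rw [neg_sub, sub_eq_add_neg, Real.rpow_add two_pos]; norm_num
  rw [e]
  have h2 : (0 : ℝ) < 2 ^ (-u.re) := by positivity
  have h3 : Real.pi ^ 2 / 6 ≤ 2 := by nlinarith [Real.pi_lt_d2, Real.pi_pos]
  nlinarith

theorem norm_zeta_le_three {u : ℂ} (hu : 2 ≤ u.re) : ‖riemannZeta u‖ ≤ 3 := by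
  have h1 := norm_zeta_sub_one_le hu
  have h2 : (2 : ℝ) ^ (-u.re) ≤ 2 ^ (-2 : ℝ) :=
    Real.rpow_le_rpow_of_exponent_le one_le_two (by linarith)
  have h3 : (2 : ℝ) ^ (-2 : ℝ) = 1 / 4 := by
    rw [Real.rpow_neg two_pos.le, show (2 : ℝ) = ((2 : ℕ) : ℝ) by norm_num, Real.rpow_natCast]
    norm_num
  have h4 : ‖riemannZeta u‖ ≤ ‖riemannZeta u - 1‖ + ‖(1 : ℂ)‖ := by
    simpa using norm_add_le (riemannZeta u - 1) 1
  rw [norm_one] at h4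
  rw [h3] at h2
  linarith

theorem exists_norm_sub_one_mul_zeta_le (a b T : ℝ) : ∃ C : ℝ, 0 < C ∧ ∀ z : ℂ, a ≤ z.re →
    z.re ≤ b → |z.im| ≤ T → ‖z - 1‖ * ‖riemannZeta z‖ ≤ C := by
  -- The singularity of (z - 1)ζ(z) is removed by the residue 1, which gives a continuous function
  -- to bound on a compact rectangle.
  set g : ℂ → ℂ := Function.update (fun z => (z - 1) * riemannZeta z) 1 1 with hg
  have hcont : Continuous g := by
    rw [continuous_iff_continuousAt]
    intro z
    rcases eq_or_ne z 1 with rfl | hz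
    · rw [hg, continuousAt_update_same]
      exact riemannZeta_residue_one
    · rw [hg, continuousAt_update_of_ne hz]
      exact (continuousAt_id.sub continuousAt_const).mul
        (differentiableAt_riemannZeta hz).continuousAt
  obtain ⟨C, hC⟩ := (isCompact_Icc.reProdIm isCompact_Icc :
    IsCompact (Set.Icc a b ×ℂ Set.Icc (-T) T)).exists_bound_of_continuousOn hcont.continuousOn
  refine ⟨max C 1, by positivity, fun z h1 h2 h3 => ?_⟩
  rcases eq_or_ne z 1 with rfl | hz
  · simp
  · have := hC z (mem_reProdIm.2 ⟨⟨h1, h2⟩, abs_le.1 h3⟩)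
    rw [hg, Function.update_of_ne hz, norm_mul] at this
    exact this.trans (le_max_left _ _)

/-! ### Exponential gains and factorial inequalities. -/

theorem exists_pow_mul_rpow_le {q : ℝ} (h0 : 0 < q) (h1 : q < 1) (P : ℕ) :
    ∃ C : ℝ, 0 < C ∧ ∀ x : ℝ, 0 ≤ x → x ^ P * q ^ x ≤ C := by
  have hl : 0 < -Real.log q := neg_pos.2 (Real.log_neg h0 h1)
  refine ⟨(Nat.factorial P : ℝ) / (-Real.log q) ^ P, by positivity, fun x hx => ?_⟩
  have h := Real.pow_div_factorial_le_exp _ (mul_nonneg hx hl.le) P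
  rw [Real.rpow_def_of_pos h0, le_div_iff₀ (by positivity)]
  have e : Real.exp (Real.log q * x) = (Real.exp (x * -Real.log q))⁻¹ := by
    rw [← Real.exp_neg]; congr 1; ring
  rw [e, mul_right_comm, ← mul_pow]
  rw [div_le_iff₀ (by positivity)] at h
  calc _ ≤ Real.exp (x * -Real.log q) * (Nat.factorial P : ℝ) * (Real.exp (x * -Real.log q))⁻¹ := by
        gcongr
    _ = _ := by
        have := (Real.exp_pos (x * -Real.log q)).ne'
        field_simp

theorem norm_ascPochhammer_mul_factorial_le {w : ℂ} {B D : ℕ}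
    (h : ∀ i : ℕ, ‖w + i‖ ≤ |(B : ℝ) - i| + D) {k : ℕ} (hk : k ≤ B) :
    ‖(ascPochhammer ℂ k).eval w‖ * (Nat.factorial (B - k + D) : ℝ) ≤ Nat.factorial (B + D) := by
  induction k with
  | zero => simp
  | succ k ih =>
    have ih := ih (by omega)
    have hk' : (k : ℝ) ≤ B := by exact_mod_cast (by omega : k ≤ B)
    have h1 := h k
    rw [abs_of_nonneg (by linarith)] at h1
    have e : (Nat.factorial (B - k + D) : ℝ) = ((B : ℝ) - k + D) *
        (Nat.factorial (B - (k + 1) + D) : ℝ) := by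
      rw [show B - k + D = (B - (k + 1) + D) + 1 by omega, Nat.factorial_succ]
      push_cast [Nat.cast_sub hk]
      ring
    rw [ascPochhammer_succ_eval, norm_mul]
    rw [e] at ih
    calc _ ≤ ‖(ascPochhammer ℂ k).eval w‖ * ((B : ℝ) - k + D) *
          (Nat.factorial (B - (k + 1) + D) : ℝ) := by gcongr
      _ ≤ _ := by linarith

/-- The factors decrease for i < B, contributing at most (B + D)!, and increase afterwards,
contributing at most (p + D)!. -/
theorem norm_ascPochhammer_le {w : ℂ} {B D : ℕ}
    (h : ∀ i : ℕ, ‖w + i‖ ≤ |(B : ℝ) - i| + D) (p : ℕ) :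
    ‖(ascPochhammer ℂ (B + p)).eval w‖ ≤ Nat.factorial (B + D) * Nat.factorial (p + D) := by
  induction p with
  | zero =>
    have h1 := norm_ascPochhammer_mul_factorial_le h le_rfl
    have h2 : (1 : ℝ) ≤ Nat.factorial D := by exact_mod_cast Nat.factorial_pos D
    simp only [Nat.sub_self, zero_add, add_zero] at *
    have h3 : (0 : ℝ) < Nat.factorial (B + D) := by exact_mod_cast Nat.factorial_pos _
    calc _ ≤ ‖(ascPochhammer ℂ B).eval w‖ * (Nat.factorial D : ℝ) :=
          le_mul_of_one_le_right (norm_nonneg _) h2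
      _ ≤ Nat.factorial (B + D) := h1
      _ ≤ _ := le_mul_of_one_le_right h3.le h2
  | succ p ih =>
    have h1 := h (B + p)
    rw [show (B : ℝ) - ((B + p : ℕ) : ℝ) = -p by push_cast; ring, abs_neg,
      abs_of_nonneg p.cast_nonneg] at h1
    rw [← add_assoc, ascPochhammer_succ_eval, norm_mul,
      show p + 1 + D = p + D + 1 by ring, Nat.factorial_succ]
    calc _ ≤ (Nat.factorial (B + D) * Nat.factorial (p + D)) * ((p : ℝ) + D) := by gcongr
      _ ≤ (Nat.factorial (B + D) * Nat.factorial (p + D)) * ((p : ℝ) + D + 1) :=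
          mul_le_mul_of_nonneg_left (by linarith) (by positivity)
      _ = _ := by push_cast; ring

theorem pow_mul_descFactorial_le (x y k : ℕ) :
    (x + y) ^ k * x.descFactorial k ≤ x ^ k * (x + y).descFactorial k := by
  induction k with
  | zero => simp
  | succ k ih =>
    have h : (x + y) * (x - k) ≤ x * (x + y - k) := by
      rcases le_total x k with h | h
      · simp [Nat.sub_eq_zero_of_le h]
      · obtain ⟨d, rfl⟩ := Nat.exists_eq_add_of_le h
        rw [show k + d - k = d by omega, show k + d + y - k = d + y by omega]
        nlinarith [Nat.zero_le (k * y)]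
    calc _ = ((x + y) * (x - k)) * ((x + y) ^ k * x.descFactorial k) := by
          rw [Nat.descFactorial_succ]; ring
      _ ≤ (x * (x + y - k)) * (x ^ k * (x + y).descFactorial k) := Nat.mul_le_mul h ih
      _ = _ := by rw [Nat.descFactorial_succ]; ring

/-- This is the bound C(x + y, x) ≥ ((x + y)/x)^x, proved factor by factor in
`pow_mul_descFactorial_le`. -/
theorem factorial_mul_factorial_le {x y : ℕ} {q : ℝ} (hx : (x : ℝ) ≤ q * (x + y)) :
    (Nat.factorial x : ℝ) * Nat.factorial y ≤ q ^ x * Nat.factorial (x + y) := by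
  rcases Nat.eq_zero_or_pos x with rfl | hx0
  · simp
  have h := pow_mul_descFactorial_le x y x
  rw [Nat.descFactorial_self] at h
  have h2 : Nat.factorial y * (x + y).descFactorial x = Nat.factorial (x + y) := by
    have := Nat.factorial_mul_descFactorial (show x ≤ x + y by omega)
    rwa [show x + y - x = y by omega] at this
  have h3 : ((x : ℝ) + y) ^ x * (Nat.factorial x * Nat.factorial y) ≤
      (x : ℝ) ^ x * Nat.factorial (x + y) := by
    have : (x + y) ^ x * (Nat.factorial x * Nat.factorial y) ≤ x ^ x * Nat.factorial (x + y) := by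
      rw [← h2]; nlinarith [Nat.zero_le (Nat.factorial y)]
    exact_mod_cast this
  have hp : (0 : ℝ) < ((x : ℝ) + y) ^ x := by positivity
  have h4 : (x : ℝ) ^ x ≤ q ^ x * ((x : ℝ) + y) ^ x := by
    rw [← mul_pow]; gcongr
  refine le_of_mul_le_mul_left ?_ hp
  calc _ ≤ _ := h3
    _ ≤ q ^ x * ((x : ℝ) + y) ^ x * Nat.factorial (x + y) := by gcongr
    _ = _ := by ring

theorem factorial_add_le (m k : ℕ) :
    Nat.factorial (m + k) ≤ Nat.factorial m * (m + k) ^ k := by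
  rw [← Nat.factorial_mul_ascFactorial]
  exact Nat.mul_le_mul_left _ (Nat.ascFactorial_le_pow_add m k)

/-- Since B/A lies between ε and 1 - ε up to rounding, the inverse binomial coefficient is at most
(q^ε)^A, which beats A^P and the polynomial loss from the shifts by D. -/
theorem exists_factorial_quotient_le {ε : ℝ} (h0 : 0 < ε) (h1 : ε < 1) (D P : ℕ) :
    ∃ C R : ℝ, 0 < C ∧ ∀ (A : ℝ) (B A₀ : ℕ), R ≤ A → A ≤ A₀ → A₀ < A + 1 → ε * A ≤ B → B ≤ A₀ →
      B ≤ (1 - ε) * A + 1 →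
      A ^ P * (Nat.factorial (B + D) * Nat.factorial (A₀ - B + D) : ℝ) ≤
        C * Nat.factorial (A₀ - 1) := by
  set q := 1 - ε / 2 with hq
  have hq0 : 0 < q := by rw [hq]; linarith
  have hq1 : q < 1 := by rw [hq]; linarith
  have hθ0 : 0 < q ^ ε := by positivity
  have hθ1 : q ^ ε < 1 := Real.rpow_lt_one hq0.le hq1 h0
  obtain ⟨C, hC, hb⟩ := exists_pow_mul_rpow_le hθ0 hθ1 (P + (2 * D + 1))
  -- The first threshold gives (1 - ε)A + 1 + D ≤ (1 - ε/2)A, the second gives A₀ + 2D ≤ 2A.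
  refine ⟨2 ^ (2 * D + 1) * C, max (2 * (1 + D) / ε) (1 + 2 * D), by positivity,
    fun A B A₀ hR hA₀ hA₀' hB hBA hB' => ?_⟩
  rw [max_le_iff] at hR
  obtain ⟨hR1, hR2⟩ := hR
  rw [div_le_iff₀ h0] at hR1
  have hD : (0 : ℝ) ≤ D := D.cast_nonneg
  have hA1 : 1 ≤ A := by linarith
  have hA₀1 : 1 ≤ A₀ := by
    have : (1 : ℝ) ≤ A₀ := hA1.trans hA₀
    exact_mod_cast this
  have hxy : B + D + (A₀ - B + D) = A₀ - 1 + (2 * D + 1) := by omega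
  have hsum : ((B + D : ℕ) : ℝ) + ((A₀ - B + D : ℕ) : ℝ) = A₀ + 2 * D := by
    push_cast [Nat.cast_sub hBA]; ring
  have hx : ((B + D : ℕ) : ℝ) ≤ q * (((B + D : ℕ) : ℝ) + ((A₀ - B + D : ℕ) : ℝ)) := by
    rw [hsum]
    have h3 : q * A ≤ q * (A₀ + 2 * D) := by gcongr; linarith
    refine le_trans ?_ h3
    push_cast
    rw [hq]
    nlinarith
  have key := factorial_mul_factorial_le hx
  rw [hxy] at key
  have h4 : (Nat.factorial (A₀ - 1 + (2 * D + 1)) : ℝ) ≤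
      Nat.factorial (A₀ - 1) * (2 * A) ^ (2 * D + 1) := by
    have h5 : (Nat.factorial (A₀ - 1 + (2 * D + 1)) : ℝ) ≤
        Nat.factorial (A₀ - 1) * ((A₀ - 1 + (2 * D + 1) : ℕ) : ℝ) ^ (2 * D + 1) := by
      exact_mod_cast factorial_add_le (A₀ - 1) (2 * D + 1)
    refine h5.trans ?_
    gcongr
    rw [← hxy]
    rw [Nat.cast_add, hsum]
    linarith
  have h6 : q ^ (B + D) ≤ (q ^ ε) ^ A := by
    rw [← Real.rpow_mul hq0.le, ← Real.rpow_natCast]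
    apply Real.rpow_le_rpow_of_exponent_ge hq0 hq1.le
    push_cast
    linarith
  calc _ ≤ A ^ P * ((q ^ ε) ^ A * (Nat.factorial (A₀ - 1) * (2 * A) ^ (2 * D + 1))) := by
        refine mul_le_mul_of_nonneg_left (key.trans ?_) (by positivity)
        gcongr
    _ = 2 ^ (2 * D + 1) * (A ^ (P + (2 * D + 1)) * (q ^ ε) ^ A) * Nat.factorial (A₀ - 1) := by
        rw [mul_pow, pow_add]; ring
    _ ≤ _ := by
        gcongr
        exact hb A (by linarith)

/-! ### Admissible points; the tail and the remainder are negligible relative to f. -/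

/-- The conditions on `(s₁, s₂)` in the asymptotic formula, apart from the lower bound on
`-Re s₁, -Re s₂`. -/
structure Admissible (ε : ℝ) (s₁ s₂ : ℂ) : Prop where
  im₁ : |s₁.im| ≤ 1 / ε
  im₂ : |s₂.im| ≤ 1 / ε
  lo₁ : ε * -(s₁ + s₂).re ≤ -s₁.re
  lo₂ : ε * -(s₁ + s₂).re ≤ -s₂.re
  sep : ∀ k : ℤ, ‖s₁ + s₂‖ ^ (-(1 / ε)) < ‖s₁ + s₂ - 2 * (k : ℂ)‖

namespace Admissible
variable {ε : ℝ} {s₁ s₂ : ℂ}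

theorem abs_im_add_le (h : Admissible ε s₁ s₂) : |(s₁ + s₂).im| ≤ 2 / ε := by
  rw [add_im]
  refine (abs_add_le _ _).trans ?_
  have := add_le_add h.im₁ h.im₂
  calc _ ≤ _ := this
    _ = _ := by ring

theorem norm_le (h : Admissible ε s₁ s₂) (hA : 2 / ε ≤ -(s₁ + s₂).re) :
    ‖s₁ + s₂‖ ≤ 2 * -(s₁ + s₂).re := by
  have h1 := Complex.norm_le_abs_re_add_abs_im (s₁ + s₂)
  have h2 := h.abs_im_add_le
  have h3 : 0 ≤ 2 / ε := (abs_nonneg _).trans h2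
  rw [abs_of_nonpos (a := (s₁ + s₂).re) (by linarith)] at h1
  linarith

theorem neg_re_le_norm : -(s₁ + s₂).re ≤ ‖s₁ + s₂‖ :=
  (neg_le_abs _).trans (Complex.abs_re_le_norm _)

/-- In the constant, 1/ε absorbs the imaginary part and 1 absorbs the rounding of -Re s₂; this is
the input for `norm_ascPochhammer_le`. -/
theorem norm_add_nat_le (h : Admissible ε s₁ s₂) (h2 : 0 ≤ -s₂.re) (i : ℕ) :
    ‖s₂ + i‖ ≤ |((⌈-s₂.re⌉₊ : ℕ) : ℝ) - i| + (⌈1 / ε⌉₊ + 1 : ℕ) := by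
  have h1 := Complex.norm_le_abs_re_add_abs_im (s₂ + i)
  have h3 := h.im₂
  have h4 := Nat.le_ceil (1 / ε)
  have h5 := Nat.le_ceil (-s₂.re)
  have h6 := Nat.ceil_lt_add_one h2
  simp only [add_re, add_im, natCast_re, natCast_im, add_zero] at h1
  have h7 : |s₂.re + i| ≤ |((⌈-s₂.re⌉₊ : ℕ) : ℝ) - i| + 1 := by
    rw [← abs_neg]
    have e : -(s₂.re + i) = (((⌈-s₂.re⌉₊ : ℕ) : ℝ) - i) + (-s₂.re - ((⌈-s₂.re⌉₊ : ℕ) : ℝ)) := by ring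
    rw [e]
    refine (abs_add_le _ _).trans ?_
    gcongr
    rw [abs_le]
    constructor <;> linarith
  push_cast
  linarith

end Admissible

theorem exists_zetaFactor_ge (ε : ℝ) : ∃ c : ℝ, 0 < c ∧ ∀ s₁ s₂ : ℂ,
    Admissible ε s₁ s₂ → 2 ≤ -(s₁ + s₂).re →
    c * ((2 * Real.pi) ^ (s₁ + s₂).re * Nat.factorial (⌈-(s₁ + s₂).re⌉₊ - 1)) ≤
      ‖zetaFactor (s₁ + s₂)‖ := by
  obtain ⟨c, hc, h⟩ := exists_mul_Gamma_le_norm_Gamma (2 / ε)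
  have hpi := Real.pi_pos
  refine ⟨2 * c / (2 * Real.pi), by positivity, fun s₁ s₂ hs hA => ?_⟩
  set s := s₁ + s₂ with hsdef
  have h1 := h (1 - s) (by simp only [sub_re, one_re]; linarith)
    (by simp only [sub_im, one_im, zero_sub, abs_neg]; exact hs.abs_im_add_le)
  have hceil : 2 ≤ ⌈-s.re⌉₊ := by
    have : (2 : ℝ) ≤ ⌈-s.re⌉₊ := hA.trans (Nat.le_ceil _)
    exact_mod_cast this
  have h2 : (Nat.factorial (⌈-s.re⌉₊ - 1) : ℝ) ≤ Real.Gamma (1 - s).re := by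
    rw [← Real.Gamma_nat_eq_factorial, Nat.cast_sub (by omega), Nat.cast_one, sub_add_cancel]
    have h3 := Nat.ceil_lt_add_one (show 0 ≤ -s.re by linarith)
    refine Real.Gamma_strictMonoOn_Ici.monotoneOn (Set.mem_Ici.2 (by exact_mod_cast hceil))
      (Set.mem_Ici.2 ?_) ?_
    · simp only [sub_re, one_re]; linarith
    · simp only [sub_re, one_re]; linarith
  rw [norm_zetaFactor, Real.rpow_sub_one (by positivity)]
  calc _ = 2 * ((2 * Real.pi) ^ s.re / (2 * Real.pi)) *
        (c * Nat.factorial (⌈-s.re⌉₊ - 1)) := by ring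
    _ ≤ 2 * ((2 * Real.pi) ^ s.re / (2 * Real.pi)) * (c * Real.Gamma (1 - s).re) := by gcongr
    _ ≤ _ := by gcongr

/-- If Re(s + n) < -1 the functional equation gives the bound. Otherwise s + n lies in a compact
range of real and imaginary parts; as n is odd, s + n - 1 is s minus an even integer, so separation
bounds the pole by |s|^(1/ε), a power of A. -/
theorem exists_zeta_add_odd_le (ε : ℝ) : ∃ C : ℝ, ∃ P : ℕ, 0 < C ∧ ∀ s₁ s₂ : ℂ,
    Admissible ε s₁ s₂ → max 1 (2 / ε) ≤ -(s₁ + s₂).re → ∀ k : ℕ,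
    2 * k + 1 ≤ ⌈-(s₁ + s₂).re⌉₊ + 4 →
    ‖riemannZeta (s₁ + s₂ + (2 * k + 1 : ℕ))‖ ≤ C * (-(s₁ + s₂).re) ^ P *
      ((2 * Real.pi) ^ (((2 * k + 1 : ℕ) : ℝ) + (s₁ + s₂).re) *
        Nat.factorial (⌈-(s₁ + s₂).re⌉₊ - (2 * k + 1))) := by
  obtain ⟨C₁, hC₁, h₁⟩ := exists_norm_sub_one_mul_zeta_le (-1) 5 (2 / ε)
  have hpi := Real.pi_gt_three
  set P := ⌈1 / ε⌉₊ with hP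
  set C₂ := 2 * Real.exp (Real.pi / 2 * (2 / ε)) * 3 with hC₂
  refine ⟨C₁ * 2 ^ P * (2 * Real.pi) + C₂, P, by positivity, fun s₁ s₂ hs hA k hk => ?_⟩
  rw [max_le_iff] at hA
  obtain ⟨hA1, hA2⟩ := hA
  have hnorm := hs.norm_le hA2
  have hnorm' := Admissible.neg_re_le_norm (s₁ := s₁) (s₂ := s₂)
  have him := hs.abs_im_add_le
  have hsep := hs.sep (-k : ℤ)
  set s := s₁ + s₂ with hsdef
  set A := -s.re with hAdef
  have hre : s.re = -A := by rw [hAdef]; ring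
  set n := 2 * k + 1 with hn
  have hz_re : (s + (n : ℂ)).re = n - A := by simp [hre]; ring
  have hz_im : (s + (n : ℂ)).im = s.im := by simp
  have hAP : 1 ≤ A ^ P := one_le_pow₀ hA1
  rw [hre, ← sub_eq_add_neg]
  have hfac : (1 : ℝ) ≤ Nat.factorial (⌈A⌉₊ - n) := by exact_mod_cast Nat.factorial_pos _
  have hceil : (⌈A⌉₊ : ℝ) < A + 1 := Nat.ceil_lt_add_one (by linarith)
  have hkR : (n : ℝ) ≤ ⌈A⌉₊ + 4 := by exact_mod_cast hk
  rcases le_or_gt (-1) ((n : ℝ) - A) with h | h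
  · have hb := h₁ (s + (n : ℂ)) (by rw [hz_re]; exact h) (by rw [hz_re]; linarith)
      (by rw [hz_im]; exact him)
    have e : s + (n : ℂ) - 1 = s - 2 * ((-k : ℤ) : ℂ) := by rw [hn]; push_cast; ring
    rw [e] at hb
    have hs1 : 1 ≤ ‖s‖ := hA1.trans hnorm'
    have h2 : ‖s‖ ^ (1 / ε) ≤ 2 ^ P * A ^ P := by
      calc ‖s‖ ^ (1 / ε) ≤ ‖s‖ ^ (P : ℝ) :=
            Real.rpow_le_rpow_of_exponent_le hs1 (Nat.le_ceil _)
        _ = ‖s‖ ^ P := Real.rpow_natCast _ _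
        _ ≤ (2 * A) ^ P := by gcongr
        _ = _ := mul_pow _ _ _
    have h3 : ‖riemannZeta (s + (n : ℂ))‖ ≤ C₁ * ‖s‖ ^ (1 / ε) := by
      have h4 : 0 < ‖s‖ ^ (1 / ε) := by positivity
      rw [Real.rpow_neg (norm_nonneg _)] at hsep
      have h5 : (‖s‖ ^ (1 / ε))⁻¹ * ‖riemannZeta (s + (n : ℂ))‖ ≤ C₁ :=
        (mul_le_mul_of_nonneg_right hsep.le (norm_nonneg _)).trans hb
      rwa [inv_mul_le_iff₀ h4, mul_comm] at h5
    have h6 : (2 * Real.pi)⁻¹ ≤ (2 * Real.pi) ^ ((n : ℝ) - A) := by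
      rw [← Real.rpow_neg_one]
      exact Real.rpow_le_rpow_of_exponent_le (by linarith) h
    have h7 : 1 ≤ (2 * Real.pi) * ((2 * Real.pi) ^ ((n : ℝ) - A) * Nat.factorial (⌈A⌉₊ - n)) := by
      rw [← mul_assoc]
      have : 1 ≤ (2 * Real.pi) * (2 * Real.pi) ^ ((n : ℝ) - A) := by
        rw [inv_le_iff_one_le_mul₀ (by positivity)] at h6
        linarith
      nlinarith
    calc _ ≤ C₁ * (2 ^ P * A ^ P) := h3.trans (by gcongr)
      _ ≤ C₁ * (2 ^ P * A ^ P) * ((2 * Real.pi) *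
          ((2 * Real.pi) ^ ((n : ℝ) - A) * Nat.factorial (⌈A⌉₊ - n))) :=
          le_mul_of_one_le_right (by positivity) h7
      _ = (C₁ * 2 ^ P * (2 * Real.pi)) * A ^ P *
          ((2 * Real.pi) ^ ((n : ℝ) - A) * Nat.factorial (⌈A⌉₊ - n)) := by ring
      _ ≤ _ := by
          gcongr
          have : 0 < C₂ := by positivity
          linarith
  · rw [riemannZeta_eq_zetaFactor_mul (by rw [hz_re]; linarith), norm_mul, norm_mul,
      norm_zetaFactor, hz_re]
    have hre1 : (1 - (s + (n : ℂ))).re = 1 + A - n := by rw [sub_re, hz_re, one_re]; ring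
    have h2 : ‖riemannZeta (1 - (s + (n : ℂ)))‖ ≤ 3 :=
      norm_zeta_le_three (by rw [hre1]; linarith)
    have hnA : n ≤ ⌈A⌉₊ := by
      have : (n : ℝ) ≤ ⌈A⌉₊ := by linarith [Nat.le_ceil A]
      exact_mod_cast this
    have h3 : ‖Complex.Gamma (1 - (s + (n : ℂ)))‖ ≤ Nat.factorial (⌈A⌉₊ - n) := by
      refine (norm_Gamma_le (by rw [hre1]; linarith)).trans ?_
      rw [hre1, ← Real.Gamma_nat_eq_factorial, Nat.cast_sub hnA]
      have := Nat.le_ceil A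
      refine Real.Gamma_strictMonoOn_Ici.monotoneOn (Set.mem_Ici.2 (by linarith))
        (Set.mem_Ici.2 (by linarith)) (by linarith)
    have h4 : ‖Complex.sin (Real.pi / 2 * (s + (n : ℂ)))‖ ≤ Real.exp (Real.pi / 2 * (2 / ε)) := by
      refine (norm_sin_le_exp _).trans ?_
      rw [Real.exp_le_exp]
      have e : (Real.pi / 2 * (s + (n : ℂ)) : ℂ).im = Real.pi / 2 * s.im := by
        rw [show (Real.pi : ℂ) / 2 = ((Real.pi / 2 : ℝ) : ℂ) by push_cast; ring, im_ofReal_mul,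
          hz_im]
      rw [e, abs_mul, abs_of_pos (by positivity)]
      gcongr
    have h5 : (2 * Real.pi) ^ ((n : ℝ) - A - 1) ≤ (2 * Real.pi) ^ ((n : ℝ) - A) :=
      Real.rpow_le_rpow_of_exponent_le (by linarith) (by linarith)
    calc _ ≤ 2 * (2 * Real.pi) ^ ((n : ℝ) - A) * Nat.factorial (⌈A⌉₊ - n) *
          Real.exp (Real.pi / 2 * (2 / ε)) * 3 := by gcongr
      _ = C₂ * 1 * ((2 * Real.pi) ^ ((n : ℝ) - A) * Nat.factorial (⌈A⌉₊ - n)) := by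
          rw [hC₂]; ring
      _ ≤ _ := by
          gcongr
          have : 0 < C₁ * 2 ^ P * (2 * Real.pi) := by positivity
          linarith

namespace Admissible
variable {ε : ℝ} {s₁ s₂ : ℂ}

theorem ceil_conditions (h : Admissible ε s₁ s₂) (hε : 0 < ε) (hA : 1 ≤ -(s₁ + s₂).re) :
    0 ≤ -s₂.re ∧ (ε * -(s₁ + s₂).re ≤ ⌈-s₂.re⌉₊) ∧ ⌈-s₂.re⌉₊ ≤ ⌈-(s₁ + s₂).re⌉₊ ∧
      (⌈-s₂.re⌉₊ : ℝ) ≤ (1 - ε) * -(s₁ + s₂).re + 1 := by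
  have h1 := h.lo₁
  have h2 := h.lo₂
  have h3 : 0 ≤ ε * -(s₁ + s₂).re := by positivity
  have h4 : -(s₁ + s₂).re = -s₁.re + -s₂.re := by rw [add_re]; ring
  have h5 := Nat.ceil_lt_add_one (show 0 ≤ -s₂.re by linarith)
  refine ⟨by linarith, h2.trans (Nat.le_ceil _), Nat.ceil_mono (by linarith), ?_⟩
  nlinarith

end Admissible

/-- The powers of 2π from the Bernoulli number and from ζ combine to that of f(s), and the
factorials to (B + D)!(A₀ - B + D)! up to shifts, against (A₀ - 1)! in f(s). -/
theorem exists_tail_term_le {ε : ℝ} (h0 : 0 < ε) (h1 : ε < 1) (P : ℕ) :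
    ∃ C R : ℝ, 0 < C ∧ ∀ s₁ s₂ : ℂ, Admissible ε s₁ s₂ → R ≤ -(s₁ + s₂).re →
    ∀ k : ℕ, ⌈-s₂.re⌉₊ ≤ 2 * k + 1 → 2 * k + 1 ≤ ⌈-(s₁ + s₂).re⌉₊ + 4 →
    (-(s₁ + s₂).re) ^ P * ‖bernCoeff (2 * k + 2) * shiftPoch (2 * k + 2) s₂ *
      riemannZeta (s₁ + s₂ + (2 * k + 2 : ℕ) - 1)‖ ≤ C * ‖zetaFactor (s₁ + s₂)‖ := by
  have hpi := Real.pi_pos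
  set D := ⌈1 / ε⌉₊ + 1 with hD
  obtain ⟨c, hc, hf⟩ := exists_zetaFactor_ge ε
  obtain ⟨C₁, P₁, hC₁, hz⟩ := exists_zeta_add_odd_le ε
  obtain ⟨C₂, R₂, hC₂, hfac⟩ := exists_factorial_quotient_le h0 h1 (D + 4) (P + P₁)
  refine ⟨4 * C₁ * C₂ / c, max (max 2 (2 / ε)) R₂, by positivity,
    fun s₁ s₂ hs hA k hk1 hk2 => ?_⟩
  simp only [max_le_iff] at hA
  obtain ⟨⟨hA1, hA2⟩, hA3⟩ := hA
  have hf := hf s₁ s₂ hs hA1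
  have hz := hz s₁ s₂ hs (max_le (by linarith) hA2) k hk2
  obtain ⟨hb0, hb1, hb2, hb3⟩ := hs.ceil_conditions h0 (by linarith)
  have hpoch := norm_ascPochhammer_le (hs.norm_add_nat_le hb0) (2 * k + 1 - ⌈-s₂.re⌉₊)
  have hbern := norm_bernCoeff_le (k := 2 * k + 2) (by omega)
  have hceil := Nat.ceil_lt_add_one (show 0 ≤ -(s₁ + s₂).re by linarith)
  have hfac := hfac _ _ _ hA3 (Nat.le_ceil _) hceil hb1 hb2 hb3
  set B := ⌈-s₂.re⌉₊ with hB
  set A₀ := ⌈-(s₁ + s₂).re⌉₊ with hA₀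
  set s := s₁ + s₂ with hsdef
  set A := -s.re with hAdef
  have hre : s.re = -A := by rw [hAdef]; ring
  rw [show B + (2 * k + 1 - B) = 2 * k + 1 by omega, ← hD] at hpoch
  have e1 : s + ((2 * k + 2 : ℕ) : ℂ) - 1 = s + ((2 * k + 1 : ℕ) : ℂ) := by push_cast; ring
  rw [e1, norm_mul, norm_mul, shiftPoch]
  have hA0 : 0 < A := by linarith
  have hfacs : (Nat.factorial (B + D) : ℝ) * (Nat.factorial (2 * k + 1 - B + D) *
      Nat.factorial (A₀ - (2 * k + 1))) ≤
      Nat.factorial (B + (D + 4)) * Nat.factorial (A₀ - B + (D + 4)) := by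
    -- When 2k + 1 exceeds A₀ the truncated difference A₀ - (2k + 1) is 0; the overshoot is at most
    -- 4, hence D + 4.
    have h3 : Nat.factorial (2 * k + 1 - B + D) * Nat.factorial (A₀ - (2 * k + 1)) ≤
        Nat.factorial (A₀ - B + (D + 4)) :=
      (Nat.le_of_dvd (Nat.factorial_pos _) (Nat.factorial_mul_factorial_dvd_factorial_add _ _)).trans
        (Nat.factorial_le (by omega))
    have h4 : Nat.factorial (B + D) ≤ Nat.factorial (B + (D + 4)) := Nat.factorial_le (by omega)
    exact_mod_cast Nat.mul_le_mul h4 h3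
  have hpow : 4 / (2 * Real.pi) ^ (2 * k + 2) * (2 * Real.pi) ^ (((2 * k + 1 : ℕ) : ℝ) + s.re) ≤
      4 * (2 * Real.pi) ^ s.re := by
    rw [Real.rpow_add (by positivity), Real.rpow_natCast]
    have hp : (1 : ℝ) ≤ 2 * Real.pi := by linarith [Real.pi_gt_three]
    have : (2 * Real.pi) ^ (2 * k + 1) ≤ (2 * Real.pi) ^ (2 * k + 2) :=
      pow_le_pow_right₀ hp (by omega)
    rw [div_mul_eq_mul_div, div_le_iff₀ (by positivity)]
    have h5 : (0 : ℝ) < (2 * Real.pi) ^ s.re := by positivity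
    nlinarith
  calc _ ≤ A ^ P * (4 / (2 * Real.pi) ^ (2 * k + 2) *
        (Nat.factorial (B + D) * Nat.factorial (2 * k + 1 - B + D)) *
        (C₁ * A ^ P₁ * ((2 * Real.pi) ^ (((2 * k + 1 : ℕ) : ℝ) + s.re) *
          Nat.factorial (A₀ - (2 * k + 1))))) := by gcongr
    _ = C₁ * A ^ (P + P₁) * (4 / (2 * Real.pi) ^ (2 * k + 2) *
        (2 * Real.pi) ^ (((2 * k + 1 : ℕ) : ℝ) + s.re)) * (Nat.factorial (B + D) *
        (Nat.factorial (2 * k + 1 - B + D) * Nat.factorial (A₀ - (2 * k + 1)))) := by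
        rw [pow_add]; ring
    _ ≤ C₁ * A ^ (P + P₁) * (4 * (2 * Real.pi) ^ s.re) *
        (Nat.factorial (B + (D + 4)) * Nat.factorial (A₀ - B + (D + 4))) := by gcongr
    _ = 4 * C₁ * (2 * Real.pi) ^ s.re * (A ^ (P + P₁) *
        (Nat.factorial (B + (D + 4)) * Nat.factorial (A₀ - B + (D + 4)))) := by ring
    _ ≤ 4 * C₁ * (2 * Real.pi) ^ s.re * (C₂ * Nat.factorial (A₀ - 1)) := by gcongr
    _ = 4 * C₁ * C₂ / c * (c * ((2 * Real.pi) ^ s.re * Nat.factorial (A₀ - 1))) := by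
        field_simp
    _ ≤ _ := by gcongr

/-- The order at which the Euler-Maclaurin expansion is cut. -/
noncomputable def cutoff (s : ℂ) : ℕ := (⌈-s.re⌉₊ + 3) / 2

theorem exists_remainder_le {ε : ℝ} (h0 : 0 < ε) (h1 : ε < 1) (P : ℕ) :
    ∃ C R : ℝ, 0 < C ∧ ∀ s₁ s₂ : ℂ, Admissible ε s₁ s₂ → R ≤ -(s₁ + s₂).re →
    (s₁, s₂) ∈ emRegion (2 * cutoff (s₁ + s₂) + 1) ∧
    (-(s₁ + s₂).re) ^ P * ‖∑' x, pairTerm (2 * cutoff (s₁ + s₂) + 1 + 3) (s₁, s₂) x‖ ≤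
      C * ‖zetaFactor (s₁ + s₂)‖ := by
  have hpi := Real.pi_pos
  set D := ⌈1 / ε⌉₊ + 1 with hD
  obtain ⟨c, hc, hf⟩ := exists_zetaFactor_ge ε
  obtain ⟨C₂, R₂, hC₂, hfac⟩ := exists_factorial_quotient_le h0 h1 (D + 6) P
  set S : ℝ := ∑' x : ℕ × ℕ, ((x.1 : ℝ) + 1) ^ (-(1 + 1 : ℝ)) * ((x.2 : ℝ) + 1) ^ (-(1 + 1 : ℝ))
    with hS
  have hS0 : 0 ≤ S := tsum_nonneg fun x => by positivity
  refine ⟨4 * (S + 1) * C₂ / c, max (max 2 (2 / ε)) R₂, by positivity,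
    fun s₁ s₂ hs hA => ?_⟩
  simp only [max_le_iff] at hA
  obtain ⟨⟨hA1, hA2⟩, hA3⟩ := hA
  have hf := hf s₁ s₂ hs hA1
  obtain ⟨hb0, hb1, hb2, hb3⟩ := hs.ceil_conditions h0 (by linarith)
  have hceil := Nat.ceil_lt_add_one (show 0 ≤ -(s₁ + s₂).re by linarith)
  have hceil' := Nat.le_ceil (-(s₁ + s₂).re)
  have hfac := hfac _ _ _ hA3 hceil' hceil hb1 hb2 hb3
  have ha0 : 0 ≤ -s₁.re := le_trans (by positivity) hs.lo₁
  have hne : s₂ ≠ 1 := fun h => by rw [h] at hb0; simp at hb0; linarith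
  have hcut : cutoff (s₁ + s₂) = (⌈-(s₁ + s₂).re⌉₊ + 3) / 2 := rfl
  set q := 2 * cutoff (s₁ + s₂) + 1 with hq
  -- The lower bound on q makes the double series converge with η = 1; the upper bound gives q + 2 ≤
  -- A₀ + 6, the source of the shift D + 6.
  have hq1 : ⌈-(s₁ + s₂).re⌉₊ + 3 ≤ q := by omega
  have hq2 : q ≤ ⌈-(s₁ + s₂).re⌉₊ + 4 := by omega
  have hq1R : (⌈-(s₁ + s₂).re⌉₊ : ℝ) + 3 ≤ q := by exact_mod_cast hq1
  have hadd : -(s₁ + s₂).re = -s₁.re + -s₂.re := by rw [add_re]; ring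
  have hpoch := norm_ascPochhammer_le (hs.norm_add_nat_le hb0) (q + 2 - ⌈-s₂.re⌉₊)
  set B := ⌈-s₂.re⌉₊ with hB
  set A₀ := ⌈-(s₁ + s₂).re⌉₊ with hA₀
  set A := -(s₁ + s₂).re with hAdef
  rw [show B + (q + 2 - B) = q + 2 by omega, ← hD] at hpoch
  refine ⟨⟨hne, ?_, ?_⟩, ?_⟩
  · simp only; linarith
  · simp only; linarith
  have hbound := fun x => norm_pairTerm_le (q := q) (s := (s₁, s₂)) (η := 1) hne one_pos
    (by simp only; linarith) (by simp only; linarith) x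
  have hsum := tsum_of_norm_bounded ((summable_pair_rpow one_pos).mul_left _).hasSum hbound
  rw [tsum_mul_left, ← hS] at hsum
  have hfacs : (Nat.factorial (B + D) : ℝ) * Nat.factorial (q + 2 - B + D) ≤
      Nat.factorial (B + (D + 6)) * Nat.factorial (A₀ - B + (D + 6)) := by
    exact_mod_cast Nat.mul_le_mul (Nat.factorial_le (by omega)) (Nat.factorial_le (by omega))
  have hp : (1 : ℝ) ≤ 2 * Real.pi := by linarith [Real.pi_gt_three]
  have hpow : 4 / (2 * Real.pi) ^ (q + 2) ≤ 4 * (2 * Real.pi) ^ (s₁ + s₂).re := by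
    rw [div_eq_mul_inv, ← Real.rpow_natCast, ← Real.rpow_neg (by positivity)]
    gcongr
    push_cast
    linarith
  calc _ ≤ A ^ P * ((Nat.factorial (B + D) * Nat.factorial (q + 2 - B + D)) *
        (4 * (2 * Real.pi) ^ (s₁ + s₂).re) * (S + 1)) := by
        have hA0 : 0 ≤ A := by linarith
        refine mul_le_mul_of_nonneg_left (hsum.trans ?_) (by positivity)
        simp only
        gcongr
        linarith
    _ ≤ A ^ P * ((Nat.factorial (B + (D + 6)) * Nat.factorial (A₀ - B + (D + 6))) *
        (4 * (2 * Real.pi) ^ (s₁ + s₂).re) * (S + 1)) := by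
        have hA0 : 0 ≤ A := by linarith
        gcongr
    _ = 4 * (S + 1) * (2 * Real.pi) ^ (s₁ + s₂).re * (A ^ P *
        (Nat.factorial (B + (D + 6)) * Nat.factorial (A₀ - B + (D + 6)))) := by ring
    _ ≤ 4 * (S + 1) * (2 * Real.pi) ^ (s₁ + s₂).re * (C₂ * Nat.factorial (A₀ - 1)) := by gcongr
    _ = 4 * (S + 1) * C₂ / c * (c * ((2 * Real.pi) ^ (s₁ + s₂).re * Nat.factorial (A₀ - 1))) := by
        field_simp
    _ ≤ _ := by gcongr

/-! ### Euler–Maclaurin terms after the functional equation, compared with moments. -/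

theorem sum_range_two_mul_add_two {F : ℕ → ℂ} (h : ∀ k, F (2 * k + 3) = 0) (m : ℕ) :
    ∑ j ∈ Finset.range (2 * m + 2), F j = F 0 + F 1 + ∑ k ∈ Finset.range m, F (2 * k + 2) := by
  induction m with
  | zero => simp [Finset.sum_range_succ]
  | succ m ih =>
    rw [show 2 * (m + 1) + 2 = 2 * m + 2 + 1 + 1 by ring, Finset.sum_range_succ,
      Finset.sum_range_succ, ih, Finset.sum_range_succ, h m]
    ring

theorem emTerm_zero {s s₂ : ℂ} (hs : s.re < 0) :
    bernCoeff 0 * shiftPoch 0 s₂ * riemannZeta (s + (0 : ℕ) - 1) =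
      zetaFactor s * (Complex.cos (Real.pi / 2 * s) / (2 * Real.pi) *
        ((s - 1) / (s₂ - 1) * riemannZeta (2 - s))) := by
  have hpi : (Real.pi : ℂ) ≠ 0 := by exact_mod_cast Real.pi_ne_zero
  have h1 := riemannZeta_eq_zetaFactor_mul (z := s - 1) (by simp; linarith)
  have h2 := zetaFactor_add_one (z := s - 1) (fun h => by
    rw [sub_eq_zero] at h; rw [h] at hs; simp at hs; linarith)
  rw [sub_add_cancel] at h2
  rw [show (Real.pi : ℂ) / 2 * (s - 1) = Real.pi / 2 * s - Real.pi / 2 by ring,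
    Complex.sin_sub_pi_div_two, show 1 - (s - 1) = 2 - s by ring] at h1
  rw [bernCoeff_zero, shiftPoch, Nat.cast_zero, add_zero, h1]
  have h3 : zetaFactor (s - 1) = -(zetaFactor s * (s - 1)) / (2 * Real.pi) := by
    rw [h2]; field_simp
  rw [h3, div_eq_mul_inv (s - 1)]
  ring

theorem emTerm_one {s s₂ : ℂ} (hs : s.re < 0) :
    bernCoeff 1 * shiftPoch 1 s₂ * riemannZeta (s + (1 : ℕ) - 1) =
      zetaFactor s * (-(1 / 2) * Complex.sin (Real.pi / 2 * s) * riemannZeta (1 - s)) := by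
  rw [Nat.cast_one, add_sub_cancel_right, riemannZeta_eq_zetaFactor_mul hs, bernCoeff_one, shiftPoch]
  simp
  ring

theorem sin_pi_div_two_mul_add_odd (z : ℂ) (k : ℕ) :
    Complex.sin (Real.pi / 2 * (z + (2 * k + 1 : ℕ))) =
      (-1) ^ k * Complex.cos (Real.pi / 2 * z) := by
  rw [show (Real.pi : ℂ) / 2 * (z + (2 * k + 1 : ℕ)) =
    Real.pi / 2 * z + Real.pi / 2 + k * Real.pi by push_cast; ring,
    Complex.sin_antiperiodic.add_nat_mul_eq, Complex.sin_add_pi_div_two]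

/-- The powers of 2π cancel between the Bernoulli number and f(s + n) = (-2π)^n f(s)/(s)_n, and the
sign (-1)^k from the sine cancels the one in B_{2k+2}. -/
theorem emTerm_even {s r₂ : ℂ} (k : ℕ) (hs : s.re + (2 * k + 1 : ℕ) < 0) :
    bernCoeff (2 * k + 2) * shiftPoch (2 * k + 2) (s * r₂) *
        riemannZeta (s + (2 * k + 2 : ℕ) - 1) =
      zetaFactor s * (-(Complex.cos (Real.pi / 2 * s) / Real.pi) *
        (riemannZeta ((2 * k + 2 : ℕ) : ℂ) * rawMoment s r₂ (2 * k + 1) *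
          riemannZeta (1 - (s + (2 * k + 1 : ℕ))))) := by
  have hpi : (Real.pi : ℂ) ≠ 0 := by exact_mod_cast Real.pi_ne_zero
  have hne : ∀ i < 2 * k + 1, s + i ≠ 0 := fun i hi h => by
    have h1 := congrArg Complex.re h
    have h2 : (i : ℝ) ≤ (2 * k + 1 : ℕ) := by exact_mod_cast hi.le
    simp only [add_re, natCast_re, zero_re] at h1
    linarith
  have h0 := ascPochhammer_eval_ne_zero hne
  have h1 := zetaFactor_add_nat _ hne
  rw [show s + (2 * k + 2 : ℕ) - 1 = s + (2 * k + 1 : ℕ) by push_cast; ring,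
    riemannZeta_eq_zetaFactor_mul (by simpa using hs), sin_pi_div_two_mul_add_odd,
    bernCoeff_even, shiftPoch, rawMoment]
  rw [← eq_div_iff h0] at h1
  rw [h1, show 2 * k + 2 = (2 * k + 1) + 1 by ring, Odd.neg_pow ⟨k, rfl⟩,
    pow_succ (2 * (Real.pi : ℂ))]
  have h2 : ((-1 : ℂ) ^ k) * (-1) ^ k = 1 := by rw [← mul_pow]; simp
  field_simp
  linear_combination (-(riemannZeta ((2 * k + 1 + 1 : ℕ) : ℂ) *
    (ascPochhammer ℂ (2 * k + 1)).eval (s * r₂) * zetaFactor s *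
    Complex.cos (Real.pi * s / 2) * riemannZeta (1 - (s + (2 * k + 1 : ℕ))))) * h2

/-- Finitely many series from `hasSum_cot_iteratedDeriv` are combined with weights ν_j, and j!
c_j/(s)_j = ν_j brings in the c_j. -/
theorem hasSum_zeta_mul_truncMoment {s₁ s₂ : ℂ} (N : ℕ) (h0 : s₁ + s₂ ≠ 0)
    (h : ∀ i < 2 * N, s₁ + s₂ + i ≠ 0) (hr0 : ratio₂ s₁ s₂ ≠ 0) (hr1 : ‖ratio₂ s₁ s₂‖ < 1) :
    HasSum (fun k : ℕ => riemannZeta ((2 * k + 2 : ℕ) : ℂ) *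
        truncMoment (2 * N) (s₁ + s₂) (ratio₁ s₁ s₂) (ratio₂ s₁ s₂) (2 * k + 1))
      ((truncMomentNegOne (2 * N) (s₁ + s₂) (ratio₁ s₁ s₂) (ratio₂ s₁ s₂) -
        Real.pi * ∑ j ∈ Finset.range (2 * N + 1),
          (Real.pi : ℂ) ^ j * iteratedDeriv j Complex.cot (Real.pi * ratio₂ s₁ s₂) /
            (ascPochhammer ℂ j).eval (s₁ + s₂) * cCoeff s₁ s₂ j) / 2) := by
  have key := hasSum_sum (s := Finset.range (2 * N + 1)) fun j _ =>
    (hasSum_cot_iteratedDeriv j hr0 hr1).mul_right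
      (centralMoment (s₁ + s₂) (ratio₁ s₁ s₂) (ratio₂ s₁ s₂) j)
  refine hasSum_of_eq key (fun k => ?_) ?_
  · rw [truncMoment, Finset.mul_sum]
    exact Finset.sum_congr rfl fun j _ => by ring
  · rw [truncMomentNegOne, Finset.mul_sum, ← Finset.sum_sub_distrib, Finset.sum_div]
    refine Finset.sum_congr rfl fun j hj => ?_
    rw [← factorial_mul_cCoeff h0 j fun i hi => h i (by have := Finset.mem_range.1 hj; omega)]
    have hf : (Nat.factorial j : ℂ) ≠ 0 := by exact_mod_cast Nat.factorial_ne_zero j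
    field_simp

namespace Admissible
variable {ε : ℝ} {s₁ s₂ : ℂ}

theorem large (hε : 0 < ε) (hε1 : ε < 1) {A : ℝ} (hA : 2 / ε ^ 2 ≤ A) :
    1 / ε ≤ ε / 2 * A ∧ 2 / ε ≤ A ∧ 1 ≤ ε * A ∧ 1 ≤ A := by
  rw [div_le_iff₀ (by positivity)] at hA
  have h1 : 1 / ε ≤ ε / 2 * A := by rw [div_le_iff₀ hε]; nlinarith
  have hA0 : 0 < A := by
    by_contra! h
    nlinarith [sq_nonneg ε]
  have h3 : 2 ≤ ε * A := by nlinarith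
  refine ⟨h1, by rw [div_le_iff₀ hε]; linarith, by linarith, by nlinarith⟩

theorem norm_left_le (h : Admissible ε s₁ s₂) : ‖s₁‖ ≤ |s₁.re| + 1 / ε :=
  (Complex.norm_le_abs_re_add_abs_im s₁).trans (by linarith [h.im₁])

/-- For A ≥ 2/ε² the imaginary parts cost at most 1/ε ≤ (ε/2)A, so ε weakens to ε/2. For i < ⌈-Re
s₂⌉ both s₂ + i and s + i still have negative real part and differ by s₁, of size at least εA; this
gives the contraction factor 1 - ε/2. -/
theorem ratio_bounds (h : Admissible ε s₁ s₂) (hε : 0 < ε) (hε1 : ε < 1)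
    (hA : 2 / ε ^ 2 ≤ -(s₁ + s₂).re) :
    ‖ratio₁ s₁ s₂‖ ≤ 1 ∧ ‖ratio₂ s₁ s₂‖ ≤ 1 - ε / 2 ∧ ε / 2 ≤ ‖ratio₂ s₁ s₂‖ ∧
    ε / 2 * ‖s₁ + s₂‖ ≤ ‖s₂ - 1‖ ∧ ∀ i < ⌈-s₂.re⌉₊, ‖s₂ + i‖ ≤ (1 - ε / 2) * ‖s₁ + s₂ + i‖ ∧
      ε / 2 * ‖s₁ + s₂‖ ≤ ‖s₁ + s₂ + i‖ ∧ ε * -(s₁ + s₂).re ≤ -(s₁ + s₂).re - i := by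
  obtain ⟨h1, h2, h3, h4⟩ := large hε hε1 hA
  have hs2 := h.norm_le h2
  have hs1 := neg_re_le_norm (s₁ := s₁) (s₂ := s₂)
  have hadd : -(s₁ + s₂).re = -s₁.re + -s₂.re := by rw [add_re]; ring
  have l1 := h.lo₁
  have l2 := h.lo₂
  set A := -(s₁ + s₂).re with hAdef
  have hs0 : 0 < ‖s₁ + s₂‖ := by linarith
  have e2 : ε / 2 * ‖s₁ + s₂‖ ≤ ε * A := by nlinarith
  refine ⟨?_, ?_, ?_, ?_, fun i hi => ?_⟩
  · rw [ratio₁, norm_div, div_le_one hs0]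
    have := h.norm_left_le
    rw [abs_of_nonpos (by linarith)] at this
    nlinarith
  · rw [ratio₂, norm_div, div_le_iff₀ hs0]
    have := Complex.norm_le_abs_re_add_abs_im s₂
    rw [abs_of_nonpos (by linarith)] at this
    have := h.im₂
    nlinarith
  · rw [ratio₂, norm_div, le_div_iff₀ hs0]
    have := (neg_le_abs s₂.re).trans (Complex.abs_re_le_norm s₂)
    linarith
  · have := (neg_le_abs (s₂ - 1).re).trans (Complex.abs_re_le_norm (s₂ - 1))
    rw [sub_re, one_re] at this
    linarith
  · have hi' := Nat.lt_ceil.1 hi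
    have n1 := (neg_le_abs (s₁ + s₂ + i).re).trans (Complex.abs_re_le_norm (s₁ + s₂ + i))
    rw [add_re, natCast_re] at n1
    have n2 := Complex.norm_le_abs_re_add_abs_im (s₂ + i)
    rw [add_re, add_im, natCast_re, natCast_im, add_zero, abs_of_nonpos (by linarith)] at n2
    have n3 := h.im₂
    have hi0 : (0 : ℝ) ≤ i := i.cast_nonneg
    refine ⟨?_, by linarith, by linarith⟩
    have : (1 - ε / 2) * (A - i) ≤ (1 - ε / 2) * ‖s₁ + s₂ + i‖ :=
      mul_le_mul_of_nonneg_left (by linarith) (by linarith)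
    nlinarith

end Admissible

theorem norm_rawMoment_le {q : ℝ} (hq : 0 ≤ q) {s r₂ : ℂ} {B : ℕ}
    (h : ∀ i < B, ‖s * r₂ + i‖ ≤ q * ‖s + i‖ ∧ s + i ≠ 0) (n : ℕ) (hn : n ≤ B) :
    ‖rawMoment s r₂ n‖ ≤ q ^ n := by
  induction n with
  | zero => simp [rawMoment]
  | succ n ih =>
    have ih := ih (by omega)
    obtain ⟨h1, h2⟩ := h n (by omega)
    have h3 := norm_pos_iff.2 h2
    have e := congrArg norm (rawMoment_succ r₂ n h2)
    rw [norm_mul, norm_mul] at e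
    refine le_of_mul_le_mul_left ?_ h3
    calc _ ≤ q * ‖s + n‖ * q ^ n := by rw [e]; gcongr
      _ = _ := by ring

/-- As n is at least a multiple of x, inserting (2n/(εx))^(N+1) ≥ 1 trades powers of n for the decay
in x. -/
theorem norm_mul_truncation_le {z T : ℂ} {K q ε x : ℝ} {n N : ℕ} (hz : ‖z‖ ≤ 2)
    (hT : ‖T‖ ≤ K * ((n + 1) ^ (2 * N) * q ^ n)) (hK : 0 ≤ K) (hq : 0 ≤ q) (hε : 0 < ε) (hx : 0 < x)
    (hn : 1 ≤ (n : ℝ)) (h : ε * x ≤ 2 * n) :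
    ‖z * T‖ ≤ 2 * (K * (2 ^ (2 * N) * (2 / ε) ^ (N + 1))) / x ^ (N + 1) *
      (n ^ (3 * N + 2) * q ^ n) := by
  have p1 : 1 ≤ (2 / ε) ^ (N + 1) * (n : ℝ) ^ (N + 1) / x ^ (N + 1) := by
    rw [le_div_iff₀ (by positivity), one_mul, ← mul_pow]
    refine pow_le_pow_left₀ hx.le ?_ _
    rw [div_mul_eq_mul_div, le_div_iff₀ hε]
    linarith
  have p2 : ((n : ℝ) + 1) ^ (2 * N) ≤ (2 * n) ^ (2 * N) :=
    pow_le_pow_left₀ (by linarith) (by linarith) _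
  have p3 : (n : ℝ) ^ (3 * N + 1) ≤ (n : ℝ) ^ (3 * N + 2) := pow_le_pow_right₀ hn (by omega)
  have p4 : 0 ≤ q ^ n := by positivity
  rw [norm_mul]
  calc _ ≤ 2 * (K * ((2 * n : ℝ) ^ (2 * N) * q ^ n)) :=
        mul_le_mul hz (hT.trans (mul_le_mul_of_nonneg_left
          (mul_le_mul_of_nonneg_right p2 p4) hK)) (norm_nonneg _) zero_le_two
    _ ≤ 2 * (K * ((2 * n : ℝ) ^ (2 * N) * q ^ n)) *
        ((2 / ε) ^ (N + 1) * (n : ℝ) ^ (N + 1) / x ^ (N + 1)) :=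
        le_mul_of_one_le_right (by positivity) p1
    _ = 2 * (K * (2 ^ (2 * N) * (2 / ε) ^ (N + 1))) / x ^ (N + 1) *
        (n ^ (3 * N + 1) * q ^ n) := by rw [mul_pow]; ring
    _ ≤ _ := mul_le_mul_of_nonneg_left (mul_le_mul_of_nonneg_right p3 p4) (by positivity)

theorem norm_mul_sub_mul_mul_le {z T μ w : ℂ} {K q E M : ℝ} {n N : ℕ} (hz : ‖z‖ ≤ 2)
    (hT : ‖μ - T‖ ≤ K / M * (n ^ (2 * N + 2) * q ^ n)) (hμ : ‖μ‖ ≤ q ^ n) (hw : ‖w - 1‖ ≤ E / M)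
    (hK : 0 ≤ K) (hq : 0 ≤ q) (hE : 0 ≤ E) (hM : 0 < M) (hn : 1 ≤ (n : ℝ)) :
    ‖z * T - z * μ * w‖ ≤ 2 * (K + E) / M * (n ^ (3 * N + 2) * q ^ n) := by
  have p1 : (n : ℝ) ^ (2 * N + 2) ≤ (n : ℝ) ^ (3 * N + 2) := pow_le_pow_right₀ hn (by omega)
  have p2 : (1 : ℝ) ≤ (n : ℝ) ^ (3 * N + 2) := one_le_pow₀ hn
  have p3 : 0 ≤ q ^ n := by positivity
  rw [show z * T - z * μ * w = -(z * ((μ - T) + μ * (w - 1))) by ring, norm_neg, norm_mul]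
  have h1 : ‖(μ - T) + μ * (w - 1)‖ ≤ K / M * (n ^ (2 * N + 2) * q ^ n) + q ^ n * (E / M) := by
    refine (norm_add_le _ _).trans (add_le_add hT ?_)
    rw [norm_mul]
    exact mul_le_mul hμ hw (norm_nonneg _) p3
  calc _ ≤ 2 * (K / M * (n ^ (2 * N + 2) * q ^ n) + q ^ n * (E / M)) :=
        mul_le_mul hz h1 (norm_nonneg _) zero_le_two
    _ ≤ 2 * (K / M * (n ^ (3 * N + 2) * q ^ n) + (n ^ (3 * N + 2) * q ^ n) * (E / M)) := by
        gcongr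
        exact le_mul_of_one_le_left p3 p2
    _ = _ := by ring

/-- For n = 2k + 1 < ⌈-Re s₂⌉ the error comes from truncating the moment and from replacing ζ(1 - s
- n) by 1, where Re(1 - s - n) ≥ 1 + εA. For larger n the truncated moment is itself the error and
is small because n ≥ εA. Both bounds are summable over k. -/
theorem exists_moment_series_term_le (N : ℕ) {ε : ℝ} (hε : 0 < ε) (hε1 : ε < 1) :
    ∃ C R : ℝ, 0 < C ∧ ∀ s₁ s₂ : ℂ, Admissible ε s₁ s₂ → R ≤ -(s₁ + s₂).re →
    ‖riemannZeta (1 - (s₁ + s₂)) - 1‖ ≤ C / ‖s₁ + s₂‖ ^ (N + 1) ∧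
    ‖(s₁ + s₂ - 1) / (s₂ - 1) * riemannZeta (2 - (s₁ + s₂)) -
      truncMomentNegOne (2 * N) (s₁ + s₂) (ratio₁ s₁ s₂) (ratio₂ s₁ s₂)‖ ≤
        C / ‖s₁ + s₂‖ ^ (N + 1) ∧
    ∀ k : ℕ, ‖riemannZeta ((2 * k + 2 : ℕ) : ℂ) *
        truncMoment (2 * N) (s₁ + s₂) (ratio₁ s₁ s₂) (ratio₂ s₁ s₂) (2 * k + 1) -
      if 2 * k + 1 < ⌈-s₂.re⌉₊ then riemannZeta ((2 * k + 2 : ℕ) : ℂ) *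
        rawMoment (s₁ + s₂) (ratio₂ s₁ s₂) (2 * k + 1) *
          riemannZeta (1 - (s₁ + s₂ + (2 * k + 1 : ℕ))) else 0‖ ≤
      C / ‖s₁ + s₂‖ ^ (N + 1) *
        (((2 * k + 1 : ℕ) : ℝ) ^ (3 * N + 2) * (1 - ε / 2) ^ (2 * k + 1)) := by
  set q := 1 - ε / 2 with hq
  have hq0 : 0 < q := by rw [hq]; linarith
  have hq1 : q < 1 := by rw [hq]; linarith
  obtain ⟨K, R₁, hK, hR₁, hmom⟩ := moment_error N hq0 hq1 (half_pos hε)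
  have hθ : (2 : ℝ) ^ (-ε) < 1 := Real.rpow_lt_one_of_one_lt_of_neg one_lt_two (by linarith)
  obtain ⟨C₁, hC₁, hpow⟩ := exists_pow_mul_rpow_le (by positivity) hθ (N + 1)
  set E := 8 * (2 ^ (N + 1) * C₁) with hE
  have hE0 : 0 < E := by positivity
  set C₂ := 2 * (K * (2 ^ (2 * N) * (2 / ε) ^ (N + 1))) with hC₂
  have hC₂0 : 0 < C₂ := by positivity
  refine ⟨E + (K + 2 / (ε / 2) * E) + (2 * (K + E) + C₂), max R₁ (2 / ε ^ 2), by positivity,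
    fun s₁ s₂ hs hR => ?_⟩
  obtain ⟨hR1, hR2⟩ := max_le_iff.1 hR
  obtain ⟨g1, g2, g3, g4⟩ := Admissible.large hε hε1 hR2
  obtain ⟨b1, b2, b3, b4, b5⟩ := hs.ratio_bounds hε hε1 hR2
  obtain ⟨c1, c2, c3, c4⟩ := hs.ceil_conditions hε g4
  have hs2 := hs.norm_le g2
  have hs1 := Admissible.neg_re_le_norm (s₁ := s₁) (s₂ := s₂)
  have hne : s₁ + s₂ ≠ 0 := norm_pos_iff.1 (by linarith)
  have hm := hmom (s₁ + s₂) _ _ (ratio_add hne) b1 b2 b3 (hR1.trans hs1)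
  rw [mul_ratio₂ hne] at hm
  obtain ⟨m1, m2, m3⟩ := hm
  have m1 := m1 b4
  have m3 := m3 ⌈-s₂.re⌉₊ fun i hi => ⟨(b5 i hi).1, (b5 i hi).2.1⟩
  have hraw := norm_rawMoment_le hq0.le (s := s₁ + s₂) (r₂ := ratio₂ s₁ s₂) (B := ⌈-s₂.re⌉₊)
    fun i hi => by
      rw [mul_ratio₂ hne]
      refine ⟨(b5 i hi).1, norm_pos_iff.1 ((b5 i hi).2.1.trans_lt' ?_)⟩
      have : 0 < ‖s₁ + s₂‖ := norm_pos_iff.2 hne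
      positivity
  set A := -(s₁ + s₂).re with hA
  have hs0 : 0 < ‖s₁ + s₂‖ := norm_pos_iff.2 hne
  have hzeta : ∀ u : ℂ, 1 + ε * A ≤ u.re → ‖riemannZeta u - 1‖ ≤ E / ‖s₁ + s₂‖ ^ (N + 1) := by
    intro u hu
    have h1 := hpow A (by linarith)
    rw [← Real.rpow_mul zero_le_two] at h1
    have h2 : (2 : ℝ) ^ (-u.re) ≤ 2 ^ (-ε * A) :=
      Real.rpow_le_rpow_of_exponent_le one_le_two (by linarith)
    refine (norm_zeta_sub_one_le (by linarith)).trans ?_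
    rw [hE, mul_div_assoc]
    refine mul_le_mul_of_nonneg_left (h2.trans ?_) (by norm_num)
    rw [le_div_iff₀ (by positivity)]
    calc _ ≤ (2 : ℝ) ^ (-ε * A) * (2 * A) ^ (N + 1) := by gcongr
      _ = 2 ^ (N + 1) * (A ^ (N + 1) * (2 : ℝ) ^ (-ε * A)) := by rw [mul_pow]; ring
      _ ≤ _ := by gcongr
  set M := ‖s₁ + s₂‖ ^ (N + 1) with hM
  have hM0 : 0 < M := by positivity
  have hD0 : 0 < 2 / (ε / 2) * E := by positivity
  refine ⟨?_, ?_, fun k => ?_⟩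
  · refine (hzeta _ ?_).trans ?_
    · rw [sub_re, one_re]; nlinarith
    · gcongr; linarith
  · have h2 : ‖(s₁ + s₂ - 1) / (s₂ - 1)‖ ≤ 2 / (ε / 2) := by
      rw [norm_div, div_le_div_iff₀ (lt_of_lt_of_le (by positivity) b4) (by positivity)]
      have h3 : ‖s₁ + s₂ - 1‖ ≤ 2 * ‖s₁ + s₂‖ := by
        refine (norm_sub_le _ _).trans ?_
        rw [norm_one]; linarith
      nlinarith
    have h4 := hzeta (2 - (s₁ + s₂)) (by rw [sub_re, re_ofNat]; nlinarith)
    rw [show (s₁ + s₂ - 1) / (s₂ - 1) * riemannZeta (2 - (s₁ + s₂)) -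
      truncMomentNegOne (2 * N) (s₁ + s₂) (ratio₁ s₁ s₂) (ratio₂ s₁ s₂) =
      ((s₁ + s₂ - 1) / (s₂ - 1) -
        truncMomentNegOne (2 * N) (s₁ + s₂) (ratio₁ s₁ s₂) (ratio₂ s₁ s₂)) +
      (s₁ + s₂ - 1) / (s₂ - 1) * (riemannZeta (2 - (s₁ + s₂)) - 1) by ring]
    calc _ ≤ K / M + 2 / (ε / 2) * (E / M) := by
          refine (norm_add_le _ _).trans ?_
          rw [norm_mul]
          gcongr
      _ = (K + 2 / (ε / 2) * E) / M := by ring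
      _ ≤ _ := (div_le_div_iff_of_pos_right hM0).2 (by linarith)
  · have hz := norm_zeta_nat_le_two (m := 2 * k + 2) (by omega)
    have hn1 : (1 : ℝ) ≤ ((2 * k + 1 : ℕ) : ℝ) := by exact_mod_cast (by omega : 1 ≤ 2 * k + 1)
    have m2 := m2 (2 * k + 1)
    have m3 := m3 (2 * k + 1)
    have hraw := hraw (2 * k + 1)
    have b5 := b5 (2 * k + 1)
    set n := 2 * k + 1 with hn
    split_ifs with hB
    · have h4 := hzeta (1 - (s₁ + s₂ + (n : ℕ))) (by
        have := (b5 hB).2.2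
        rw [sub_re, add_re _ (n : ℂ), natCast_re, one_re]
        linarith)
      have h5 := m3 hB.le
      have h6 := hraw hB.le
      refine (norm_mul_sub_mul_mul_le hz h5 h6 h4 hK.le hq0.le hE0.le hM0 hn1).trans
        (mul_le_mul_of_nonneg_right ((div_le_div_iff_of_pos_right hM0).2 ?_) (by positivity))
      linarith
    · rw [sub_zero]
      have hBn : ε * A ≤ n := c2.trans (by exact_mod_cast not_lt.1 hB)
      refine (norm_mul_truncation_le hz m2 hK.le hq0.le hε hs0 hn1 (by nlinarith)).trans
        (mul_le_mul_of_nonneg_right ((div_le_div_iff_of_pos_right hM0).2 ?_) (by positivity))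
      linarith

theorem norm_div_le_of_pow_mul_le {A x C : ℝ} {z f : ℂ} {P : ℕ} (hx : 0 < x)
    (hxA : x ≤ 2 * A) (hf : f ≠ 0) (h : A ^ P * ‖z‖ ≤ C * ‖f‖) : ‖z / f‖ ≤ 2 ^ P * C / x ^ P := by
  have hf' : 0 < ‖f‖ := norm_pos_iff.2 hf
  rw [norm_div, div_le_div_iff₀ hf' (by positivity)]
  calc ‖z‖ * x ^ P ≤ ‖z‖ * (2 * A) ^ P := by gcongr
    _ = 2 ^ P * (A ^ P * ‖z‖) := by rw [mul_pow]; ring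
    _ ≤ 2 ^ P * (C * ‖f‖) := by gcongr
    _ = _ := by ring

theorem exists_tail_sum_le {ε : ℝ} (h0 : 0 < ε) (h1 : ε < 1) (P : ℕ) :
    ∃ C R : ℝ, 0 < C ∧ ∀ s₁ s₂ : ℂ, Admissible ε s₁ s₂ → R ≤ -(s₁ + s₂).re →
    (-(s₁ + s₂).re) ^ P * ‖∑ k ∈ Finset.range (cutoff (s₁ + s₂) + 1),
      if 2 * k + 1 < ⌈-s₂.re⌉₊ then 0 else bernCoeff (2 * k + 2) * shiftPoch (2 * k + 2) s₂ *
        riemannZeta (s₁ + s₂ + (2 * k + 2 : ℕ) - 1)‖ ≤ C * ‖zetaFactor (s₁ + s₂)‖ := by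
  -- The extra power of A pays for the number of terms, at most 4A.
  obtain ⟨C, R, hC, h⟩ := exists_tail_term_le h0 h1 (P + 1)
  refine ⟨4 * C, max R 1, by positivity, fun s₁ s₂ hs hR => ?_⟩
  obtain ⟨hR, hA1⟩ := max_le_iff.1 hR
  have h := h s₁ s₂ hs hR
  have hceil := Nat.ceil_lt_add_one (show 0 ≤ -(s₁ + s₂).re by linarith)
  have hcut : cutoff (s₁ + s₂) = (⌈-(s₁ + s₂).re⌉₊ + 3) / 2 := rfl
  set κ := cutoff (s₁ + s₂)
  set A := -(s₁ + s₂).re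
  have hA0 : 0 < A := by linarith
  have hκ : ((κ + 1 : ℕ) : ℝ) ≤ 4 * A := by
    have h2 : 2 * (κ + 1) ≤ ⌈A⌉₊ + 5 := by omega
    have h3 : 2 * ((κ + 1 : ℕ) : ℝ) ≤ ⌈A⌉₊ + 5 := by exact_mod_cast h2
    linarith
  have hterm : ∀ k ∈ Finset.range (κ + 1), ‖if 2 * k + 1 < ⌈-s₂.re⌉₊ then (0 : ℂ) else
      bernCoeff (2 * k + 2) * shiftPoch (2 * k + 2) s₂ *
        riemannZeta (s₁ + s₂ + (2 * k + 2 : ℕ) - 1)‖ ≤ C * ‖zetaFactor (s₁ + s₂)‖ / A ^ (P + 1) := by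
    intro k hk
    have hk' := Finset.mem_range.1 hk
    split_ifs with hB
    · rw [norm_zero]; positivity
    · rw [le_div_iff₀' (by positivity)]
      exact h k (not_lt.1 hB) (by omega)
  have hsum := (norm_sum_le _ _).trans (Finset.sum_le_card_nsmul _ _ _ hterm)
  rw [Finset.card_range, nsmul_eq_mul] at hsum
  calc _ ≤ A ^ P * (4 * A * (C * ‖zetaFactor (s₁ + s₂)‖ / A ^ (P + 1))) :=
        mul_le_mul_of_nonneg_left (hsum.trans (by gcongr)) (by positivity)
    _ = _ := by rw [pow_succ]; field_simp

/-- The split at ⌈-Re s₂⌉ keeps Re(s + n) < 0 in the first group, as Re s₁ ≤ 0, so the functional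
equation applies there; the second group is left as it is, to be estimated. -/
theorem doubleZeta_eq_sum {s₁ s₂ : ℂ} (hd : (s₁, s₂) ∈ doubleZetaDomain) (h0 : s₁ + s₂ ≠ 0)
    (hre : s₁.re ≤ 0) (hs : (s₁ + s₂).re < 0) {κ : ℕ} (hκ : (s₁, s₂) ∈ emRegion (2 * κ + 1)) :
    doubleZeta (s₁, s₂) = zetaFactor (s₁ + s₂) *
      (-(1 / 2) * Complex.sin (Real.pi / 2 * (s₁ + s₂)) * riemannZeta (1 - (s₁ + s₂)) +
        Complex.cos (Real.pi / 2 * (s₁ + s₂)) / (2 * Real.pi) *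
          ((s₁ + s₂ - 1) / (s₂ - 1) * riemannZeta (2 - (s₁ + s₂))) -
        Complex.cos (Real.pi / 2 * (s₁ + s₂)) / Real.pi * ∑ k ∈ Finset.range (κ + 1),
          if 2 * k + 1 < ⌈-s₂.re⌉₊ then riemannZeta ((2 * k + 2 : ℕ) : ℂ) *
            rawMoment (s₁ + s₂) (ratio₂ s₁ s₂) (2 * k + 1) *
              riemannZeta (1 - (s₁ + s₂ + (2 * k + 1 : ℕ))) else 0) +
      (∑ k ∈ Finset.range (κ + 1),
        if 2 * k + 1 < ⌈-s₂.re⌉₊ then 0 else bernCoeff (2 * k + 2) * shiftPoch (2 * k + 2) s₂ *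
          riemannZeta (s₁ + s₂ + (2 * k + 2 : ℕ) - 1)) +
      ∑' x, pairTerm (2 * κ + 1 + 3) (s₁, s₂) x := by
  have hsum : ∑ k ∈ Finset.range (κ + 1), bernCoeff (2 * k + 2) * shiftPoch (2 * k + 2) s₂ *
        riemannZeta (s₁ + s₂ + (2 * k + 2 : ℕ) - 1) =
      zetaFactor (s₁ + s₂) * (-(Complex.cos (Real.pi / 2 * (s₁ + s₂)) / Real.pi) *
        ∑ k ∈ Finset.range (κ + 1),
          if 2 * k + 1 < ⌈-s₂.re⌉₊ then riemannZeta ((2 * k + 2 : ℕ) : ℂ) *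
            rawMoment (s₁ + s₂) (ratio₂ s₁ s₂) (2 * k + 1) *
              riemannZeta (1 - (s₁ + s₂ + (2 * k + 1 : ℕ))) else 0) +
      ∑ k ∈ Finset.range (κ + 1),
        if 2 * k + 1 < ⌈-s₂.re⌉₊ then 0 else bernCoeff (2 * k + 2) * shiftPoch (2 * k + 2) s₂ *
          riemannZeta (s₁ + s₂ + (2 * k + 2 : ℕ) - 1) := by
    rw [Finset.mul_sum, Finset.mul_sum, ← Finset.sum_add_distrib]
    refine Finset.sum_congr rfl fun k _ => ?_
    split_ifs with hB
    · have h1 := Nat.lt_ceil.1 hB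
      have h2 := emTerm_even (s := s₁ + s₂) (r₂ := ratio₂ s₁ s₂) k (by rw [add_re]; linarith)
      rw [mul_ratio₂ h0] at h2
      rw [h2, add_zero]
    · ring
  have hodd : ∀ k : ℕ, bernCoeff (2 * k + 3) * shiftPoch (2 * k + 3) s₂ *
      riemannZeta (s₁ + s₂ + (2 * k + 3 : ℕ) - 1) = 0 := fun k => by
    rw [bernCoeff_odd, zero_mul, zero_mul]
  rw [doubleZeta_eq_emZeta hd hκ, emZeta, show 2 * κ + 1 + 3 = 2 * (κ + 1) + 2 by ring]
  simp only
  rw [sum_range_two_mul_add_two (F := fun j => bernCoeff j * shiftPoch j s₂ *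
    riemannZeta (s₁ + s₂ + j - 1)) hodd, hsum, emTerm_zero hs, emTerm_one hs]
  ring

/-! ### Assembly of the asymptotic formula. -/

theorem exists_doubleZeta_asymptotic {ε : ℝ} (hε : 0 < ε) (hε1 : ε < 1) (N : ℕ) :
    ∃ C R : ℝ, 0 < C ∧ ∀ s₁ s₂ : ℂ, (s₁, s₂) ∈ doubleZetaDomain → Admissible ε s₁ s₂ →
      R ≤ -(s₁ + s₂).re →
      ‖doubleZeta (s₁, s₂) / zetaFactor (s₁ + s₂) -
          (-(1 / 2) * Complex.sin (Real.pi / 2 * (s₁ + s₂)) +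
            1 / 2 * Complex.cos (Real.pi / 2 * (s₁ + s₂)) *
              ∑ j ∈ Finset.range (2 * N + 1),
                (Real.pi : ℂ) ^ j * iteratedDeriv j Complex.cot (Real.pi * ratio₂ s₁ s₂) /
                  (ascPochhammer ℂ j).eval (s₁ + s₂) * cCoeff s₁ s₂ j)‖
        ≤ C / ‖s₁ + s₂‖ ^ (N + 1) := by
  have hpi := Real.pi_gt_three
  have hpi0 : (Real.pi : ℂ) ≠ 0 := by exact_mod_cast Real.pi_ne_zero
  obtain ⟨C₀, R₀, hC₀, hser⟩ := exists_moment_series_term_le N hε hε1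
  obtain ⟨C₁, R₁, hC₁, htail⟩ := exists_tail_sum_le hε hε1 (N + 1)
  obtain ⟨C₂, R₂, hC₂, hrem⟩ := exists_remainder_le hε hε1 (N + 1)
  have hU := (summable_pow_mul_geometric_odd (3 * N + 2) (ρ := 1 - ε / 2) (by linarith)
    (by linarith)).hasSum
  set U := ∑' k : ℕ, ((2 * k + 1 : ℕ) : ℝ) ^ (3 * N + 2) * (1 - ε / 2) ^ (2 * k + 1) with hUdef
  have hU0 : 0 ≤ U := tsum_nonneg fun k => by
    have : 0 < 1 - ε / 2 := by linarith
    positivity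
  set E := Real.exp (Real.pi / ε) with hE
  have hE0 : 0 < E := Real.exp_pos _
  refine ⟨E * (C₀ * (2 + U)) + 2 ^ (N + 1) * (C₁ + C₂),
    max (max R₀ R₁) (max R₂ (max (2 / ε ^ 2) (2 * N))), by positivity, fun s₁ s₂ hd hs hR => ?_⟩
  simp only [max_le_iff] at hR
  obtain ⟨⟨hR0, hR1⟩, hR2, hR3, hR4⟩ := hR
  obtain ⟨-, g2, -, g4⟩ := Admissible.large hε hε1 hR3
  obtain ⟨-, b2, b3, -, -⟩ := hs.ratio_bounds hε hε1 hR3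
  obtain ⟨z1, z2, z3⟩ := hser s₁ s₂ hs hR0
  have t1 := htail s₁ s₂ hs hR1
  obtain ⟨hreg, t2⟩ := hrem s₁ s₂ hs hR2
  obtain ⟨-, -, hBA, -⟩ := hs.ceil_conditions hε g4
  have hs2 := hs.norm_le g2
  have hs1 := Admissible.neg_re_le_norm (s₁ := s₁) (s₂ := s₂)
  have hs0 : 0 < ‖s₁ + s₂‖ := by linarith
  have hne : s₁ + s₂ ≠ 0 := norm_pos_iff.1 hs0
  have hf := zetaFactor_ne_zero (z := s₁ + s₂) (by linarith)
  have hl : 0 ≤ ε * -(s₁ + s₂).re := mul_nonneg hε.le (by linarith)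
  have hcut : cutoff (s₁ + s₂) = (⌈-(s₁ + s₂).re⌉₊ + 3) / 2 := rfl
  have key := doubleZeta_eq_sum hd hne (by linarith [hs.lo₁]) (by linarith) hreg
  have t1 := norm_div_le_of_pow_mul_le hs0 hs2 hf t1
  have t2 := norm_div_le_of_pow_mul_le hs0 hs2 hf t2
  have hasum := hasSum_zeta_mul_truncMoment N hne (fun i hi h => by
    have h1 := congrArg Complex.re h
    have h2 : (i : ℝ) < 2 * N := by exact_mod_cast hi
    rw [add_re, natCast_re, zero_re] at h1
    linarith) (norm_pos_iff.1 (lt_of_lt_of_le (by linarith) b3)) (by linarith)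
  -- The cutoff lies beyond ⌈-Re s₂⌉, so the finite sum may be read as a series over all k and
  -- subtracted termwise from the cotangent series.
  have hG := hasSum_sum_of_ne_finset_zero (L := .unconditional ℕ)
    (s := Finset.range (cutoff (s₁ + s₂) + 1))
    (f := fun k : ℕ => if 2 * k + 1 < ⌈-s₂.re⌉₊ then riemannZeta ((2 * k + 2 : ℕ) : ℂ) *
      rawMoment (s₁ + s₂) (ratio₂ s₁ s₂) (2 * k + 1) *
        riemannZeta (1 - (s₁ + s₂ + (2 * k + 1 : ℕ))) else 0) (fun k hk => by
    rw [Finset.mem_range] at hk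
    exact if_neg (by omega))
  have z4 := (hasum.sub hG).norm_le_of_bounded (hU.mul_left _) z3
  have hexp : |(Real.pi / 2 * (s₁ + s₂) : ℂ).im| ≤ Real.pi / ε := by
    rw [show (Real.pi : ℂ) / 2 = ((Real.pi / 2 : ℝ) : ℂ) by push_cast; ring, im_ofReal_mul,
      abs_mul, abs_of_pos (by positivity)]
    calc _ ≤ Real.pi / 2 * (2 / ε) := by gcongr; exact hs.abs_im_add_le
      _ = _ := by field_simp
  have hsin := (norm_sin_le_exp (Real.pi / 2 * (s₁ + s₂))).trans (Real.exp_le_exp.2 hexp)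
  have hcos := (norm_cos_le_exp (Real.pi / 2 * (s₁ + s₂))).trans (Real.exp_le_exp.2 hexp)
  rw [key]
  generalize (∑' x, pairTerm (2 * cutoff (s₁ + s₂) + 1 + 3) (s₁, s₂) x) = rem at *
  generalize (∑ k ∈ Finset.range (cutoff (s₁ + s₂) + 1),
        if 2 * k + 1 < ⌈-s₂.re⌉₊ then 0 else bernCoeff (2 * k + 2) * shiftPoch (2 * k + 2) s₂ *
          riemannZeta (s₁ + s₂ + (2 * k + 2 : ℕ) - 1)) = L at *
  generalize (∑ k ∈ Finset.range (cutoff (s₁ + s₂) + 1),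
    if 2 * k + 1 < ⌈-s₂.re⌉₊ then riemannZeta ((2 * k + 2 : ℕ) : ℂ) *
      rawMoment (s₁ + s₂) (ratio₂ s₁ s₂) (2 * k + 1) *
        riemannZeta (1 - (s₁ + s₂ + (2 * k + 1 : ℕ))) else 0) = G at *
  generalize (∑ j ∈ Finset.range (2 * N + 1),
    (Real.pi : ℂ) ^ j * iteratedDeriv j Complex.cot (Real.pi * ratio₂ s₁ s₂) /
      (ascPochhammer ℂ j).eval (s₁ + s₂) * cCoeff s₁ s₂ j) = S at *
  generalize truncMomentNegOne (2 * N) (s₁ + s₂) (ratio₁ s₁ s₂) (ratio₂ s₁ s₂) = T at *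
  generalize (s₁ + s₂ - 1) / (s₂ - 1) * riemannZeta (2 - (s₁ + s₂)) = W at *
  generalize riemannZeta (1 - (s₁ + s₂)) = Z at *
  generalize Complex.sin (Real.pi / 2 * (s₁ + s₂)) = a at *
  generalize Complex.cos (Real.pi / 2 * (s₁ + s₂)) = c at *
  generalize zetaFactor (s₁ + s₂) = f at *
  set M := ‖s₁ + s₂‖ ^ (N + 1) with hM
  have hM0 : 0 < M := by positivity
  -- T, the truncated moment of order -1, is added and subtracted: it approximates the j = 0 term W
  -- and cancels the part of the moment series that comes from 1/x.
  have e : (f * (-(1 / 2) * a * Z + c / (2 * Real.pi) * W - c / Real.pi * G) + L + rem) / f -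
      (-(1 / 2) * a + 1 / 2 * c * S) =
      -(1 / 2) * (a * (Z - 1)) + 1 / (2 * Real.pi) * (c * (W - T)) +
        1 / Real.pi * (c * ((T - Real.pi * S) / 2 - G)) + L / f + rem / f := by
    field_simp
    ring
  have hpos : ∀ x : ℝ, 1 ≤ x → ∀ w : ℂ, ‖1 / (x : ℂ) * w‖ ≤ ‖w‖ := by
    intro x hx w
    rw [norm_mul, norm_div, norm_one, Complex.norm_real, Real.norm_of_nonneg (by linarith)]
    exact mul_le_of_le_one_left (norm_nonneg _) (by rw [div_le_one (by linarith)]; exact hx)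
  have n1 : ‖-(1 / 2) * (a * (Z - 1))‖ ≤ E * (C₀ / M) := by
    rw [neg_mul, norm_neg]
    refine (by simpa using hpos 2 (by norm_num) (a * (Z - 1)) :
      ‖1 / 2 * (a * (Z - 1))‖ ≤ ‖a‖ * ‖Z - 1‖).trans ?_
    gcongr
  have n2 : ‖1 / (2 * Real.pi) * (c * (W - T))‖ ≤ E * (C₀ / M) := by
    refine (by simpa using hpos (2 * Real.pi) (by linarith) (c * (W - T)) :
      ‖1 / (2 * Real.pi) * (c * (W - T))‖ ≤ ‖c‖ * ‖W - T‖).trans ?_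
    gcongr
  have n3 : ‖1 / Real.pi * (c * ((T - Real.pi * S) / 2 - G))‖ ≤ E * (C₀ / M * U) := by
    refine (hpos Real.pi (by linarith) _).trans ?_
    rw [norm_mul]
    gcongr
  rw [e]
  calc _ ≤ E * (C₀ / M) + E * (C₀ / M) + E * (C₀ / M * U) + 2 ^ (N + 1) * C₁ / M +
        2 ^ (N + 1) * C₂ / M := by
        refine (norm_add_le _ _).trans (add_le_add ?_ t2)
        refine (norm_add_le _ _).trans (add_le_add ?_ t1)
        refine (norm_add_le _ _).trans (add_le_add ?_ n3)
        exact (norm_add_le _ _).trans (add_le_add n1 n2)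
    _ = _ := by ring

theorem theorem1p1 (ε : ℝ) (hε : 0 < ε) (N : ℕ) :
    IsDoubleZetaContinuation doubleZeta ∧
    (∀ s₁ s₂ : ℂ, s₁ + s₂ ≠ 0 → ∀ j : ℕ, cCoeff s₁ s₂ j = cExplicit s₁ s₂ j) ∧
    ∃ C R : ℝ, 0 < C ∧ 0 < R ∧ ∀ s₁ s₂ : ℂ,
      |s₁.im| < 1 / ε → |s₂.im| < 1 / ε →
      ε < s₁.re / (s₁ + s₂).re → s₁.re / (s₁ + s₂).re < 1 - ε →
      (∀ k : ℤ, ‖s₁ + s₂ - 2 * (k : ℂ)‖ > ‖s₁ + s₂‖ ^ (-(1 / ε))) →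
      s₁.re < -R → s₂.re < -R →
      ‖doubleZeta (s₁, s₂) / zetaFactor (s₁ + s₂) -
          (-(1 / 2) * Complex.sin (Real.pi / 2 * (s₁ + s₂)) +
            1 / 2 * Complex.cos (Real.pi / 2 * (s₁ + s₂)) *
              ∑ j ∈ Finset.range (2 * N + 1),
                (Real.pi : ℂ) ^ j * iteratedDeriv j Complex.cot (Real.pi * ratio₂ s₁ s₂) /
                  (ascPochhammer ℂ j).eval (s₁ + s₂) * cCoeff s₁ s₂ j)‖
        ≤ C * ‖s₁ + s₂‖ ^ (-(N : ℤ) - 1) := by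
  refine ⟨isDoubleZetaContinuation_doubleZeta, fun s₁ s₂ h j => cCoeff_eq_cExplicit h j, ?_⟩
  rcases lt_or_ge ε 1 with hε1 | hε1
  swap
  -- For ε ≥ 1 no number lies between ε and 1 - ε.
  · exact ⟨1, 1, one_pos, one_pos, fun s₁ s₂ _ _ h₁ h₂ => by linarith⟩
  obtain ⟨C, R, hC, h⟩ := exists_doubleZeta_asymptotic hε hε1 N
  refine ⟨C, max R 1, hC, by positivity, fun s₁ s₂ hi₁ hi₂ hr₁ hr₂ hsep h₁ h₂ => ?_⟩
  have hR := le_max_left R 1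
  have hR1 := le_max_right R 1
  have hre : (s₁ + s₂).re < 0 := by rw [add_re]; linarith
  rw [lt_div_iff_of_neg hre] at hr₁
  rw [div_lt_iff_of_neg hre] at hr₂
  have hadd : (s₁ + s₂).re = s₁.re + s₂.re := add_re _ _
  have hadm : Admissible ε s₁ s₂ :=
    ⟨hi₁.le, hi₂.le, by linarith, by linarith, fun k => hsep k⟩
  have hdom : (s₁, s₂) ∈ doubleZetaDomain := by
    refine ⟨fun h => ?_, fun h => ?_, fun n h => ?_⟩
    · simp only at h
      rw [h, one_re] at h₂
      linarith
    · simp only at h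
      rw [h, one_re] at hre
      linarith
    · simp only at h
      -- On the hyperplane s₁ + s₂ = 2 - 2n separation fails for the integer k = 1 - n, so
      -- admissible points avoid the poles.
      have h3 := hsep (1 - n)
      rw [h] at h3
      push_cast at h3
      rw [show (2 : ℂ) - 2 * n - 2 * (1 - n) = 0 by ring, norm_zero] at h3
      exact absurd h3 (not_lt.2 (by positivity))
  refine (h s₁ s₂ hdom hadm (by linarith)).trans (le_of_eq ?_)
  rw [show -(N : ℤ) - 1 = -((N + 1 : ℕ) : ℤ) by push_cast; ring, zpow_neg, zpow_natCast,
    div_eq_mul_inv]
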